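/- All graphs are finite, simple and undirected, with $n\ge 1$ vertices; $N(v)$ is the open neighbourhood of $v$. For $\gamma\in\mathbb N$, a graph $G$ is weakly $\gamma$-closed if every nonempty induced subgraph $G'$ of $G$ has a vertex $v$ such that $|N_{G'}(v)\cap N_{G'}(w)|<\gamma$ for every vertex $w\neq v$ of $G'$ that is not adjacent to $v$. For $s\in\mathbb N$, a set $S\subseteq V(G)$ is an $s$-defective clique if $G[S]$ has at least $\binom{|S|}{2}-s$ edges; it is maximal if no proper superset of $S$ is an $s$-defective clique. Running times are numbers of steps of a random access machine with unit costs that reads the adjacency matrix of $G$ (one step per entry) and whose arithmetic operations are increment and decrement. Theorem. There are an absolute constant $C$ and two fixed programs such that for all $s\ge 2$, all $\gamma\ge 0$ and every weakly $\gamma$-closed graph $G$ with $n\ge 1$ vertices: (1) $G$ has at most $C\cdot 2^{\gamma} n^{s+1}$ maximal $s$-defective cliques. (2) The first program, given $G$, $n$ and $s$, prints all maximal $s$-defective cliques of $G$, each exactly once (as characteristic vectors), and halts within $C\cdot 2^{\gamma} n^{s+3}$ steps. (3) The second program, given $G$, $n$, $s$ and $k\in\mathbb N$, decides within $C\cdot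 2^{\gamma} n^{s+3}$ steps whether $G$ has an $s$-defective clique with at least $k$ vertices (the problem $s$-Defective Clique). -/

import Mathlib

namespace DefClique

/-! ### Graph notions -/

section Graph

variable {V : Type*}

/-- `cl_G(v) < γ`: every non-neighbour `w ≠ v` of `v` has fewer than `γ` common neighbours
with `v` (vacuously true if `v` is adjacent to all other vertices). -/
def ClosureLT (G : SimpleGraph V) (v : V) (γ : ℕ) : Prop :=
  ∀ w : V, w ≠ v → ¬ G.Adj v w → (G.commonNeighbors v w).ncard < γ

/-- `G` is weakly `γ`-closed: every (nonempty) induced subgraph `G[X]` has a vertex `v` with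
`cl_{G[X]}(v) < γ`. -/
def IsWeaklyClosed (G : SimpleGraph V) (γ : ℕ) : Prop :=
  ∀ X : Set V, X.Nonempty → ∃ v : X, ClosureLT (G.induce X) v γ

/-- `S` is an `s`-defective clique: `G[S]` has at least `|S|.choose 2 - s` edges. -/
def IsDefectiveClique (G : SimpleGraph V) (s : ℕ) (S : Finset V) : Prop :=
  S.card.choose 2 ≤ (G.induce (S : Set V)).edgeSet.ncard + s

/-- `S` is an inclusion-maximal `s`-defective clique. -/
def IsMaximalDefectiveClique (G : SimpleGraph V) (s : ℕ) (S : Finset V) : Prop :=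
  Maximal (IsDefectiveClique G s) S

end Graph

/-! ### A random access machine with a step count

Programs are structured programs over registers and random access arrays.  Every elementary
operation and every evaluation of a test costs one step.  The input graph is given by its
adjacency matrix, whose entries can be read in one step each.  The only arithmetic operations are
increment and decrement, so that within `t` steps no value exceeds the largest input number or
program constant by more than `t`: unit cost charges never hide operations on long numbers. -/

/-- Comparisons between two registers. -/
inductive Test where
  | lt (x y : ℕ)
  | eq (x y : ℕ)

/-- Programs.  The letters `x y z` are names of registers, and `a` is the name of an array. -/
inductive Prog where
  /-- do nothing -/
  | skip
  /-- `x := c` -/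
  | const (x c : ℕ)
  /-- `x := y` -/
  | copy (x y : ℕ)
  /-- `x := x + 1` -/
  | inc (x : ℕ)
  /-- `x := x - 1`, where `0 - 1 = 0` -/
  | dec (x : ℕ)
  /-- `x := a[y]` -/
  | load (x a y : ℕ)
  /-- `a[x] := y` -/
  | store (a x y : ℕ)
  /-- `x := 1` if the vertices with numbers `y` and `z` are adjacent, `x := 0` otherwise -/
  | edge (x y z : ℕ)
  /-- append the content of `x` to the output -/
  | print (x : ℕ)
  /-- first `p`, then `q` -/
  | seq (p q : Prog)
  /-- if `b` then `p` else `q` -/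
  | ite (b : Test) (p q : Prog)
  /-- while `b` do `p` -/
  | loop (b : Test) (p : Prog)

/-- Memory contents: registers, arrays (name, index), and the output printed so far. -/
structure State where
  reg : ℕ → ℕ
  arr : ℕ → ℕ → ℕ
  out : List ℕ

/-- Assign the value `v` to register `x`. -/
def State.set (σ : State) (x v : ℕ) : State :=
  { σ with reg := Function.update σ.reg x v }

/-- Assign the value `v` to cell `i` of array `a`. -/
def State.setArr (σ : State) (a i v : ℕ) : State :=
  { σ with arr := Function.update σ.arr a (Function.update (σ.arr a) i v) }

/-- Append the value `v` to the output. -/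
def State.write (σ : State) (v : ℕ) : State :=
  { σ with out := σ.out ++ [v] }

/-- Truth of a test in a state. -/
def Test.Holds (σ : State) : Test → Prop
  | .lt x y => σ.reg x < σ.reg y
  | .eq x y => σ.reg x = σ.reg y

open Classical in
/-- The adjacency matrix of a graph with vertices `0, …, n - 1` (entries outside are `0`). -/
noncomputable def adjEntry {n : ℕ} (G : SimpleGraph (Fin n)) (i j : ℕ) : ℕ :=
  if ∃ (hi : i < n) (hj : j < n), G.Adj ⟨i, hi⟩ ⟨j, hj⟩ then 1 else 0

/-- `Runs G p σ τ t`: on the input graph `G`, the program `p` started in state `σ` halts in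
state `τ` after exactly `t` steps. -/
inductive Runs {n : ℕ} (G : SimpleGraph (Fin n)) : Prog → State → State → ℕ → Prop where
  | skip (σ : State) : Runs G .skip σ σ 1
  | const (σ : State) (x c : ℕ) : Runs G (.const x c) σ (σ.set x c) 1
  | copy (σ : State) (x y : ℕ) : Runs G (.copy x y) σ (σ.set x (σ.reg y)) 1
  | inc (σ : State) (x : ℕ) : Runs G (.inc x) σ (σ.set x (σ.reg x + 1)) 1
  | dec (σ : State) (x : ℕ) : Runs G (.dec x) σ (σ.set x (σ.reg x - 1)) 1
  | load (σ : State) (x a y : ℕ) : Runs G (.load x a y) σ (σ.set x (σ.arr a (σ.reg y))) 1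
  | store (σ : State) (a x y : ℕ) :
      Runs G (.store a x y) σ (σ.setArr a (σ.reg x) (σ.reg y)) 1
  | edge (σ : State) (x y z : ℕ) :
      Runs G (.edge x y z) σ (σ.set x (adjEntry G (σ.reg y) (σ.reg z))) 1
  | print (σ : State) (x : ℕ) : Runs G (.print x) σ (σ.write (σ.reg x)) 1
  | seq {p q : Prog} {σ ρ τ : State} {t u : ℕ} :
      Runs G p σ ρ t → Runs G q ρ τ u → Runs G (.seq p q) σ τ (t + u)
  | ite_true {b : Test} {p q : Prog} {σ τ : State} {t : ℕ} :
      b.Holds σ → Runs G p σ τ t → Runs G (.ite b p q) σ τ (t + 1)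
  | ite_false {b : Test} {p q : Prog} {σ τ : State} {t : ℕ} :
      ¬ b.Holds σ → Runs G q σ τ t → Runs G (.ite b p q) σ τ (t + 1)
  | loop_done {b : Test} {p : Prog} {σ : State} :
      ¬ b.Holds σ → Runs G (.loop b p) σ σ 1
  | loop_step {b : Test} {p : Prog} {σ ρ τ : State} {t u : ℕ} :
      b.Holds σ → Runs G p σ ρ t → Runs G (.loop b p) ρ τ u →
        Runs G (.loop b p) σ τ (t + u + 1)

/-- The initial state: the numbers `args` stand in the registers `0, 1, …`; all other registers
and all array cells hold `0`, and nothing has been printed. -/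
def init (args : List ℕ) : State where
  reg i := args.getD i 0
  arr _ _ := 0
  out := []

/-- On the input graph `G` and the input numbers `args`, the program `p` halts within `T` steps
and has then printed exactly `w`. -/
def PrintsWithin {n : ℕ} (G : SimpleGraph (Fin n)) (p : Prog) (args : List ℕ) (w : List ℕ)
    (T : ℕ) : Prop :=
  ∃ (τ : State) (t : ℕ), Runs G p (init args) τ t ∧ τ.out = w ∧ t ≤ T

/-- The characteristic vector of a vertex set: `n` entries, each `0` or `1`. -/
def charVec {n : ℕ} (S : Finset (Fin n)) : List ℕ :=
  List.ofFn fun i : Fin n => if i ∈ S then 1 else 0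

/-- The program `p`, given `G`, `n` and `s`, lists all maximal `s`-defective cliques of `G`, each
exactly once and in any order, as consecutive characteristic vectors, within `T` steps. -/
def EnumeratesWithin {n : ℕ} (G : SimpleGraph (Fin n)) (s : ℕ) (p : Prog) (T : ℕ) : Prop :=
  ∃ L : List (Finset (Fin n)),
    L.Nodup ∧ (∀ S, S ∈ L ↔ IsMaximalDefectiveClique G s S) ∧
      PrintsWithin G p [n, s] (L.flatMap charVec) T

open Classical in
/-- The program `p`, given `G`, `n`, `s` and `k`, decides within `T` steps whether `G` has an
`s`-defective clique with at least `k` vertices: it prints `1` for yes and `0` for no. -/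
def DecidesWithin {n : ℕ} (G : SimpleGraph (Fin n)) (s k : ℕ) (p : Prog) (T : ℕ) : Prop :=
  PrintsWithin G p [n, s, k]
    [if ∃ S : Finset (Fin n), k ≤ S.card ∧ IsDefectiveClique G s S then 1 else 0] T

end DefClique

/-! Weak closure yields an order of deletion in which every vertex v, when it is deleted from the
remaining set X, has fewer than γ common neighbours in X with each of its nonneighbours u in X.
Hence the set `cand G X v u` always has at most γ + 1 elements.

Let S be a maximal s-defective clique, and delete the vertices one by one from the graph and from S.
While the trace T of S stays maximal in the remaining graph, nothing is lost: offering the deleted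
vertices again in reverse order, and accepting each one that respects the budget s, restores S
(`MaxIn.ins_erase`). So it suffices to know T \ v at the first step where maximality breaks. There v
∈ T, and some u ∉ T fits in the place of v (`MaxIn.erase_or`). If v has a nonneighbour w in T, then
at most s - 1 missing edges other than vw meet v or w, so all but s - 1 vertices of T \ v lie in the
candidate set of v and w. If v is adjacent to the rest of T, then u is not adjacent to v, because
otherwise u could be added to T; the neighbours of u in T \ v are candidates for v and u, and at
most s - 1 vertices are left over provided that T \ v has a missing edge (`mem_of_not_maxIn`).

If T \ v is a clique, u may miss s of its vertices, which would cost another factor n. This is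
avoided by repeating the argument with budget 0: the clique is followed through deletions until it
stops being a maximal clique or the graph is used up (`mem_of_maxIn_zero`). A clique with a
replacement u for v lies, apart from v, entirely in the candidate set, so no further vertices have
to be guessed. Only the position where the budget switches from 0 to s has to be guessed, and since
s ≥ 2 these at most n choices are absorbed by n^(s-1).

Thus S is determined by v, u, a subset of at most γ + 1 candidates, and either at most s - 1
vertices or a switch position. This gives the bound n · n · 2^γ · n^(s-1), up to a constant.

The programs generate these greedy extensions, in O(n²) steps each. They need not know γ, since
every stage picks a vertex minimising the largest number of candidates. An odometer runs through the
choices. All results are s-defective cliques by construction; the decision program compares their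
sizes with k, and the enumeration program tests maximality and removes duplicates with a trie. Both
are instances of one correctness theorem, `ter_enumeration`, with an abstract routine `emit` for
treating a set. -/

namespace DefClique

/-! ### Running programs: a calculus of total correctness with time -/

section Calculus

variable {n : ℕ} {G : SimpleGraph (Fin n)}

/-- The program `p` started in `σ` halts in a state `τ` after `t` steps such that `Q τ t`. -/
def Ter (G : SimpleGraph (Fin n)) (p : Prog) (σ : State) (Q : State → ℕ → Prop) : Prop :=
  ∃ τ t, Runs G p σ τ t ∧ Q τ t

theorem Ter.mono {p : Prog} {σ : State} {Q Q' : State → ℕ → Prop} (h : Ter G p σ Q)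
    (hQ : ∀ τ t, Q τ t → Q' τ t) : Ter G p σ Q' := by
  obtain ⟨τ, t, hr, hq⟩ := h
  exact ⟨τ, t, hr, hQ τ t hq⟩

-- This equivalence and its companions below act as weakest-precondition rules: with them `simp`
-- executes loop-free code symbolically and adds up the steps.
@[simp]
theorem ter_skip {σ : State} {Q : State → ℕ → Prop} : Ter G .skip σ Q ↔ Q σ 1 :=
  ⟨fun ⟨_, _, h, hq⟩ => by cases h; exact hq, fun h => ⟨_, _, .skip σ, h⟩⟩

@[simp]
theorem ter_const {σ : State} {x c : ℕ} {Q : State → ℕ → Prop} :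
    Ter G (.const x c) σ Q ↔ Q (σ.set x c) 1 :=
  ⟨fun ⟨_, _, h, hq⟩ => by cases h; exact hq, fun h => ⟨_, _, .const σ x c, h⟩⟩

@[simp]
theorem ter_copy {σ : State} {x y : ℕ} {Q : State → ℕ → Prop} :
    Ter G (.copy x y) σ Q ↔ Q (σ.set x (σ.reg y)) 1 :=
  ⟨fun ⟨_, _, h, hq⟩ => by cases h; exact hq, fun h => ⟨_, _, .copy σ x y, h⟩⟩

@[simp]
theorem ter_inc {σ : State} {x : ℕ} {Q : State → ℕ → Prop} :
    Ter G (.inc x) σ Q ↔ Q (σ.set x (σ.reg x + 1)) 1 :=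
  ⟨fun ⟨_, _, h, hq⟩ => by cases h; exact hq, fun h => ⟨_, _, .inc σ x, h⟩⟩

@[simp]
theorem ter_dec {σ : State} {x : ℕ} {Q : State → ℕ → Prop} :
    Ter G (.dec x) σ Q ↔ Q (σ.set x (σ.reg x - 1)) 1 :=
  ⟨fun ⟨_, _, h, hq⟩ => by cases h; exact hq, fun h => ⟨_, _, .dec σ x, h⟩⟩

@[simp]
theorem ter_load {σ : State} {x a y : ℕ} {Q : State → ℕ → Prop} :
    Ter G (.load x a y) σ Q ↔ Q (σ.set x (σ.arr a (σ.reg y))) 1 :=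
  ⟨fun ⟨_, _, h, hq⟩ => by cases h; exact hq, fun h => ⟨_, _, .load σ x a y, h⟩⟩

@[simp]
theorem ter_store {σ : State} {a x y : ℕ} {Q : State → ℕ → Prop} :
    Ter G (.store a x y) σ Q ↔ Q (σ.setArr a (σ.reg x) (σ.reg y)) 1 :=
  ⟨fun ⟨_, _, h, hq⟩ => by cases h; exact hq, fun h => ⟨_, _, .store σ a x y, h⟩⟩

@[simp]
theorem ter_edge {σ : State} {x y z : ℕ} {Q : State → ℕ → Prop} :
    Ter G (.edge x y z) σ Q ↔ Q (σ.set x (adjEntry G (σ.reg y) (σ.reg z))) 1 :=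
  ⟨fun ⟨_, _, h, hq⟩ => by cases h; exact hq, fun h => ⟨_, _, .edge σ x y z, h⟩⟩

@[simp]
theorem ter_print {σ : State} {x : ℕ} {Q : State → ℕ → Prop} :
    Ter G (.print x) σ Q ↔ Q (σ.write (σ.reg x)) 1 :=
  ⟨fun ⟨_, _, h, hq⟩ => by cases h; exact hq, fun h => ⟨_, _, .print σ x, h⟩⟩

@[simp]
theorem ter_seq {p q : Prog} {σ : State} {Q : State → ℕ → Prop} :
    Ter G (.seq p q) σ Q ↔ Ter G p σ fun ρ t => Ter G q ρ fun τ u => Q τ (t + u) := by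
  constructor
  · rintro ⟨τ, _, h, hq⟩
    cases h with
    | seq h₁ h₂ => exact ⟨_, _, h₁, _, _, h₂, hq⟩
  · rintro ⟨ρ, t, h₁, τ, u, h₂, hq⟩
    exact ⟨τ, _, .seq h₁ h₂, hq⟩

@[simp]
theorem ter_ite {b : Test} {p q : Prog} {σ : State} {Q : State → ℕ → Prop} :
    Ter G (.ite b p q) σ Q ↔
      (b.Holds σ → Ter G p σ fun τ t => Q τ (t + 1)) ∧
        (¬ b.Holds σ → Ter G q σ fun τ t => Q τ (t + 1)) := by
  constructor
  · rintro ⟨τ, _, h, hq⟩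
    cases h with
    | ite_true hb h => exact ⟨fun _ => ⟨_, _, h, hq⟩, fun h' => absurd hb h'⟩
    | ite_false hb h => exact ⟨fun h' => absurd h' hb, fun _ => ⟨_, _, h, hq⟩⟩
  · rintro ⟨h₁, h₂⟩
    by_cases hb : b.Holds σ
    · obtain ⟨τ, t, h, hq⟩ := h₁ hb
      exact ⟨τ, _, .ite_true hb h, hq⟩
    · obtain ⟨τ, t, h, hq⟩ := h₂ hb
      exact ⟨τ, _, .ite_false hb h, hq⟩

@[simp]
theorem holds_lt {σ : State} {x y : ℕ} : (Test.lt x y).Holds σ ↔ σ.reg x < σ.reg y := Iff.rfl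

@[simp]
theorem holds_eq {σ : State} {x y : ℕ} : (Test.eq x y).Holds σ ↔ σ.reg x = σ.reg y := Iff.rfl

@[simp]
theorem State.set_reg (σ : State) (x v y : ℕ) :
    (σ.set x v).reg y = if y = x then v else σ.reg y := by
  simp [State.set, Function.update_apply]

@[simp]
theorem State.set_arr (σ : State) (x v : ℕ) : (σ.set x v).arr = σ.arr := rfl

@[simp]
theorem State.set_out (σ : State) (x v : ℕ) : (σ.set x v).out = σ.out := rfl

@[simp]
theorem State.setArr_reg (σ : State) (a i v : ℕ) : (σ.setArr a i v).reg = σ.reg := rfl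

@[simp]
theorem State.setArr_arr (σ : State) (a i v b j : ℕ) :
    (σ.setArr a i v).arr b j = if b = a then (if j = i then v else σ.arr a j) else σ.arr b j := by
  by_cases h : b = a
  · subst h
    simp [State.setArr, Function.update_apply]
  · simp [State.setArr, h]

@[simp]
theorem State.write_out (σ : State) (v : ℕ) : (σ.write v).out = σ.out ++ [v] := rfl

/-- The registers that a program may change. -/
def Prog.regs : Prog → List ℕ
  | .skip => []
  | .const x _ => [x]
  | .copy x _ => [x]
  | .inc x => [x]
  | .dec x => [x]
  | .load x _ _ => [x]
  | .store _ _ _ => []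
  | .edge x _ _ => [x]
  | .print _ => []
  | .seq p q => p.regs ++ q.regs
  | .ite _ p q => p.regs ++ q.regs
  | .loop _ p => p.regs

/-- The arrays that a program may change. -/
def Prog.arrs : Prog → List ℕ
  | .store a _ _ => [a]
  | .seq p q => p.arrs ++ q.arrs
  | .ite _ p q => p.arrs ++ q.arrs
  | .loop _ p => p.arrs
  | _ => []

/-- Whether a program contains a print instruction. -/
def Prog.prints : Prog → Bool
  | .print _ => true
  | .seq p q => p.prints || q.prints
  | .ite _ p q => p.prints || q.prints
  | .loop _ p => p.prints
  | _ => false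

/-- `σ` and `τ` differ only in what the program `p` may change. -/
structure Agree (p : Prog) (σ τ : State) : Prop where
  reg : ∀ x, x ∉ p.regs → τ.reg x = σ.reg x
  arr : ∀ a, a ∉ p.arrs → τ.arr a = σ.arr a
  out : p.prints = false → τ.out = σ.out

theorem Agree.refl (p : Prog) (σ : State) : Agree p σ σ :=
  ⟨fun _ _ => rfl, fun _ _ => rfl, fun _ => rfl⟩

theorem Agree.trans {p : Prog} {σ ρ τ : State} (h : Agree p σ ρ) (h' : Agree p ρ τ) :
    Agree p σ τ :=
  ⟨fun x hx => (h'.reg x hx).trans (h.reg x hx), fun a ha => (h'.arr a ha).trans (h.arr a ha),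
    fun hp => (h'.out hp).trans (h.out hp)⟩

theorem Agree.of_subset {p q : Prog} {σ τ : State} (h : Agree p σ τ) (hr : p.regs ⊆ q.regs)
    (ha : p.arrs ⊆ q.arrs) (hp : q.prints = false → p.prints = false) : Agree q σ τ :=
  ⟨fun x hx => h.reg x fun h' => hx (hr h'), fun a hx => h.arr a fun h' => hx (ha h'),
    fun h' => h.out (hp h')⟩

/-- The frame is read off the syntax, so for concrete programs "this register is untouched" is
settled by `decide`, and loop invariants need to mention only what changes. -/
theorem Runs.agree {p : Prog} {σ τ : State} {t : ℕ} (h : Runs G p σ τ t) : Agree p σ τ := by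
  induction h with
  | skip | loop_done => exact Agree.refl _ _
  | const | copy | inc | dec | load | edge =>
    exact ⟨fun y hy => by rw [State.set_reg, if_neg (by simpa [Prog.regs] using hy)],
      fun _ _ => rfl, fun _ => rfl⟩
  | store σ a x y =>
    refine ⟨fun _ _ => rfl, fun b hb => ?_, fun _ => rfl⟩
    funext j
    rw [State.setArr_arr, if_neg (by simpa [Prog.arrs] using hb)]
  | print => exact ⟨fun _ _ => rfl, fun _ _ => rfl, fun h => by simp [Prog.prints] at h⟩
  | seq _ _ ih₁ ih₂ =>
    exact (ih₁.of_subset (by simp [Prog.regs]) (by simp [Prog.arrs])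
      (by simp +contextual [Prog.prints])).trans
      (ih₂.of_subset (by simp [Prog.regs]) (by simp [Prog.arrs])
      (by simp +contextual [Prog.prints]))
  | ite_true _ _ ih =>
    exact ih.of_subset (by simp [Prog.regs]) (by simp [Prog.arrs])
      (by simp +contextual [Prog.prints])
  | ite_false _ _ ih =>
    exact ih.of_subset (by simp [Prog.regs]) (by simp [Prog.arrs])
      (by simp +contextual [Prog.prints])
  | loop_step _ _ _ ih₁ ih₂ => exact (ih₁.of_subset (by simp [Prog.regs]) (by simp [Prog.arrs])
      (by simp [Prog.prints])).trans ih₂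

theorem Ter.agree {p : Prog} {σ : State} {Q : State → ℕ → Prop} (h : Ter G p σ Q) :
    Ter G p σ fun τ t => Q τ t ∧ Agree p σ τ := by
  obtain ⟨τ, t, hr, hq⟩ := h
  exact ⟨τ, t, hr, hq, hr.agree⟩

/-- Sequential composition, with the frame of the first program. -/
theorem Ter.bind {p q : Prog} {σ : State} {Q Q' : State → ℕ → Prop} (h : Ter G p σ Q)
    (hQ : ∀ ρ t, Q ρ t → Agree p σ ρ → Ter G q ρ fun τ u => Q' τ (t + u)) :
    Ter G (.seq p q) σ Q' :=
  ter_seq.2 (h.agree.mono fun ρ t h' => hQ ρ t h'.1 h'.2)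

/-- While `x < y` do `p` and increase `x`. -/
def Prog.forLoop (x y : ℕ) (p : Prog) : Prog := .loop (.lt x y) (.seq p (.inc x))

/-- The rule for counting loops. -/
theorem Ter.forLoop {x y c : ℕ} {p : Prog} {σ : State} (I : ℕ → State → Prop)
    (hx : x ∉ p.regs) (hy : y ∉ x :: p.regs) (h0 : I (σ.reg x) σ)
    (hstep : ∀ k ρ, σ.reg x ≤ k → k < σ.reg y → ρ.reg x = k → Agree (Prog.forLoop x y p) σ ρ →
      I k ρ → Ter G p ρ fun τ t => t ≤ c ∧ I (k + 1) (τ.set x (k + 1))) :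
    Ter G (Prog.forLoop x y p) σ fun τ t =>
      t ≤ (σ.reg y - σ.reg x) * (c + 2) + 1 ∧ I (max (σ.reg x) (σ.reg y)) τ ∧
        τ.reg x = max (σ.reg x) (σ.reg y) := by
  obtain ⟨d, hd⟩ : ∃ d, d = σ.reg y - σ.reg x := ⟨_, rfl⟩
  have hxy : y ≠ x := fun h => hy (by simp [h])
  have hyp : y ∉ p.regs := fun h => hy (by simp [h])
  induction d generalizing σ with
  | zero =>
    refine ⟨σ, 1, .loop_done (by simp only [holds_lt]; omega), by omega, ?_, ?_⟩
    · rwa [max_eq_left (by omega)]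
    · rw [max_eq_left (by omega)]
  | succ d ih =>
    obtain ⟨ρ, t, hr, ht, hI⟩ := hstep _ σ le_rfl (by omega) rfl (Agree.refl _ _) h0
    have hag := hr.agree
    have hρx : ρ.reg x = σ.reg x := hag.reg x hx
    have hρy : ρ.reg y = σ.reg y := hag.reg y hyp
    have hrun : Runs G (.seq p (.inc x)) σ (ρ.set x (ρ.reg x + 1)) (t + 1) := .seq hr (.inc ρ x)
    have hag' : Agree (Prog.forLoop x y p) σ (ρ.set x (ρ.reg x + 1)) :=
      ⟨hrun.agree.reg, hrun.agree.arr, hrun.agree.out⟩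
    have e1 : (ρ.set x (ρ.reg x + 1)).reg x = σ.reg x + 1 := by simp [State.set_reg, hρx]
    have e2 : (ρ.set x (ρ.reg x + 1)).reg y = σ.reg y := by simp [State.set_reg, hρy, hxy]
    obtain ⟨τ, u, hr', hu, hI', hx'⟩ := ih (σ := ρ.set x (ρ.reg x + 1))
      (by rw [e1, hρx]; exact hI)
      (fun k ρ' h1 h2 h3 h4 h5 => hstep k ρ' (by omega) (by omega) h3 (hag'.trans h4) h5)
      (by omega)
    refine ⟨τ, t + 1 + u + 1, .loop_step (by simp only [holds_lt]; omega) hrun hr', ?_, ?_, ?_⟩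
    · rw [e1, e2] at hu
      have : σ.reg y - σ.reg x = (σ.reg y - (σ.reg x + 1)) + 1 := by omega
      rw [this, add_mul]
      omega
    · rw [e1, e2] at hI'
      rwa [max_eq_right (by omega)] at hI' ⊢
    · rw [e1, e2] at hx'
      rw [hx', max_eq_right (by omega), max_eq_right (by omega)]

theorem adjEntry_eq (G : SimpleGraph (Fin n)) [DecidableRel G.Adj] (u v : Fin n) :
    adjEntry G u v = if G.Adj u v then 1 else 0 := by
  simp [adjEntry]

end Calculus

/-! ### Missing edges and greedy extensions -/

section Greedy

variable {V : Type*} (G : SimpleGraph V)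

/-- The number of missing edges in `G[S]`. -/
noncomputable def miss (S : Finset V) : ℕ :=
  S.card.choose 2 - (G.induce (S : Set V)).edgeSet.ncard

/-- Moves the edges from the subtype into `Sym2 V`, where the edge sets for different S can be
compared. -/
theorem ncard_edgeSet_induce [DecidableEq V] [DecidableRel G.Adj] (S : Finset V) :
    (G.induce (S : Set V)).edgeSet.ncard = (S.sym2.filter (· ∈ G.edgeSet)).card := by
  rw [← Set.ncard_coe_finset,
    ← Set.ncard_image_of_injective _ (Sym2.map.injective (Subtype.val_injective (p := (· ∈ S))))]
  congr 1
  ext e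
  induction e using Sym2.ind with
  | _ a b =>
    constructor
    · rintro ⟨e, he, hab⟩
      induction e using Sym2.ind with
      | _ c d =>
        rw [← hab]
        simpa using he
    · intro h
      simp only [Finset.coe_filter, Finset.mk_mem_sym2_iff, Set.mem_ofPred_eq] at h
      exact ⟨s(⟨a, h.1.1⟩, ⟨b, h.1.2⟩), by simpa using h.2, rfl⟩

/-- Guarantees that the truncated subtraction in `miss` is exact. -/
theorem ncard_edgeSet_le (S : Finset V) :
    (G.induce (S : Set V)).edgeSet.ncard ≤ S.card.choose 2 := by
  classical
  rw [ncard_edgeSet_induce, ← Sym2.card_image_offDiag]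
  refine Finset.card_le_card fun e => ?_
  induction e using Sym2.ind with
  | _ a b =>
    intro h
    simp only [Finset.mem_filter, Finset.mk_mem_sym2_iff, SimpleGraph.mem_edgeSet] at h
    exact Finset.mem_image.2 ⟨(a, b), Finset.mem_offDiag.2 ⟨h.1.1, h.1.2, h.2.ne⟩, rfl⟩

variable {G}

theorem isDefectiveClique_iff {d : ℕ} {S : Finset V} :
    IsDefectiveClique G d S ↔ miss G S ≤ d := by
  have := ncard_edgeSet_le G S
  unfold IsDefectiveClique miss
  omega

theorem miss_empty : miss G (∅ : Finset V) = 0 := by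
  simp [miss]

variable [DecidableEq V] [DecidableRel G.Adj]

/-- The new pairs are those of x with the elements of S; the ones that are not edges are the new
missing edges. All counting of missing edges, in the proofs and in the programs, goes through this
recursion. -/
theorem miss_insert {S : Finset V} {x : V} (hx : x ∉ S) :
    miss G (insert x S) = miss G S + (S.filter fun w => ¬ G.Adj x w).card := by
  have h1 := ncard_edgeSet_le G S
  have h2 : (G.induce ((insert x S : Finset V) : Set V)).edgeSet.ncard =
      (G.induce (S : Set V)).edgeSet.ncard + (S.filter fun w => G.Adj x w).card := by
    have hd : Disjoint ((S.filter fun w => G.Adj x w).image fun w => s(x, w))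
        (S.sym2.filter (· ∈ G.edgeSet)) := by
      refine Finset.disjoint_left.2 fun e he he' => ?_
      obtain ⟨w, -, rfl⟩ := Finset.mem_image.1 he
      exact hx (Finset.mk_mem_sym2_iff.1 (Finset.mem_filter.1 he').1).1
    have hi : ((S.filter fun w => G.Adj x w).image fun w => s(x, w)).card =
        (S.filter fun w => G.Adj x w).card :=
      Finset.card_image_of_injective _ fun a b h => Sym2.congr_right.1 h
    rw [ncard_edgeSet_induce, ncard_edgeSet_induce, ← hi, add_comm,
      ← Finset.card_union_of_disjoint hd]
    congr 1
    ext e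
    induction e using Sym2.ind with
    | _ a b =>
      simp only [Finset.mem_filter, Finset.mk_mem_sym2_iff, Finset.mem_union, Finset.mem_image,
        SimpleGraph.mem_edgeSet, Finset.mem_insert, Sym2.eq_iff]
      constructor
      · rintro ⟨⟨rfl | ha, rfl | hb⟩, hab⟩
        · exact absurd rfl hab.ne
        · exact Or.inl ⟨b, ⟨hb, hab⟩, by simp⟩
        · exact Or.inl ⟨a, ⟨ha, hab.symm⟩, by simp⟩
        · exact Or.inr ⟨⟨ha, hb⟩, hab⟩
      · rintro (⟨w, ⟨hw, hxw⟩, ⟨rfl, rfl⟩ | ⟨rfl, rfl⟩⟩ | ⟨⟨ha, hb⟩, hab⟩)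
        · exact ⟨⟨Or.inl rfl, Or.inr hw⟩, hxw⟩
        · exact ⟨⟨Or.inr hw, Or.inl rfl⟩, hxw.symm⟩
        · exact ⟨⟨Or.inr ha, Or.inr hb⟩, hab⟩
  have h3 := S.card_filter_add_card_filter_not (fun w => G.Adj x w)
  have h4 : (insert x S).card.choose 2 = S.card + S.card.choose 2 := by
    rw [Finset.card_insert_of_notMem hx, Nat.choose_succ_succ' S.card 1, Nat.choose_one_right]
  unfold miss
  omega

omit [DecidableRel G.Adj] in
theorem miss_le_insert (S : Finset V) (x : V) : miss G S ≤ miss G (insert x S) := by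
  classical
  by_cases hx : x ∈ S
  · rw [Finset.insert_eq_of_mem hx]
  · rw [miss_insert hx]
    omega

omit [DecidableEq V] [DecidableRel G.Adj] in
theorem miss_mono {S T : Finset V} (h : S ⊆ T) : miss G S ≤ miss G T := by
  classical
  have key : ∀ U : Finset V, miss G S ≤ miss G (S ∪ U) := by
    intro U
    induction U using Finset.induction_on with
    | empty => simp
    | insert x U _ ih =>
      rw [Finset.union_insert]
      exact ih.trans (miss_le_insert _ _)
  have := key T
  rwa [Finset.union_eq_right.2 h] at this

omit [DecidableEq V] [DecidableRel G.Adj] in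
theorem IsDefectiveClique.subset {d : ℕ} {S T : Finset V} (hT : IsDefectiveClique G d T)
    (h : S ⊆ T) : IsDefectiveClique G d S :=
  isDefectiveClique_iff.2 ((miss_mono h).trans (isDefectiveClique_iff.1 hT))

omit [DecidableEq V] [DecidableRel G.Adj] in
theorem isDefectiveClique_empty (d : ℕ) : IsDefectiveClique G d ∅ :=
  isDefectiveClique_iff.2 (by simp [miss_empty])

omit [DecidableEq V] [DecidableRel G.Adj] in
theorem IsDefectiveClique.mono {d e : ℕ} {S : Finset V} (hS : IsDefectiveClique G d S)
    (h : d ≤ e) : IsDefectiveClique G e S :=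
  isDefectiveClique_iff.2 ((isDefectiveClique_iff.1 hS).trans h)

-- Since defective cliques are closed under subsets, a proper extension yields one by a single
-- vertex; so maximality can be tested vertex by vertex.
omit [DecidableEq V] [DecidableRel G.Adj] in
theorem isMaximalDefectiveClique_iff [DecidableEq V] {s : ℕ} {S : Finset V} :
    IsMaximalDefectiveClique G s S ↔
      IsDefectiveClique G s S ∧ ∀ x, x ∉ S → ¬ IsDefectiveClique G s (insert x S) := by
  constructor
  · intro h
    exact ⟨h.1, fun x hx h' => hx (h.2 h' (Finset.subset_insert x S) (Finset.mem_insert_self x S))⟩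
  · rintro ⟨h1, h2⟩
    refine ⟨h1, fun T hT hST => ?_⟩
    by_contra hTS
    obtain ⟨x, hxT, hxS⟩ := Finset.not_subset.1 hTS
    exact h2 x hxS (IsDefectiveClique.subset hT (Finset.insert_subset hxT hST))

variable (G) in
open Classical in
/-- Insert `x` into `S` if the result is a `d`-defective clique. -/
noncomputable def ins (d : ℕ) (S : Finset V) (x : V) : Finset V :=
  if IsDefectiveClique G d (insert x S) then insert x S else S

omit [DecidableRel G.Adj] in
theorem ins_of_mem {d : ℕ} {S : Finset V} {x : V} (hx : x ∈ S) : ins G d S x = S := by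
  simp [ins, Finset.insert_eq_of_mem hx]

omit [DecidableRel G.Adj] in
theorem ins_pos {d : ℕ} {S : Finset V} {x : V} (h : IsDefectiveClique G d (insert x S)) :
    ins G d S x = insert x S := if_pos h

omit [DecidableRel G.Adj] in
theorem ins_neg {d : ℕ} {S : Finset V} {x : V} (h : ¬ IsDefectiveClique G d (insert x S)) :
    ins G d S x = S := if_neg h

omit [DecidableRel G.Adj] in
theorem isDefectiveClique_ins {d : ℕ} {S : Finset V} {x : V} (h : IsDefectiveClique G d S) :
    IsDefectiveClique G d (ins G d S x) := by
  unfold ins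
  split_ifs with h'
  · exact h'
  · exact h

omit [DecidableRel G.Adj] in
theorem isDefectiveClique_foldl {d : ℕ} (l : List V) {S : Finset V}
    (h : IsDefectiveClique G d S) : IsDefectiveClique G d (l.foldl (ins G d) S) := by
  induction l generalizing S with
  | nil => exact h
  | cons x l ih => exact ih (isDefectiveClique_ins h)

-- By heredity no insertion on the way to a defective clique is ever refused. Hence a correctly
-- guessed set is built exactly, in whatever order its elements arrive.
omit [DecidableRel G.Adj] in
theorem foldl_ins_of_isDefectiveClique {d : ℕ} (l : List V) {S : Finset V}
    (h : IsDefectiveClique G d (S ∪ l.toFinset)) : l.foldl (ins G d) S = S ∪ l.toFinset := by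
  induction l generalizing S with
  | nil => simp
  | cons x l ih =>
    have e : S ∪ (x :: l).toFinset = insert x S ∪ l.toFinset := by
      rw [List.toFinset_cons, Finset.union_insert, Finset.insert_union]
    rw [e] at h ⊢
    rw [List.foldl_cons, ins_pos (h.subset Finset.subset_union_left), ih h]

end Greedy

/-! ### Every maximal defective clique is a greedy extension of a small candidate -/

section Cover

variable {V : Type*} [DecidableEq V]

/-- For nonadjacent `v` and `u` in `X`: the vertex `u` and, if `u ≠ v`, the common neighbours of
`v` and `u` in `X`. -/
def cand (G : SimpleGraph V) [DecidableRel G.Adj] (X : Finset V) (v u : V) : Finset V :=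
  if u ∈ X ∧ ¬ G.Adj v u then
    insert u (if u = v then ∅ else X.filter fun w => G.Adj v w ∧ G.Adj u w)
  else ∅

variable {G : SimpleGraph V} [DecidableRel G.Adj]

theorem cand_of_ne {X : Finset V} {v u : V} (hu : u ∈ X) (hvu : ¬ G.Adj v u) (hne : u ≠ v) :
    cand G X v u = insert u (X.filter fun w => G.Adj v w ∧ G.Adj u w) := by
  simp [cand, hu, hvu, hne]

/-- The vertex is the one that weak closure provides for `G[X]`. The summand 1 is needed for γ = 0,
where the choice u = v still gives a singleton. -/
theorem IsWeaklyClosed.exists_card_cand_le {γ : ℕ} (hG : IsWeaklyClosed G γ) {X : Finset V}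
    (hX : X.Nonempty) : ∃ v ∈ X, ∀ u, (cand G X v u).card ≤ γ + 1 := by
  obtain ⟨⟨v, hv⟩, hcl⟩ := hG (X : Set V) (by simpa using hX)
  refine ⟨v, by simpa using hv, fun u => ?_⟩
  by_cases hu : u ∈ X ∧ ¬ G.Adj v u
  · by_cases huv : u = v
    · simp [cand, huv]
      split_ifs <;> simp
    · rw [cand_of_ne hu.1 hu.2 huv]
      refine (Finset.card_insert_le _ _).trans (Nat.succ_le_succ (le_of_lt ?_))
      refine lt_of_eq_of_lt ?_ (hcl ⟨u, by simpa using hu.1⟩ (by simpa using huv)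
        (by simpa using hu.2))
      rw [← Set.ncard_coe_finset, ← Set.ncard_image_of_injective _ Subtype.val_injective]
      congr 1
      ext w
      simp only [Finset.coe_filter, Set.mem_image, Subtype.exists]
      constructor
      · rintro ⟨h1, h2, h3⟩
        exact ⟨w, by simpa using h1, ⟨by simpa using h2, by simpa using h3⟩, rfl⟩
      · rintro ⟨w, h1, ⟨h2, h3⟩, rfl⟩
        exact ⟨by simpa using h1, by simpa using h2, by simpa using h3⟩
  · simp [cand, hu]

variable (G) in
/-- `P` contains the greedy extensions along the list `R` of all candidates which consist of a
set `A ⊆ X` and up to `s - 1` further vertices, and of all cliques `A ⊆ X` (where the greedy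
extension first looks for a clique and then for an `s`-defective clique). -/
structure Extends (s : ℕ) (X : Finset V) (R : List V) (P : Set (Finset V)) : Prop where
  defective : ∀ A ⊆ X, ∀ B : Finset V, B.card ≤ s - 1 → IsDefectiveClique G s (A ∪ B) →
    R.foldl (ins G s) (A ∪ B) ∈ P
  clique : ∀ A ⊆ X, IsDefectiveClique G 0 A → ∀ R₁ R₂, R₂ ≠ [] → R₁ ++ R₂ = R →
    R₂.foldl (ins G s) (R₁.foldl (ins G 0) A) ∈ P

variable (G) in
/-- `T` is a maximal `d`-defective clique of `G[X]`. -/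
structure MaxIn (d : ℕ) (X T : Finset V) : Prop where
  subset : T ⊆ X
  defective : IsDefectiveClique G d T
  maximal : ∀ x ∈ X, x ∉ T → ¬ IsDefectiveClique G d (insert x T)

-- If v ∈ T, the reinsertion is accepted because T is defective; if v ∉ T, it is refused because T
-- is maximal. Either way one greedy step undoes the deletion.
omit [DecidableRel G.Adj] in
theorem MaxIn.ins_erase {d : ℕ} {X T : Finset V} (h : MaxIn G d X T) {v : V} (hv : v ∈ X) :
    ins G d (T.erase v) v = T := by
  by_cases hT : v ∈ T
  · rw [ins_pos, Finset.insert_erase hT]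
    rw [Finset.insert_erase hT]
    exact h.defective
  · rw [Finset.erase_eq_of_notMem hT, ins_neg (h.maximal v hv hT)]

omit [DecidableRel G.Adj] in
/-- Deleting `v` either preserves maximality, or another vertex can replace `v`. -/
theorem MaxIn.erase_or {d : ℕ} {X T : Finset V} (h : MaxIn G d X T) (v : V) :
    MaxIn G d (X.erase v) (T.erase v) ∨
      v ∈ T ∧ ∃ u ∈ X, u ≠ v ∧ u ∉ T ∧ IsDefectiveClique G d (insert u (T.erase v)) := by
  by_cases hm : ∀ x ∈ X.erase v, x ∉ T.erase v → ¬ IsDefectiveClique G d (insert x (T.erase v))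
  · exact Or.inl ⟨Finset.erase_subset_erase v h.subset,
      h.defective.subset (Finset.erase_subset v T), hm⟩
  · right
    push Not at hm
    obtain ⟨u, huX, huT, hu⟩ := hm
    have huv := Finset.ne_of_mem_erase huX
    have huT' : u ∉ T := fun h' => huT (Finset.mem_erase.2 ⟨huv, h'⟩)
    have huX' := Finset.mem_of_mem_erase huX
    refine ⟨?_, u, huX', huv, huT', hu⟩
    by_contra hvT
    rw [Finset.erase_eq_of_notMem hvT] at hu
    exact h.maximal u huX' huT' hu

/-- A replacement vertex for a vertex `v` of a maximal defective clique, which is adjacent to all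
of this clique, is not adjacent to `v`. -/
theorem MaxIn.not_adj {d : ℕ} {X T : Finset V} (h : MaxIn G d X T) {v u : V} (hv : v ∈ T)
    (hadj : ∀ w ∈ T.erase v, G.Adj v w) (hu : u ∈ X) (huT : u ∉ T)
    (hd : IsDefectiveClique G d (insert u (T.erase v))) : ¬ G.Adj v u := by
  intro hvu
  refine h.maximal u hu huT ?_
  have huv : v ∉ insert u (T.erase v) := by
    simp only [Finset.mem_insert, Finset.mem_erase, not_or]
    exact ⟨fun h' => huT (h' ▸ hv), fun h' => h'.1 rfl⟩
  rw [isDefectiveClique_iff, ← Finset.insert_erase hv, Finset.insert_comm, miss_insert huv,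
    Finset.filter_false_of_mem]
  · simpa using isDefectiveClique_iff.1 hd
  · intro w hw
    rcases Finset.mem_insert.1 hw with rfl | hw
    · simpa using hvu
    · simpa using hadj w hw

/-- In a clique `T`, all vertices adjacent to the rest. -/
theorem adj_of_isDefectiveClique_zero {T : Finset V} (h : IsDefectiveClique G 0 T) {v w : V}
    (hv : v ∈ T) (hw : w ∈ T.erase v) : G.Adj v w := by
  rw [isDefectiveClique_iff, ← Finset.insert_erase hv,
    miss_insert (Finset.notMem_erase v T)] at h
  have : ((T.erase v).filter fun w => ¬ G.Adj v w).card = 0 := by omega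
  rw [Finset.card_eq_zero, Finset.filter_eq_empty_iff] at this
  simpa using this hw

/-- A clique that has a replacement `u` for its vertex `v`, apart from `v`, lies in
`cand G X v u`. -/
theorem erase_subset_cand {X T : Finset V} {v u : V} (hTX : T ⊆ X) (huX : u ∈ X) (huv : u ≠ v)
    (hvu : ¬ G.Adj v u) (hadj : ∀ w ∈ T.erase v, G.Adj v w) {w : V} (hw : w ∈ T.erase v)
    (huw : G.Adj u w) : w ∈ cand G X v u := by
  rw [cand_of_ne huX hvu huv]
  exact Finset.mem_insert_of_mem (Finset.mem_filter.2
    ⟨hTX (Finset.mem_of_mem_erase hw), hadj w hw, huw⟩)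

variable [Fintype V]

omit [DecidableRel G.Adj] in
theorem compl_cons (v : V) (R : List V) :
    (v :: R).toFinsetᶜ = R.toFinsetᶜ.erase v := by
  ext w
  simp

/-- Cliques: follow a maximal clique through the deletion of vertices. -/
theorem mem_of_maxIn_zero {s : ℕ} {P : Set (Finset V)} {R : List V} (hR : ∀ v, v ∈ R)
    (hnd : R.Nodup)
    (hP : ∀ L v R', L ++ v :: R' = R → ∀ u, Extends G s (cand G R'.toFinsetᶜ v u) (v :: R') P)
    (L : List V) : ∀ (R₁ R₂ : List V) (T : Finset V), L ++ (R₁ ++ R₂) = R → R₂ ≠ [] →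
      MaxIn G 0 (R₁ ++ R₂).toFinsetᶜ T → R₂.foldl (ins G s) (R₁.foldl (ins G 0) T) ∈ P := by
  induction L using List.reverseRecOn with
  | nil =>
    intro R₁ R₂ T hL hne hT
    have hT' : T = ∅ := by
      have : (R₁ ++ R₂).toFinsetᶜ = ∅ := by
        ext w
        simpa [← hL, or_iff_not_imp_left] using hR w
      have h := hT.subset
      rwa [this, Finset.subset_empty] at h
    subst hT'
    -- The empty set is a subset of every candidate set, so the last stage serves with an arbitrary
    -- second vertex.
    obtain ⟨v, R', hv⟩ : ∃ v R', R₁ ++ R₂ = v :: R' :=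
      List.exists_cons_of_ne_nil (by simp [hne])
    exact (hP [] v R' (by simpa [hv] using hL) v).clique ∅ (by simp) (isDefectiveClique_empty 0)
      R₁ R₂ hne hv
  | append_singleton L v ih =>
    intro R₁ R₂ T hL hne hT
    have hL' : L ++ v :: (R₁ ++ R₂) = R := by simpa using hL
    have hv : v ∈ (R₁ ++ R₂).toFinsetᶜ := by
      have := (List.nodup_append.1 (hL' ▸ hnd)).2.1
      simpa using (List.nodup_cons.1 this).1
    -- The vertex joins the part of the list with budget 0, and the switch to budget s stays in
    -- front of R₂.
    have hfold : R₁.foldl (ins G 0) T = (v :: R₁).foldl (ins G 0) (T.erase v) := by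
      rw [List.foldl_cons, hT.ins_erase hv]
    rw [hfold]
    rcases hT.erase_or v with h | ⟨hvT, u, huX, huv, huT, hu⟩
    · rw [← compl_cons, ← List.cons_append] at h
      exact ih (v :: R₁) R₂ _ hL' hne h
    · have hadj : ∀ w ∈ T.erase v, G.Adj v w := fun w hw =>
        adj_of_isDefectiveClique_zero hT.defective hvT hw
      refine (hP L v _ hL' u).clique (T.erase v) (fun w hw => ?_)
        (hT.defective.subset (Finset.erase_subset v T)) (v :: R₁) R₂ hne rfl
      refine erase_subset_cand hT.subset huX huv (hT.not_adj hvT hadj huX huT hu) hadj hw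
        (adj_of_isDefectiveClique_zero hu (Finset.mem_insert_self _ _) ?_)
      rw [Finset.erase_insert (fun h => huT (Finset.mem_of_mem_erase h))]
      exact hw

/-- One deletion step for a maximal `s`-defective clique. -/
theorem mem_of_not_maxIn {s : ℕ} (hs : 1 ≤ s) {P : Set (Finset V)} {R : List V}
    (hR : ∀ v, v ∈ R) (hnd : R.Nodup)
    (hP : ∀ L v R', L ++ v :: R' = R → ∀ u, Extends G s (cand G R'.toFinsetᶜ v u) (v :: R') P)
    {L R' : List V} {v u : V} (hL : L ++ v :: R' = R) {T : Finset V}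
    (hT : MaxIn G s R'.toFinsetᶜ T) (hvT : v ∈ T) (huX : u ∈ R'.toFinsetᶜ) (huv : u ≠ v)
    (huT : u ∉ T) (hu : IsDefectiveClique G s (insert u (T.erase v))) :
    (v :: R').foldl (ins G s) (T.erase v) ∈ P := by
  have hsplit : ∀ u, (T.erase v) ∩ cand G R'.toFinsetᶜ v u ∪ (T.erase v) \ cand G R'.toFinsetᶜ v u
      = T.erase v := fun u => by
    rw [Finset.union_comm, Finset.sdiff_union_inter]
  have hdef : IsDefectiveClique G s (T.erase v) :=
    hT.defective.subset (Finset.erase_subset v T)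
  have hsmall : ∀ u, ((T.erase v) \ cand G R'.toFinsetᶜ v u).card ≤ s - 1 →
      (v :: R').foldl (ins G s) (T.erase v) ∈ P := by
    intro u hcard
    have := (hP L v R' hL u).defective _ Finset.inter_subset_right _ hcard (by rwa [hsplit])
    rwa [hsplit] at this
  -- The partner of v is the replacement u (or another one for cliques) if v is adjacent to the rest
  -- of T, and a nonneighbour of v inside T otherwise.
  by_cases hadj : ∀ w ∈ T.erase v, G.Adj v w
  · have hvu := hT.not_adj hvT hadj huX huT hu
    have hmiss := isDefectiveClique_iff.1 hu
    rw [miss_insert (fun h => huT (Finset.mem_of_mem_erase h))] at hmiss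
    -- If T \ v is a clique, u may have s nonneighbours there, one too many; the set is then treated
    -- as a clique, with budget 0.
    by_cases h0 : miss G (T.erase v) = 0
    · by_cases hmax : MaxIn G 0 (v :: R').toFinsetᶜ (T.erase v)
      · exact mem_of_maxIn_zero hR hnd hP L [] (v :: R') _ hL (by simp) hmax
      · have hT0 : IsDefectiveClique G 0 T := by
          rw [isDefectiveClique_iff, ← Finset.insert_erase hvT,
            miss_insert (Finset.notMem_erase v T), h0, Finset.filter_false_of_mem]
          · simp
          · intro w hw
            simpa using hadj w hw
        -- A clique that is maximal for budget s is all the more a maximal clique, so the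
        -- alternative for deletions applies again, now with a replacement that keeps the clique
        -- property.
        have hTm : MaxIn G 0 R'.toFinsetᶜ T :=
          ⟨hT.subset, hT0, fun x hx hxT h => hT.maximal x hx hxT (h.mono (Nat.zero_le s))⟩
        rcases hTm.erase_or v with h | ⟨-, u, huX, huv, huT, hu⟩
        · rw [← compl_cons] at h
          exact absurd h hmax
        · refine (hP L v R' hL u).clique (T.erase v) (fun w hw => ?_)
            (hT0.subset (Finset.erase_subset v T)) [] (v :: R') (by simp) rfl
          refine erase_subset_cand hT.subset huX huv (hTm.not_adj hvT hadj huX huT hu) hadj hw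
            (adj_of_isDefectiveClique_zero hu (Finset.mem_insert_self _ _) ?_)
          rw [Finset.erase_insert (fun h => huT (Finset.mem_of_mem_erase h))]
          exact hw
    -- A missing edge inside T \ v uses up one of the s, which leaves at most s - 1 nonneighbours of
    -- u.
    · refine hsmall u (le_trans (Finset.card_le_card fun w hw => ?_)
        (show ((T.erase v).filter fun w => ¬ G.Adj u w).card ≤ s - 1 by omega))
      obtain ⟨hw1, hw2⟩ := Finset.mem_sdiff.1 hw
      exact Finset.mem_filter.2 ⟨hw1, fun h => hw2
        (erase_subset_cand hT.subset huX huv hvu hadj hw1 h)⟩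
  · push Not at hadj
    obtain ⟨w, hw, hvw⟩ := hadj
    refine hsmall w ?_
    have hwv := Finset.ne_of_mem_erase hw
    have hm := isDefectiveClique_iff.1 hT.defective
    -- The missing edges of T are split into those inside T \ {v, w}, those at w, those at v, and
    -- the edge vw, which accounts for the s - 1.
    rw [← Finset.insert_erase hvT, miss_insert (Finset.notMem_erase v T),
      ← Finset.insert_erase hw, miss_insert (Finset.notMem_erase w _),
      Finset.filter_insert, if_pos hvw, Finset.card_insert_of_notMem (by simp)] at hm
    have hcard : (T.erase v \ cand G R'.toFinsetᶜ v w).card ≤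
        (((T.erase v).erase w).filter fun x => ¬ G.Adj w x).card +
          (((T.erase v).erase w).filter fun x => ¬ G.Adj v x).card := by
      refine le_trans (Finset.card_le_card fun x hx => ?_) (Finset.card_union_le _ _)
      obtain ⟨hx1, hx2⟩ := Finset.mem_sdiff.1 hx
      rw [cand_of_ne (hT.subset (Finset.mem_of_mem_erase hw)) hvw hwv, Finset.mem_insert,
        Finset.mem_filter] at hx2
      push Not at hx2
      have hx3 : x ∈ (T.erase v).erase w := Finset.mem_erase.2 ⟨hx2.1, hx1⟩
      by_cases hvx : G.Adj v x
      · exact Finset.mem_union_left _ (Finset.mem_filter.2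
          ⟨hx3, hx2.2 (hT.subset (Finset.mem_of_mem_erase hx1)) hvx⟩)
      · exact Finset.mem_union_right _ (Finset.mem_filter.2 ⟨hx3, hvx⟩)
    omega

/-- If the vertices are deleted in the order given by (the reverse of) `R`, and `P` contains the
extensions of the candidates at each stage, then `P` contains all maximal `s`-defective
cliques. -/
theorem mem_of_isMaximalDefectiveClique [Nonempty V] {s : ℕ} (hs : 1 ≤ s) {P : Set (Finset V)}
    {R : List V} (hR : ∀ v, v ∈ R) (hnd : R.Nodup)
    (hP : ∀ L v R', L ++ v :: R' = R → ∀ u, Extends G s (cand G R'.toFinsetᶜ v u) (v :: R') P)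
    {S : Finset V} (hS : IsMaximalDefectiveClique G s S) : S ∈ P := by
  suffices h : ∀ (L R' : List V) (T : Finset V), L ++ R' = R → MaxIn G s R'.toFinsetᶜ T →
      R'.foldl (ins G s) T ∈ P by
    have hS' := isMaximalDefectiveClique_iff.1 hS
    exact h R [] S (by simp) ⟨by simp, hS'.1, fun x _ => hS'.2 x⟩
  intro L
  induction L using List.reverseRecOn with
  | nil =>
    intro R' T hL hT
    simp only [List.nil_append] at hL
    subst hL
    have hT' : T = ∅ := by
      have : R'.toFinsetᶜ = ∅ := by
        ext w
        simpa using hR w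
      have h := hT.subset
      rwa [this, Finset.subset_empty] at h
    subst hT'
    obtain ⟨v, R, rfl⟩ := List.exists_cons_of_ne_nil
      (List.ne_nil_of_mem (hR (Classical.arbitrary V)))
    exact (hP [] v R rfl v).clique ∅ (by simp) (isDefectiveClique_empty 0) [] (v :: R)
      (by simp) rfl
  | append_singleton L v ih =>
    intro R' T hL hT
    have hL' : L ++ v :: R' = R := by simpa using hL
    have hv : v ∈ R'.toFinsetᶜ := by
      have := (List.nodup_append.1 (hL' ▸ hnd)).2.1
      simpa using (List.nodup_cons.1 this).1
    have hfold : R'.foldl (ins G s) T = (v :: R').foldl (ins G s) (T.erase v) := by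
      rw [List.foldl_cons, hT.ins_erase hv]
    rw [hfold]
    rcases hT.erase_or v with h | ⟨hvT, u, huX, huv, huT, hu⟩
    · rw [← compl_cons] at h
      exact ih (v :: R') _ hL' h
    · exact mem_of_not_maxIn hs hR hnd hP hL' hT hvT huX huv huT hu

end Cover

/-! ### The number of maximal defective cliques -/

section Count

variable {V : Type*} [DecidableEq V] [Fintype V] {G : SimpleGraph V} [DecidableRel G.Adj]

/-- The list grows at its head: a suffix R' consists of the vertices deleted so far, and the entry
in front of it is chosen in the subgraph induced by the complement of R'. -/
theorem IsWeaklyClosed.exists_order {γ : ℕ} (hG : IsWeaklyClosed G γ) :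
    ∃ R : List V, (∀ v, v ∈ R) ∧ R.Nodup ∧
      ∀ L v R', L ++ v :: R' = R → ∀ u, (cand G R'.toFinsetᶜ v u).card ≤ γ + 1 := by
  suffices h : ∀ k ≤ Fintype.card V, ∃ R : List V, R.length = k ∧ R.Nodup ∧
      ∀ L v R', L ++ v :: R' = R → ∀ u, (cand G R'.toFinsetᶜ v u).card ≤ γ + 1 by
    obtain ⟨R, hlen, hnd, hR⟩ := h _ le_rfl
    refine ⟨R, fun v => ?_, hnd, hR⟩
    have : R.toFinset = Finset.univ := by
      rw [← Finset.card_eq_iff_eq_univ, List.toFinset_card_of_nodup hnd, hlen]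
    rw [← List.mem_toFinset, this]
    exact Finset.mem_univ v
  intro k
  induction k with
  | zero => exact fun _ => ⟨[], rfl, List.nodup_nil, fun L v R' h => by simp at h⟩
  | succ k ih =>
    intro hk
    obtain ⟨R, hlen, hnd, hR⟩ := ih (by omega)
    have hne : R.toFinsetᶜ.Nonempty := by
      rw [← Finset.card_pos, Finset.card_compl, List.toFinset_card_of_nodup hnd]
      omega
    obtain ⟨v, hv, hcard⟩ := hG.exists_card_cand_le hne
    refine ⟨v :: R, by simp [hlen], List.nodup_cons.2 ⟨by simpa using hv, hnd⟩, ?_⟩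
    intro L w R' h
    cases L with
    | nil =>
      obtain ⟨rfl, rfl⟩ := List.cons_eq_cons.1 h
      exact hcard
    | cons x L =>
      exact hR L w R' (List.cons_eq_cons.1 h).2

variable (G) in
/-- The greedy extensions of all candidates with respect to `X` along the list `R`. -/
noncomputable def extensions (s : ℕ) (X : Finset V) (R : List V) : Finset (Finset V) :=
  (X.powerset ×ˢ insert ∅ (Finset.univ.image fun f : Fin (s - 1) → V =>
      Finset.univ.image f)).image (fun p => R.foldl (ins G s) (p.1 ∪ p.2)) ∪
    (X.powerset ×ˢ Finset.range R.length).image fun p =>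
      (R.drop p.2).foldl (ins G s) ((R.take p.2).foldl (ins G 0) p.1)

-- A nonempty B with at most s - 1 elements is the range of a function on `Fin (s - 1)` that repeats
-- one element; only the empty set needs a separate entry. A switch is recorded as the length of R₁.
omit [DecidableRel G.Adj] in
theorem extends_extensions {s : ℕ} {X : Finset V} {R : List V} {P : Set (Finset V)}
    (hP : ∀ S ∈ extensions G s X R, S ∈ P) : Extends G s X R P := by
  constructor
  · intro A hA B hB _
    refine hP _ (Finset.mem_union_left _ (Finset.mem_image.2 ⟨(A, B), ?_, rfl⟩))
    refine Finset.mem_product.2 ⟨Finset.mem_powerset.2 hA, ?_⟩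
    rcases B.eq_empty_or_nonempty with rfl | ⟨b, hb⟩
    · exact Finset.mem_insert_self _ _
    · refine Finset.mem_insert_of_mem (Finset.mem_image.2
        ⟨fun i => if h : i.1 < B.card then (B.equivFin.symm ⟨i, h⟩).1 else b,
          Finset.mem_univ _, ?_⟩)
      ext x
      simp only [Finset.mem_image, Finset.mem_univ, true_and]
      constructor
      · rintro ⟨i, rfl⟩
        split_ifs
        · exact (B.equivFin.symm _).2
        · exact hb
      · intro hx
        refine ⟨⟨B.equivFin ⟨x, hx⟩, lt_of_lt_of_le (B.equivFin ⟨x, hx⟩).2 hB⟩, ?_⟩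
        simp
  · rintro A hA - R₁ R₂ hne rfl
    refine hP _ (Finset.mem_union_right _ (Finset.mem_image.2 ⟨(A, R₁.length), ?_, ?_⟩))
    · simpa using ⟨hA, List.length_pos_iff.2 hne⟩
    · simp

omit [DecidableRel G.Adj] in
theorem card_extensions_le [Nonempty V] {s γ : ℕ} (hs : 2 ≤ s) {X : Finset V}
    (hX : X.card ≤ γ + 1) {R : List V} (hR : R.length ≤ Fintype.card V) :
    (extensions G s X R).card ≤ 6 * 2 ^ γ * Fintype.card V ^ (s - 1) := by
  have hpos : 1 ≤ Fintype.card V := Fintype.card_pos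
  have hpow : 2 ^ X.card ≤ 2 * 2 ^ γ :=
    (Nat.pow_le_pow_right (by norm_num) hX).trans (by rw [pow_succ, mul_comm])
  -- The hypothesis s ≥ 2 enters here: the switch positions cost no more than the choice of B.
  have hn : Fintype.card V ≤ Fintype.card V ^ (s - 1) := Nat.le_self_pow (by omega) _
  have h1 : (insert ∅ (Finset.univ.image fun f : Fin (s - 1) → V =>
      Finset.univ.image f)).card ≤ 2 * Fintype.card V ^ (s - 1) := by
    refine (Finset.card_insert_le _ _).trans ?_
    have := Finset.card_image_le (s := Finset.univ) (f := fun f : Fin (s - 1) → V =>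
      Finset.univ.image f)
    rw [Finset.card_univ, Fintype.card_fun, Fintype.card_fin] at this
    omega
  refine (Finset.card_union_le _ _).trans
    ((Nat.add_le_add Finset.card_image_le Finset.card_image_le).trans ?_)
  rw [Finset.card_product, Finset.card_product, Finset.card_powerset, Finset.card_range]
  calc _ ≤ 2 * 2 ^ γ * (2 * Fintype.card V ^ (s - 1)) + 2 * 2 ^ γ * Fintype.card V ^ (s - 1) :=
        Nat.add_le_add (Nat.mul_le_mul hpow h1) (Nat.mul_le_mul hpow (hR.trans hn))
    _ = _ := by ring

omit [DecidableEq V] [DecidableRel G.Adj] in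
theorem ncard_isMaximalDefectiveClique_le [Nonempty V] {s γ : ℕ} (hs : 2 ≤ s)
    (hG : IsWeaklyClosed G γ) :
    {S : Finset V | IsMaximalDefectiveClique G s S}.ncard ≤
      12 * (2 ^ γ * Fintype.card V ^ (s + 1)) := by
  classical
  obtain ⟨R, hR, hnd, hcard⟩ := hG.exists_order
  have hlen : R.length = Fintype.card V := by
    rw [← List.toFinset_card_of_nodup hnd, Finset.card_eq_iff_eq_univ]
    ext v
    simpa using hR v
  have hpos : 1 ≤ Fintype.card V := Fintype.card_pos
  -- The stages correspond to the nonempty suffixes of R; the head of a suffix is the vertex deleted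
  -- at that stage.
  let E : V × List V → Finset (Finset V) := fun p =>
    match p.2 with
    | [] => ∅
    | v :: R' => extensions G s (cand G R'.toFinsetᶜ v p.1) (v :: R')
  let P : Finset (Finset V) := (Finset.univ ×ˢ R.tails.toFinset).biUnion E
  have hP : ∀ L v R', L ++ v :: R' = R → ∀ u,
      Extends G s (cand G R'.toFinsetᶜ v u) (v :: R') (P : Set (Finset V)) := by
    intro L v R' hL u
    refine extends_extensions fun S hS => ?_
    refine Finset.mem_coe.2 (Finset.mem_biUnion.2 ⟨(u, v :: R'), ?_, hS⟩)
    simpa using ⟨L, hL⟩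
  have hsub : {S : Finset V | IsMaximalDefectiveClique G s S} ⊆ (P : Set (Finset V)) :=
    fun S hS => mem_of_isMaximalDefectiveClique (by omega) hR hnd hP hS
  refine (Set.ncard_le_ncard hsub).trans ?_
  rw [Set.ncard_coe_finset]
  refine (Finset.card_biUnion_le_card_mul _ _ (6 * 2 ^ γ * Fintype.card V ^ (s - 1)) ?_).trans ?_
  · rintro ⟨u, R'⟩ hu
    cases R' with
    | nil => simp [E]
    | cons v R' =>
      obtain ⟨L, hL⟩ : v :: R' <:+ R := by simpa using hu
      refine card_extensions_le hs (hcard L v R' hL u) ?_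
      rw [← hlen, ← hL, List.length_append]
      omega
  · have htails : R.tails.toFinset.card ≤ 2 * Fintype.card V := by
      refine (List.toFinset_card_le _).trans ?_
      rw [List.length_tails, hlen]
      omega
    rw [Finset.card_product, Finset.card_univ]
    calc _ ≤ Fintype.card V * (2 * Fintype.card V) * (6 * 2 ^ γ * Fintype.card V ^ (s - 1)) :=
          Nat.mul_le_mul_right _ (Nat.mul_le_mul_left _ htails)
      _ = 12 * (2 ^ γ * (Fintype.card V ^ (s - 1) * Fintype.card V ^ 2)) := by ring
      _ = _ := by rw [← pow_add, show s - 1 + 2 = s + 1 by omega]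

end Count

/-! ### The greedy extension as a program -/

infixr:60 " ;; " => Prog.seq

/-- number of vertices -/
notation "rN" => 0
/-- the parameter `s` -/
notation "rS" => 1
/-- the parameter `k` -/
notation "rK" => 2
/-- the constants `0`, `1` and `2` -/
notation "rZero" => 3
notation "rOne" => 4
notation "rTwo" => 5
/-- number of digits that stand for vertices -/
notation "rMB" => 6
/-- number of vertices which have not been deleted -/
notation "rTop" => 7
notation "rStage" => 8
/-- the vertex to be deleted, and its nonneighbour -/
notation "rV" => 9
notation "rU" => 13
/-- the best choice for the vertex to be deleted, its value, and the value of `rV` -/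
notation "rBest" => 10
notation "rBestVal" => 11
notation "rVal" => 12
/-- size of the set of candidates, and number of all digits -/
notation "rM" => 14
notation "rLen" => 15
notation "rCarry" => 16
/-- number of digits to be used, and budget -/
notation "rUse" => 17
notation "rBud" => 18
/-- number of missing edges of the current set -/
notation "rMiss" => 19
notation "rSwitch" => 20
notation "rI" => 21
notation "rJ" => 22
notation "rT" => 30
notation "rC" => 31
notation "rW" => 32
notation "rX" => 33
notation "rY" => 34
/-- the current set, the remaining vertices, the candidates, the digits, their bases, and the
deleted vertices -/
notation "aSet" => 0
notation "aAlive" => 1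
notation "aCand" => 2
notation "aDig" => 3
notation "aBase" => 4
notation "aOrd" => 5

/-- The contents of the registers that are never changed. -/
structure Ctx (n s : ℕ) (σ : State) : Prop where
  hN : σ.reg rN = n
  hS : σ.reg rS = s
  hZ : σ.reg rZero = 0
  hO : σ.reg rOne = 1
  hT : σ.reg rTwo = 2

theorem Ctx.agree {n s : ℕ} {σ τ : State} {p : Prog} (h : Ctx n s σ) (ha : Agree p σ τ)
    (hp : ∀ x ∈ [rN, rS, rZero, rOne, rTwo], x ∉ p.regs) : Ctx n s τ :=
  ⟨(ha.reg _ (hp _ (by simp))).trans h.hN, (ha.reg _ (hp _ (by simp))).trans h.hS,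
    (ha.reg _ (hp _ (by simp))).trans h.hZ, (ha.reg _ (hp _ (by simp))).trans h.hO,
    (ha.reg _ (hp _ (by simp))).trans h.hT⟩

theorem Ctx.set {n s : ℕ} {σ : State} (h : Ctx n s σ) {x : ℕ} (v : ℕ)
    (hx : x ∉ [rN, rS, rZero, rOne, rTwo]) : Ctx n s (σ.set x v) := by
  simp only [List.mem_cons, List.not_mem_nil, not_or] at hx
  obtain ⟨h0, h1, h2, h3, h4, -⟩ := hx
  exact ⟨by simp [h.hN, Ne.symm h0], by simp [h.hS, Ne.symm h1], by simp [h.hZ, Ne.symm h2],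
    by simp [h.hO, Ne.symm h3], by simp [h.hT, Ne.symm h4]⟩

theorem Ctx.setArr {n s : ℕ} {σ : State} (h : Ctx n s σ) (a i v : ℕ) : Ctx n s (σ.setArr a i v) :=
  ⟨h.1, h.2, h.3, h.4, h.5⟩

section Programs

variable {n s : ℕ} {G : SimpleGraph (Fin n)} [DecidableRel G.Adj]

/-- `f` is the characteristic function of `S`. -/
def IsChar (f : ℕ → ℕ) (S : Finset (Fin n)) : Prop :=
  ∀ i : Fin n, f i = if i ∈ S then 1 else 0

/-- The numbers below `k` with the property `p`. -/
def below (p : Fin n → Prop) [DecidablePred p] (k : ℕ) : Finset (Fin n) :=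
  Finset.univ.filter fun w => (w : ℕ) < k ∧ p w

theorem below_zero (p : Fin n → Prop) [DecidablePred p] : below p 0 = ∅ := by
  simp [below]

theorem below_self (p : Fin n → Prop) [DecidablePred p] : below p n = Finset.univ.filter p := by
  simp [below]

theorem notMem_below (p : Fin n → Prop) [DecidablePred p] (k : Fin n) : k ∉ below p k := by
  simp [below]

theorem below_succ_pos {p : Fin n → Prop} [DecidablePred p] {k : Fin n} (hk : p k) :
    below p (k + 1) = insert k (below p k) := by
  ext w
  by_cases hw : w = k
  · simp [below, hw, hk]
  · have : (w : ℕ) ≠ k := fun h => hw (Fin.ext h)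
    have : (w : ℕ) < k + 1 ↔ (w : ℕ) < k := by omega
    simp only [below, Finset.mem_filter, this, Finset.mem_insert, hw, false_or]

theorem below_succ_neg {p : Fin n → Prop} [DecidablePred p] {k : Fin n} (hk : ¬ p k) :
    below p (k + 1) = below p k := by
  ext w
  by_cases hw : w = k
  · simp [below, hw, hk]
  · have : (w : ℕ) ≠ k := fun h => hw (Fin.ext h)
    have : (w : ℕ) < k + 1 ↔ (w : ℕ) < k := by omega
    simp only [below, Finset.mem_filter, this]

/-- Add the number of vertices in the current set that are not adjacent to `rX` to the number
of missing edges. -/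
def countMiss : Prog :=
  .copy rC rMiss ;; .const rW 0 ;; .forLoop rW rN
    (.load rT aSet rW ;; .ite (.eq rT rOne)
      (.edge rT rX rW ;; .ite (.eq rT rZero) (.inc rC) .skip) .skip)

theorem ter_countMiss {σ : State} (hc : Ctx n s σ) {S : Finset (Fin n)} {x : Fin n}
    (hS : IsChar (σ.arr aSet) S) (hx : σ.reg rX = x) :
    Ter G countMiss σ fun τ t => t ≤ 7 * n + 3 ∧
      τ.reg rC = σ.reg rMiss + (S.filter fun w => ¬ G.Adj x w).card := by
  unfold countMiss
  simp only [ter_seq, ter_copy, ter_const]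
  refine Ter.mono (Ter.forLoop (c := 5) (fun k ρ => ρ.reg rC = σ.reg rMiss +
    (below (fun w => w ∈ S ∧ ¬ G.Adj x w) k).card)
    (by decide) (by decide) (by simp [below_zero]) ?_) ?_
  · intro k ρ _ hk hW ha hI
    have h0 := hc.hN
    simp [h0] at hk
    lift k to Fin n using hk
    have e1 := ha.reg rX (by decide)
    have e2 := ha.reg rZero (by decide)
    have e3 := ha.reg rOne (by decide)
    have e4 := ha.arr aSet (by decide)
    simp [hc.hZ, hc.hO, hx] at e1 e2 e3 e4
    have := hS k
    by_cases hk : k ∈ S ∧ ¬ G.Adj x k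
    · rw [below_succ_pos hk, Finset.card_insert_of_notMem (notMem_below _ k)]
      simp [e1, e2, e3, e4, this, hk, hW, adjEntry_eq, hI, add_assoc]
    · rw [below_succ_neg hk]
      by_cases h1 : k ∈ S
      · have h2 : G.Adj x k := by
          by_contra h2
          exact hk ⟨h1, h2⟩
        simp [e1, e2, e3, e4, this, h1, h2, hW, adjEntry_eq, hI]
      · simp [e3, e4, this, h1, hW, hI]
  · rintro τ t ⟨ht, hI, -⟩
    simp [hc.hN] at ht hI
    refine ⟨by omega, ?_⟩
    rw [hI, below_self]
    congr 2
    ext w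
    simp

variable (G) in
/-- The current set is `S`, and its number of missing edges is known. -/
def Cur (S : Finset (Fin n)) (σ : State) : Prop :=
  IsChar (σ.arr aSet) S ∧ σ.reg rMiss = miss G S

/-- Insert `rX` into the current set if the number of missing edges is within the budget. -/
def tryInsert : Prog :=
  .load rT aSet rX ;; .ite (.eq rT rZero)
    (countMiss ;; .ite (.lt rBud rC) .skip (.store aSet rX rOne ;; .copy rMiss rC)) .skip

theorem ter_tryInsert {σ : State} (hc : Ctx n s σ) {S : Finset (Fin n)} {x : Fin n}
    (hS : Cur G S σ) (hx : σ.reg rX = x) :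
    Ter G tryInsert σ fun τ t => t ≤ 7 * n + 8 ∧ Cur G (ins G (σ.reg rBud) S x) τ := by
  unfold tryInsert
  have hSx := hS.1 x
  by_cases h : x ∈ S
  · rw [ins_of_mem h]
    simpa [hx, hSx, h, hc.hZ, Cur, IsChar] using hS
  · simp [hx, hSx, h, hc.hZ]
    refine Ter.mono (ter_countMiss (S := S) (x := x) (hc.set 0 (by decide))
      (by simpa using hS.1) (by simpa using hx)).agree ?_
    rintro τ t ⟨⟨ht, hC⟩, ha⟩
    have e1 := ha.reg rX (by decide)
    have e2 := ha.reg rOne (by decide)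
    have e3 := ha.reg rBud (by decide)
    have e4 := ha.reg rMiss (by decide)
    have e5 := ha.arr aSet (by decide)
    simp [hx, hc.hO] at e1 e2 e3 e4 e5 hC
    rw [hS.2, ← miss_insert h] at hC
    rw [hS.2] at e4
    rw [e3, hC]
    constructor
    · intro hlt
      -- The stored number of missing edges plus the nonneighbours counted is the number for the
      -- enlarged set, so comparing it with the budget decides the greedy step.
      rw [ins_neg (by rw [isDefectiveClique_iff]; omega)]
      exact ⟨by omega, by rw [e5]; exact hS.1, e4⟩
    · intro hle
      rw [ins_pos (isDefectiveClique_iff.2 hle)]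
      refine ⟨by omega, fun i => ?_, by simp⟩
      have := hS.1 i
      by_cases hi : i = x
      · simp [e1, e2, hi]
      · simp [e1, e2, e5, hi, this, Fin.val_inj]

/-- GreedyProcess insert the entries of a part of an array. -/
theorem ter_insertList {σ : State} (hc : Ctx n s σ) {S : Finset (Fin n)} (hS : Cur G S σ)
    {y a : ℕ} (hy : y ∉ rJ :: (Prog.load rX a rJ ;; tryInsert).regs) {l : List (Fin n)}
    (hl : σ.reg y - σ.reg rJ = l.length)
    (ha : ∀ j (h : j < l.length), σ.arr a (σ.reg rJ + j) = l[j]) (haS : a ≠ aSet) :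
    Ter G (.forLoop rJ y (.load rX a rJ ;; tryInsert)) σ fun τ t =>
      t ≤ l.length * (7 * n + 11) + 1 ∧ Cur G (l.foldl (ins G (σ.reg rBud)) S) τ ∧
        τ.reg rJ = max (σ.reg rJ) (σ.reg y) := by
  refine Ter.mono (Ter.forLoop (c := 7 * n + 9) (fun k ρ =>
    Cur G ((l.take (k - σ.reg rJ)).foldl (ins G (σ.reg rBud)) S) ρ)
    (by simp [Prog.regs, tryInsert, countMiss, Prog.forLoop]) hy (by simpa) ?_) ?_
  · intro k ρ hk1 hk2 hk hag hI
    have hc' : Ctx n s ρ := hc.agree hag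
      (by simp [Prog.regs, tryInsert, countMiss, Prog.forLoop])
    have e1 := hag.reg rBud (by simp [Prog.regs, tryInsert, countMiss, Prog.forLoop])
    have e2 := hag.arr a (by simp [Prog.arrs, tryInsert, countMiss, Prog.forLoop, haS])
    have hlt : k - σ.reg rJ < l.length := by omega
    have e3 := ha _ hlt
    rw [Nat.add_sub_cancel' hk1] at e3
    simp only [ter_seq, ter_load, hk, e2, e3]
    refine Ter.mono (ter_tryInsert (x := l[k - σ.reg rJ])
      (hc'.set _ (by decide))
      (S := (l.take (k - σ.reg rJ)).foldl (ins G (σ.reg rBud)) S) (by simpa [Cur] using hI)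
      (by simp)) ?_
    rintro τ t ⟨ht, h1, h2⟩
    simp only [State.set_reg, Nat.reduceEqDiff, ↓reduceIte, e1] at h1 h2
    refine ⟨by omega, ?_⟩
    rw [show k + 1 - σ.reg rJ = k - σ.reg rJ + 1 by omega, ← List.take_concat_get' _ _ hlt,
      List.foldl_append]
    exact ⟨by simpa using h1, by simpa using h2⟩
  · rintro τ t ⟨ht, hI, hJ⟩
    refine ⟨by rwa [hl] at ht, ?_, hJ⟩
    rwa [List.take_of_length_le (by omega)] at hI

/-- Make the current set empty. -/
def clear : Prog :=
  .const rMiss 0 ;; .const rJ 0 ;; .forLoop rJ rN (.store aSet rJ rZero)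

omit [DecidableRel G.Adj] in
theorem ter_clear {σ : State} (hc : Ctx n s σ) :
    Ter G clear σ fun τ t => t ≤ 3 * n + 3 ∧ Cur G ∅ τ := by
  unfold clear
  simp only [ter_seq, ter_const]
  refine Ter.mono (Ter.forLoop (c := 1) (fun k ρ => ∀ i < k, ρ.arr aSet i = 0)
    (by decide) (by decide) (by simp) ?_).agree ?_
  · intro k ρ _ _ hk ha hI
    have e2 := ha.reg rZero (by decide)
    simp [hc.hZ] at e2
    simp only [ter_store, State.set_arr, State.setArr_arr, hk, e2, ↓reduceIte]
    refine ⟨le_rfl, fun i hi => ?_⟩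
    split_ifs with h
    · rfl
    · exact hI i (by omega)
  · rintro τ t ⟨⟨ht, hI, -⟩, ha⟩
    have e1 := ha.reg rMiss (by decide)
    simp [hc.hN] at ht hI e1
    exact ⟨by omega, fun i => by simpa using hI i i.2, by rw [e1, miss_empty]⟩

/-- GreedyProcess insert the candidates whose digit is `1`. -/
def insertCands : Prog :=
  .copy rI rMB ;; .const rJ 0 ;; .forLoop rJ rM
    (.load rT aDig rI ;; .ite (.eq rT rOne) (.load rX aCand rJ ;; tryInsert) .skip ;; .inc rI)

theorem ter_insertCands {σ : State} (hc : Ctx n s σ) {S : Finset (Fin n)} (hS : Cur G S σ)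
    {w : ℕ → Fin n} (hw : ∀ j < σ.reg rM, σ.arr aCand j = w j) :
    Ter G insertCands σ fun τ t => t ≤ σ.reg rM * (7 * n + 14) + 3 ∧
      Cur G ((((List.range (σ.reg rM)).filter fun j => σ.arr aDig (σ.reg rMB + j) = 1).map
        w).foldl (ins G (σ.reg rBud)) S) τ := by
  unfold insertCands
  simp only [ter_seq, ter_const, ter_copy]
  refine Ter.mono (Ter.forLoop (c := 7 * n + 12) (fun k ρ => ρ.reg rI = σ.reg rMB + k ∧
      Cur G ((((List.range k).filter fun j => σ.arr aDig (σ.reg rMB + j) = 1).map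
        w).foldl (ins G (σ.reg rBud)) S) ρ)
    (by decide) (by decide) (by simpa [Cur] using hS) ?_) ?_
  · rintro k ρ - hk2 hk hag ⟨hI1, hI2⟩
    simp at hk2
    have e1 := hag.reg rBud (by decide)
    have e2 := hag.arr aCand (by decide)
    have e3 := hag.arr aDig (by decide)
    have hc' : Ctx n s ρ :=
      ((hc.set _ (by decide)).set _ (by decide)).agree hag (by decide)
    simp at e1 e2 e3
    have e9 := hw k hk2
    by_cases hb : σ.arr aDig (σ.reg rMB + k) = 1
    · simp [hI1, e3, e2, hc'.hO, hb, hk, e9]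
      refine Ter.mono (ter_tryInsert (x := w k)
        ((hc'.set _ (by decide)).set _ (by decide))
        (by simpa [Cur] using hI2) (by simp)).agree ?_
      rintro τ t ⟨⟨ht, h1, h2⟩, hag'⟩
      have e10 := hag'.reg rI (by decide)
      simp [hI1] at e10
      refine ⟨by omega, by rw [e10]; ring, ?_⟩
      simp [e1] at h1 h2
      simpa [Cur, List.range_succ, List.filter_append, hb] using ⟨h1, h2⟩
    · simp [hI1, e3, hc'.hO, hb, hk]
      refine ⟨by ring, ?_⟩
      simpa [Cur, List.range_succ, List.filter_append, hb] using hI2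
  · rintro τ t ⟨ht, ⟨-, hI⟩, -⟩
    simp at ht hI
    simp only [add_assoc, Nat.reduceAdd] at ht
    exact ⟨by omega, hI⟩

end Programs

/-! ### One complete greedy extension -/

section GreedyProcess

variable {n s : ℕ} {G : SimpleGraph (Fin n)} [DecidableRel G.Adj]

/-- The array `aOrd` contains the list `R` of deleted vertices, the last deleted vertex first. -/
structure Deleted (R : List (Fin n)) (σ : State) : Prop where
  top : σ.reg rTop + R.length = n
  ord : ∀ j (h : j < R.length), σ.arr aOrd (σ.reg rTop + j) = R[j]

/-- Build a defective clique greedily from the first `rUse` digits, the candidates whose digit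
is `1`, and the deleted vertices; the budget changes to `s` where the first digit says so. -/
def process : Prog :=
  clear ;; .const rJ 0 ;; .forLoop rJ rUse (.load rX aDig rJ ;; tryInsert) ;; insertCands ;;
    .load rSwitch aDig rZero ;; .copy rJ rTop ;;
    .forLoop rJ rSwitch (.load rX aOrd rJ ;; tryInsert) ;;
    .copy rBud rS ;; .forLoop rJ rN (.load rX aOrd rJ ;; tryInsert)

/-- The switch is an absolute position in `aOrd`. If it lies before `rTop`, the loop with the old
budget does nothing and leaves `rJ` at `rTop`; the truncated subtraction in the statement describes
the same behaviour. There are O(n) insertion attempts, of O(n) steps each. -/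
theorem ter_process {σ : State} (hc : Ctx n s σ) {B R : List (Fin n)} {w : ℕ → Fin n}
    (hB : σ.reg rUse = B.length) (hBn : B.length ≤ n)
    (hB' : ∀ j (h : j < B.length), σ.arr aDig j = B[j])
    (hw : ∀ j < σ.reg rM, σ.arr aCand j = w j) (hM : σ.reg rM ≤ n)
    (hR : Deleted R σ) (hsw : σ.arr aDig 0 ≤ n) :
    Ter G process σ fun τ t => t ≤ 60 * (n + 1) ^ 2 ∧
      Cur G ((R.drop (σ.arr aDig 0 - σ.reg rTop)).foldl (ins G s)
        ((R.take (σ.arr aDig 0 - σ.reg rTop)).foldl (ins G (σ.reg rBud))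
        ((((List.range (σ.reg rM)).filter fun j => σ.arr aDig (σ.reg rMB + j) = 1).map
          w).foldl (ins G (σ.reg rBud)) (B.foldl (ins G (σ.reg rBud)) ∅)))) τ := by
  have hlen := hR.top
  refine (ter_clear hc).bind ?_
  rintro ρ₁ t₁ ⟨ht₁, h₁⟩ a₁
  have c₁ := hc.agree a₁ (by decide)
  rw [ter_seq, ter_const]
  refine (ter_insertList (c₁.set 0 (by decide)) (S := ∅) (by simpa [Cur] using h₁)
    (y := rUse) (a := aDig) (by decide) (l := B) ?_ ?_ (by decide)).bind ?_
  · simp [a₁.reg rUse (by decide), hB]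
  · intro j h
    simpa [a₁.arr aDig (by decide)] using hB' j h
  rintro ρ₂ t₂ ⟨ht₂, h₂, -⟩ a₂
  have c₂ := (c₁.set 0 (by decide)).agree a₂ (by decide)
  have b₂ := a₂.reg rBud (by decide)
  have m₂ := a₂.reg rM (by decide)
  have n₂ := a₂.reg rMB (by decide)
  have d₂ := a₂.arr aDig (by decide)
  have o₂ := a₂.arr aOrd (by decide)
  have p₂ := a₂.reg rTop (by decide)
  have w₂ := a₂.arr aCand (by decide)
  simp [a₁.reg rBud (by decide), a₁.reg rM (by decide), a₁.arr aDig (by decide),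
    a₁.arr aOrd (by decide), a₁.arr aCand (by decide), a₁.reg rTop (by decide),
    a₁.reg rMB (by decide)] at b₂ m₂ d₂ o₂ p₂ h₂ w₂ n₂
  refine (ter_insertCands c₂ h₂ (w := w) (by rwa [m₂, w₂])).bind ?_
  rintro ρ₃ t₃ ⟨ht₃, h₃⟩ a₃
  have c₃ := c₂.agree a₃ (by decide)
  rw [m₂, n₂, d₂, b₂] at h₃
  rw [m₂] at ht₃
  rw [ter_seq, ter_load, ter_seq, ter_copy]
  simp only [c₃.hZ, a₃.arr aDig (by decide), d₂]
  have hR' : ∀ j (h : j < R.length), ρ₃.arr aOrd (ρ₃.reg rTop + j) = R[j] := by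
    intro j h
    rw [a₃.arr aOrd (by decide), a₃.reg rTop (by decide), o₂, p₂]
    exact hR.ord j h
  have p₃ := (a₃.reg rTop (by decide)).trans p₂
  have b₃ := (a₃.reg rBud (by decide)).trans b₂
  refine (ter_insertList ((c₃.set _ (by decide)).set _ (by decide))
    (S := (((List.range (σ.reg rM)).filter fun j => σ.arr aDig (σ.reg rMB + j) = 1).map
          w).foldl (ins G (σ.reg rBud)) (B.foldl (ins G (σ.reg rBud)) ∅))
    (by simpa [Cur] using h₃) (y := rSwitch) (a := aOrd) (by decide)
    (l := R.take (σ.arr aDig 0 - σ.reg rTop)) ?_ ?_ (by decide)).bind ?_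
  · simp [p₃]
    omega
  · intro j h
    simpa using hR' j (lt_of_lt_of_le h (by simp))
  rintro ρ₄ t₄ ⟨ht₄, h₄, j₄⟩ a₄
  have c₄ := ((c₃.set _ (by decide)).set _ (by decide)).agree a₄ (by decide)
  have o₄ := a₄.arr aOrd (by decide)
  simp [b₃, p₃] at h₄ j₄ o₄
  rw [ter_seq, ter_copy]
  refine Ter.mono (ter_insertList (c₄.set _ (by decide)) (by simpa [Cur] using h₄)
    (y := rN) (a := aOrd) (by decide) (l := R.drop (σ.arr aDig 0 - σ.reg rTop)) ?_ ?_
    (by decide)) ?_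
  · simp [j₄, c₄.hN]
    omega
  · intro j h
    have := hR' (σ.arr aDig 0 - σ.reg rTop + j) (by simp at h; omega)
    simp [j₄, o₄]
    rw [← this, p₃]
    congr 1
    omega
  · rintro τ t ⟨ht, h, -⟩
    simp [c₄.hS] at h
    refine ⟨?_, h⟩
    have l1 : (R.take (σ.arr aDig 0 - σ.reg rTop)).length ≤ n := by
      simp
      omega
    have l2 : (R.drop (σ.arr aDig 0 - σ.reg rTop)).length ≤ n := by
      simp
      omega
    have g1 := Nat.mul_le_mul_right (7 * n + 11) l1
    have g2 := Nat.mul_le_mul_right (7 * n + 11) l2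
    have g3 := Nat.mul_le_mul_right (7 * n + 11) hBn
    have g4 := Nat.mul_le_mul_right (7 * n + 14) hM
    nlinarith

end GreedyProcess

/-! ### Candidate lists and the choice of the next vertex -/

section Choice

variable {n s : ℕ} {G : SimpleGraph (Fin n)} [DecidableRel G.Adj]

/-- The first `m` values of `f` enumerate `S`. -/
def Lists (f : ℕ → ℕ) (m : ℕ) (S : Finset (Fin n)) : Prop :=
  m = S.card ∧ ∃ w : ℕ → Fin n, (∀ j < m, f j = w j) ∧ (Finset.range m).image w = S

theorem Lists.empty (f : ℕ → ℕ) (v : Fin n) : Lists f 0 (∅ : Finset (Fin n)) :=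
  ⟨rfl, fun _ => v, fun j hj => absurd hj (by omega), rfl⟩

theorem Lists.insert {f f' : ℕ → ℕ} {m : ℕ} {S : Finset (Fin n)} (h : Lists f m S) {x : Fin n}
    (hx : x ∉ S) (hf : ∀ j < m, f' j = f j) (hm : f' m = x) :
    Lists f' (m + 1) (insert x S) := by
  obtain ⟨hc, w, hw, rfl⟩ := h
  refine ⟨by rw [Finset.card_insert_of_notMem hx, ← hc], Function.update w m x, ?_, ?_⟩
  · intro j hj
    by_cases hjm : j = m
    · simp [hjm, hm]
    · rw [hf j (by omega), hw j (by omega), Function.update_of_ne hjm]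
  · rw [Finset.range_add_one, Finset.image_insert, Function.update_self]
    congr 1
    refine Finset.image_congr fun j hj => ?_
    rw [Function.update_of_ne]
    have := Finset.mem_range.1 hj
    omega

/-- Compute the list of candidates for the vertices `rV` and `rU`. -/
def buildCand : Prog :=
  .const rM 0 ;; .load rT aAlive rU ;; .ite (.eq rT rOne)
    (.edge rT rV rU ;; .ite (.eq rT rZero)
      (.store aCand rM rU ;; .inc rM ;; .ite (.eq rU rV) .skip
        (.const rW 0 ;; .forLoop rW rN
          (.load rT aAlive rW ;; .ite (.eq rT rOne)
            (.edge rT rV rW ;; .ite (.eq rT rOne)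
              (.edge rT rU rW ;; .ite (.eq rT rOne) (.store aCand rM rW ;; .inc rM) .skip)
              .skip)
            .skip)))
      .skip)
    .skip

theorem ter_buildCand {σ : State} (hc : Ctx n s σ) {X : Finset (Fin n)} {u v : Fin n}
    (hX : IsChar (σ.arr aAlive) X) (hv : σ.reg rV = v) (hu : σ.reg rU = u) :
    Ter G buildCand σ fun τ t => t ≤ 10 * n + 10 ∧
      Lists (τ.arr aCand) (τ.reg rM) (cand G X v u) := by
  unfold buildCand
  have hXu := hX u
  by_cases h : u ∈ X ∧ ¬ G.Adj v u
  · by_cases huv : u = v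
    · subst huv
      simp [hu, hXu, h.1, hc.hO, hc.hZ, hv, adjEntry_eq]
      rw [cand, if_pos ⟨h.1, h.2⟩, if_pos rfl]
      exact (Lists.empty (fun _ => 0) u).insert (by simp) (by simp) (by simp)
    · have huv' : (u : ℕ) ≠ v := fun h' => huv (Fin.ext h')
      simp [hu, hXu, h.1, hc.hO, hc.hZ, hv, adjEntry_eq, h.2, huv']
      refine Ter.mono (Ter.forLoop (c := 8) (fun k ρ => Lists (ρ.arr aCand) (ρ.reg rM)
        (insert u (below (fun w => w ∈ X ∧ G.Adj v w ∧ G.Adj u w) k))) (by decide) (by decide) ?_ ?_) ?_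
      · simp only [State.set_reg, ↓reduceIte, Nat.reduceEqDiff, below_zero]
        exact (Lists.empty (fun _ => 0) u).insert (by simp) (by simp) (by simp)
      · rintro k ρ - hk hW ha hI
        simp [hc.hN] at hk
        lift k to Fin n using hk
        have e1 := ha.reg rV (by decide)
        have e2 := ha.reg rU (by decide)
        have e3 := ha.reg rOne (by decide)
        have e4 := ha.arr aAlive (by decide)
        simp [hc.hO, hv, hu] at e1 e2 e3 e4
        have hXk := hX k
        by_cases hk : k ∈ X ∧ G.Adj v k ∧ G.Adj u k
        · rw [below_succ_pos hk]
          simp [e1, e2, e3, e4, hW, hXk, hk, adjEntry_eq]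
          rw [Finset.insert_comm]
          refine hI.insert ?_ (fun j hj => by simp [hj.ne]) (by simp)
          rw [Finset.mem_insert, not_or]
          exact ⟨hk.2.2.ne', notMem_below _ k⟩
        · rw [below_succ_neg hk]
          by_cases h1 : k ∈ X
          · by_cases h2 : G.Adj v k
            · have h3 : ¬ G.Adj u k := fun h3 => hk ⟨h1, h2, h3⟩
              simpa [e1, e2, e3, e4, hW, hXk, h1, h2, h3, adjEntry_eq] using hI
            · simpa [e1, e3, e4, hW, hXk, h1, h2, adjEntry_eq] using hI
          · simpa [e3, e4, hW, hXk, h1] using hI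
      · rintro τ t ⟨ht, hI, -⟩
        simp [hc.hN] at ht hI
        refine ⟨by omega, ?_⟩
        rw [cand_of_ne h.1 h.2 huv]
        rw [below_self] at hI
        convert! hI using 2
        ext w
        simp
  · have h0 : cand G X v u = ∅ := by
      rw [cand, if_neg h]
    rw [h0]
    by_cases h1 : u ∈ X
    · have h2 : G.Adj v u := by
        by_contra h2
        exact h ⟨h1, h2⟩
      simpa [hu, hXu, h1, h2, hc.hO, hc.hZ, hv, adjEntry_eq] using Lists.empty _ u
    · simpa [hu, hXu, h1, hc.hO] using Lists.empty _ u

variable (G) in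
/-- `g` bounds the number of candidates for `v` and any other vertex. -/
def Bounds (X : Finset (Fin n)) (v : Fin n) (g : ℕ) : Prop :=
  ∀ u, (cand G X v u).card ≤ g

/-- Compute the largest number of candidates for the vertex `rV`. -/
def maxCand : Prog :=
  .const rVal 0 ;; .const rU 0 ;; .forLoop rU rN
    (buildCand ;; .ite (.lt rVal rM) (.copy rVal rM) .skip)

theorem ter_maxCand {σ : State} (hc : Ctx n s σ) {X : Finset (Fin n)} {v : Fin n}
    (hX : IsChar (σ.arr aAlive) X) (hv : σ.reg rV = v) :
    Ter G maxCand σ fun τ t => t ≤ n * (10 * n + 14) + 3 ∧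
      Bounds G X v (τ.reg rVal) ∧ ∀ g, Bounds G X v g → τ.reg rVal ≤ g := by
  unfold maxCand
  rw [ter_seq, ter_const, ter_seq, ter_const]
  refine Ter.mono (Ter.forLoop (c := 10 * n + 12) (fun k ρ =>
    (∀ u : Fin n, (u : ℕ) < k → (cand G X v u).card ≤ ρ.reg rVal) ∧
      ∀ g, Bounds G X v g → ρ.reg rVal ≤ g) (by decide) (by decide) (by simp) ?_) ?_
  · rintro k ρ - hk hU ha ⟨hI1, hI2⟩
    simp [hc.hN] at hk
    lift k to Fin n using hk
    have e1 := ha.reg rV (by decide)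
    have e2 := ha.arr aAlive (by decide)
    simp [hv] at e1 e2
    have hc' : Ctx n s ρ := ((hc.set _ (by decide)).set _ (by decide)).agree ha (by decide)
    refine (ter_buildCand (u := k) hc' (by rwa [e2]) e1 hU).bind ?_
    rintro ρ' t ⟨ht, hm, -⟩ ha'
    have e3 := ha'.reg rVal (by decide)
    simp [e3]
    constructor
    · intro hlt
      refine ⟨by omega, fun u hu => ?_, fun g hg => ?_⟩
      · rcases hu.lt_or_eq with h | h
        · exact (hI1 u h).trans hlt.le
        · rw [h, ← hm]
      · rw [hm]
        exact hg k
    · intro hle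
      refine ⟨by omega, fun u hu => ?_, hI2⟩
      rcases hu.lt_or_eq with h | h
      · exact hI1 u h
      · rwa [h, ← hm]
  · rintro τ t ⟨ht, ⟨hI1, hI2⟩, -⟩
    simp [hc.hN] at ht hI1
    simp only [add_assoc, Nat.reduceAdd] at ht
    exact ⟨by omega, hI1, hI2⟩

/-- Choose the vertex with the smallest largest number of candidates. -/
def pick : Prog :=
  .copy rBestVal rN ;; .inc rBestVal ;; .const rV 0 ;; .forLoop rV rN
    (.load rT aAlive rV ;; .ite (.eq rT rOne)
      (maxCand ;; .ite (.lt rVal rBestVal) (.copy rBestVal rVal ;; .copy rBest rV) .skip)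
      .skip) ;;
    .copy rV rBest

/-- The number g is known only to the analysis: a minimiser of the largest candidate number is at
least as good as any vertex x that satisfies the bound. -/
theorem ter_pick {σ : State} (hc : Ctx n s σ) {X : Finset (Fin n)} {g : ℕ}
    (hX : IsChar (σ.arr aAlive) X) (hg : ∃ x ∈ X, Bounds G X x g) :
    Ter G pick σ fun τ t => t ≤ 30 * (n + 1) ^ 3 ∧
      ∃ v ∈ X, τ.reg rV = v ∧ Bounds G X v g := by
  obtain ⟨x, hx, hxg⟩ := hg
  unfold pick
  simp only [ter_seq, ter_const, ter_copy, ter_inc]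
  refine Ter.mono (Ter.forLoop (c := n * (10 * n + 14) + 8) (fun k ρ =>
    (ρ.reg rBestVal = n + 1 ∨ ∃ v ∈ X, ρ.reg rBest = v ∧ Bounds G X v (ρ.reg rBestVal)) ∧
      ((x : ℕ) < k → ρ.reg rBestVal ≤ g ∧ ρ.reg rBestVal ≤ n))
    (by decide) (by decide) (by simp [hc.hN]) ?_) ?_
  · rintro k ρ - hk hV ha ⟨hI1, hI2⟩
    simp [hc.hN] at hk
    lift k to Fin n using hk
    have e2 := ha.arr aAlive (by decide)
    simp at e2
    have hc' : Ctx n s ρ := (((hc.set _ (by decide)).set _ (by decide)).set _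
      (by decide)).agree ha (by decide)
    have hXk := hX k
    by_cases hk : k ∈ X
    · simp [hV, e2, hXk, hk, hc'.hO]
      refine (ter_maxCand (v := k) (hc'.set _ (by decide)) (X := X) (by simpa [e2] using hX)
        (by simpa using hV)).agree.mono ?_
      rintro τ t ⟨⟨ht, h1, h2⟩, ha'⟩
      have e3 := ha'.reg rBestVal (by decide)
      have e4 := ha'.reg rBest (by decide)
      have e5 := ha'.reg rV (by decide)
      simp [hV] at e3 e4 e5
      -- No candidate set exceeds n, so the initial value n + 1 of `rBestVal` is beaten as soon as x
      -- has been inspected, and `rBest` then holds a genuine vertex.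
      have hn : τ.reg rVal ≤ n := h2 n fun u => by
        simpa using Finset.card_le_univ (cand G X k u)
      rw [e3, e4, e5]
      constructor
      · intro hlt
        refine ⟨by omega, Or.inr ⟨k, hk, rfl, h1⟩, fun hxk => ⟨?_, hn⟩⟩
        rcases hxk.lt_or_eq with h | h
        · exact hlt.le.trans (hI2 h).1
        · rw [h] at hxg
          exact h2 g hxg
      · intro hle
        refine ⟨by omega, hI1, fun hxk => ?_⟩
        rcases hxk.lt_or_eq with h | h
        · exact hI2 h
        · rw [h] at hxg
          exact ⟨hle.trans (h2 g hxg), hle.trans hn⟩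
    · simp [hV, e2, hXk, hk, hc'.hO]
      refine ⟨hI1, fun hxk => hI2 ?_⟩
      rcases hxk.lt_or_eq with h | h
      · exact h
      · exact absurd (h ▸ hx) hk
  · rintro τ t ⟨ht, ⟨hI1, hI2⟩, -⟩
    simp [hc.hN] at ht hI1 hI2
    refine ⟨by nlinarith, ?_⟩
    rcases hI1 with h | ⟨v, hv, hv', hb⟩
    · omega
    · exact ⟨v, hv, by simpa using hv', fun u => (hb u).trans hI2.1⟩

end Choice

/-! ### Running through all digit strings -/

/-- The number with the digits `d` (least significant digit first) in the mixed radix system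
with the bases `b`. -/
def mixedVal (b d : ℕ → ℕ) (k : ℕ) : ℕ :=
  ∑ j ∈ Finset.range k, d j * ∏ i ∈ Finset.range j, b i

theorem mixedVal_congr {b d e : ℕ → ℕ} {k : ℕ} (h : ∀ j < k, d j = e j) :
    mixedVal b d k = mixedVal b e k :=
  Finset.sum_congr rfl fun j hj => by rw [h j (Finset.mem_range.1 hj)]

theorem mixedVal_succ (b d : ℕ → ℕ) (k : ℕ) :
    mixedVal b d (k + 1) = mixedVal b d k + d k * ∏ i ∈ Finset.range k, b i :=
  Finset.sum_range_succ _ _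

theorem mixedVal_lt {b d : ℕ → ℕ} {k : ℕ} (h : ∀ j < k, d j < b j) :
    mixedVal b d k < ∏ i ∈ Finset.range k, b i := by
  induction k with
  | zero => simp [mixedVal]
  | succ k ih =>
    rw [mixedVal_succ, Finset.prod_range_succ]
    have h1 := ih fun j hj => h j (by omega)
    have h2 := Nat.mul_le_mul_left (∏ i ∈ Finset.range k, b i) (h k (by omega))
    rw [Nat.mul_succ] at h2
    rw [mul_comm (d k)]
    omega

/-- Uniqueness of mixed radix representations: counting through all values therefore meets every
admissible digit string. -/
theorem eq_of_mixedVal_eq {b d e : ℕ → ℕ} {k : ℕ} (hd : ∀ j < k, d j < b j)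
    (he : ∀ j < k, e j < b j) (h : mixedVal b d k = mixedVal b e k) : ∀ j < k, d j = e j := by
  induction k with
  | zero => exact fun j hj => absurd hj (by omega)
  | succ k ih =>
    rw [mixedVal_succ, mixedVal_succ] at h
    have h1 := mixedVal_lt fun j (hj : j < k) => hd j (by omega)
    have h2 := mixedVal_lt fun j (hj : j < k) => he j (by omega)
    have h3 : d k = e k := by
      have := congrArg (· / ∏ i ∈ Finset.range k, b i) h
      simpa [Nat.add_mul_div_right _ _ (Nat.zero_lt_of_lt h1), Nat.div_eq_of_lt h1,
        Nat.div_eq_of_lt h2] using this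
    intro j hj
    rcases Nat.lt_succ_iff_lt_or_eq.1 hj with hj | rfl
    · refine ih (fun j hj => hd j (by omega)) (fun j hj => he j (by omega)) ?_ j hj
      rw [h3] at h
      omega
    · exact h3

theorem State.setArr_arr_self (σ : State) (a i v : ℕ) :
    (σ.setArr a i v).arr a = fun j => if j = i then v else σ.arr a j := by
  funext j
  simp

section Odometer

variable {n s : ℕ} {G : SimpleGraph (Fin n)}

/-- Replace the digits by those of the next number; `rCarry` tells whether there is none. -/
def advance : Prog :=
  .const rCarry 1 ;; .const rJ 0 ;; .forLoop rJ rLen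
    (.ite (.eq rCarry rOne)
      (.load rX aDig rJ ;; .inc rX ;; .load rY aBase rJ ;; .ite (.eq rX rY)
        (.store aDig rJ rZero) (.store aDig rJ rX ;; .const rCarry 0))
      .skip)

/-- Along the loop, the carry acts as one more digit, whose weight is the product of the bases
already passed; with it the value is the old one plus 1. -/
theorem ter_advance {σ : State} (hc : Ctx n s σ) {b : ℕ → ℕ}
    (hb : ∀ j < σ.reg rLen, σ.arr aBase j = b j)
    (hd : ∀ j < σ.reg rLen, σ.arr aDig j < b j) :
    Ter G advance σ fun τ t => t ≤ σ.reg rLen * 10 + 3 ∧ τ.reg rCarry ≤ 1 ∧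
      (∀ j < σ.reg rLen, τ.arr aDig j < b j) ∧
      mixedVal b (τ.arr aDig) (σ.reg rLen) +
        τ.reg rCarry * ∏ i ∈ Finset.range (σ.reg rLen), b i =
          mixedVal b (σ.arr aDig) (σ.reg rLen) + 1 := by
  unfold advance
  simp only [ter_seq, ter_const]
  refine Ter.mono (Ter.forLoop (c := 8) (fun k ρ => ρ.reg rCarry ≤ 1 ∧
    (∀ j < k, ρ.arr aDig j < b j) ∧ (∀ j, k ≤ j → ρ.arr aDig j = σ.arr aDig j) ∧
      mixedVal b (ρ.arr aDig) k + ρ.reg rCarry * ∏ i ∈ Finset.range k, b i =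
          mixedVal b (σ.arr aDig) k + 1)
    (by decide) (by decide) (by simp [mixedVal]) ?_) ?_
  · rintro k ρ - hk hJ ha ⟨h1, h2, h3, h4⟩
    simp at hk
    have e1 := ha.reg rZero (by decide)
    have e2 := ha.reg rOne (by decide)
    have e3 := ha.arr aBase (by decide)
    simp [hc.hZ, hc.hO] at e1 e2 e3
    have e4 := h3 k le_rfl
    have e5 := hb k hk
    have e6 := hd k hk
    rw [← e3] at e5
    have hcongr : ∀ v, mixedVal b (fun j => if j = k then v else ρ.arr aDig j) k =
        mixedVal b (ρ.arr aDig) k := fun v => mixedVal_congr fun j hj => if_neg hj.ne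
    rcases Nat.le_one_iff_eq_zero_or_eq_one.1 h1 with h0 | h0
    · simp [h0, e2]
      rw [h0] at h4
      refine ⟨fun j hj => ?_, fun j hj => h3 j (by omega), ?_⟩
      · rcases hj.lt_or_eq with hj | rfl
        · exact h2 j hj
        · rwa [e4]
      · rw [mixedVal_succ, mixedVal_succ, e4]
        omega
    · rw [h0, one_mul] at h4
      by_cases h5 : σ.arr aDig k + 1 = b k
      · simp [h0, e1, e2, hJ, e4, e5, h5]
        refine ⟨fun j hj => ?_, fun j hj => ?_, ?_⟩
        · split_ifs with hjk
          · rw [hjk]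
            omega
          · exact h2 j (by omega)
        · rw [if_neg (by omega)]
          exact h3 j (by omega)
        · rw [mixedVal_succ, mixedVal_succ, State.setArr_arr_self, State.set_arr,
            State.set_arr, State.set_arr, hcongr, Finset.prod_range_succ, ← h5]
          simp
          linarith
      · simp [h0, e1, e2, hJ, e4, e5, h5]
        refine ⟨fun j hj => ?_, fun j hj => ?_, ?_⟩
        · split_ifs with hjk
          · rw [hjk]
            omega
          · exact h2 j (by omega)
        · rw [if_neg (by omega)]
          exact h3 j (by omega)
        · rw [mixedVal_succ, mixedVal_succ, State.setArr_arr_self, State.set_arr,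
            State.set_arr, State.set_arr, hcongr]
          simp
          linarith
  · rintro τ t ⟨ht, ⟨h1, h2, -, h4⟩, -⟩
    simp at ht h2 h4
    exact ⟨by omega, h1, h2, h4⟩

/-- Run `p` for all digit strings. -/
def odometer (p : Prog) : Prog := .loop (.eq rCarry rZero) (p ;; advance)

theorem ter_odometer {p : Prog} {σ : State} (hc : Ctx n s σ) {b : ℕ → ℕ} {c : ℕ}
    (I : ℕ → State → Prop)
    (hpr : ∀ x ∈ [rN, rS, rZero, rOne, rTwo, rLen, rCarry], x ∉ p.regs)
    (hpa : ∀ a ∈ [aDig, aBase], a ∉ p.arrs)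
    (hb : ∀ j < σ.reg rLen, σ.arr aBase j = b j)
    (hbp : ∀ j < σ.reg rLen, 0 < b j)
    (hd : ∀ j < σ.reg rLen, σ.arr aDig j = 0) (hcarry : σ.reg rCarry = 0)
    (h0 : I 0 σ)
    (hI : ∀ N ρ τ, Agree advance ρ τ → I N ρ → I N τ)
    (hstep : ∀ N ρ, Agree (odometer p) σ ρ → (∀ j < σ.reg rLen, ρ.arr aDig j < b j) →
      mixedVal b (ρ.arr aDig) (σ.reg rLen) = N → I N ρ →
      Ter G p ρ fun τ t => t ≤ c ∧ I (N + 1) τ) :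
    Ter G (odometer p) σ fun τ t =>
      t ≤ (∏ i ∈ Finset.range (σ.reg rLen), b i) * (c + σ.reg rLen * 10 + 4) + 1 ∧
        I (∏ i ∈ Finset.range (σ.reg rLen), b i) τ := by
  set D := ∏ i ∈ Finset.range (σ.reg rLen), b i with hD
  -- Induction on the number r of strings still to come; the carry appears exactly when r = 0, since
  -- D is one more than the largest value.
  suffices h : ∀ r N ρ, N + r = D → Agree (odometer p) σ ρ → ρ.reg rCarry ≤ 1 →
      (ρ.reg rCarry = 0 → mixedVal b (ρ.arr aDig) (σ.reg rLen) = N) →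
      (ρ.reg rCarry = 1 → r = 0) →
      (∀ j < σ.reg rLen, ρ.arr aDig j < b j) → I N ρ →
      Ter G (odometer p) ρ fun τ t => t ≤ r * (c + σ.reg rLen * 10 + 4) + 1 ∧ I D τ by
    refine h D 0 σ (by simp) (Agree.refl _ _) (by simp [hcarry]) (fun _ => ?_) (by simp [hcarry])
      (fun j hj => by rw [hd j hj]; exact hbp j hj) h0
    rw [mixedVal_congr (e := fun _ => 0) hd]
    simp [mixedVal]
  have hregs : ∀ x, x ∉ p.regs → x ∉ advance.regs → x ∉ (odometer p).regs := by
    intro x h1 h2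
    simp only [odometer, Prog.regs, List.mem_append, not_or]
    exact ⟨h1, h2⟩
  intro r
  induction r with
  | zero =>
    intro N ρ hN hag hle hval _ hdig hIN
    have hN' : N = D := by omega
    have : ρ.reg rCarry = 1 := by
      rcases Nat.le_one_iff_eq_zero_or_eq_one.1 hle with h | h
      · have h' := mixedVal_lt hdig
        rw [hval h] at h'
        omega
      · exact h
    refine ⟨ρ, 1, .loop_done ?_, by omega, hN' ▸ hIN⟩
    rw [holds_eq, this, hag.reg rZero (hregs _ (hpr _ (by simp)) (by decide)), hc.hZ]
    decide
  | succ r ih =>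
    intro N ρ hN hag hle hval hr hdig hIN
    have h0 : ρ.reg rCarry = 0 := by
      rcases Nat.le_one_iff_eq_zero_or_eq_one.1 hle with h | h
      · exact h
      · exact absurd (hr h) (by omega)
    have hcρ : Ctx n s ρ := hc.agree hag fun x hx => hregs x (hpr x (by
      simp only [List.mem_cons, List.not_mem_nil, or_false] at hx ⊢
      tauto)) (by
        simp only [List.mem_cons, List.not_mem_nil, or_false] at hx
        rcases hx with rfl | rfl | rfl | rfl | rfl <;> decide)
    have hL : ρ.reg rLen = σ.reg rLen := hag.reg _ (hregs _ (hpr _ (by simp)) (by decide))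
    have hB : ρ.arr aBase = σ.arr aBase := hag.arr _ (by
      simp only [odometer, Prog.arrs, List.mem_append, not_or]
      exact ⟨hpa _ (by simp), by decide⟩)
    obtain ⟨ρ₁, t₁, hr₁, ht₁, hI₁⟩ := hstep N ρ hag hdig (hval h0) hIN
    have a₁ := hr₁.agree
    have hcρ₁ : Ctx n s ρ₁ := hcρ.agree a₁ fun x hx => hpr x (by
      simp only [List.mem_cons, List.not_mem_nil, or_false] at hx ⊢
      tauto)
    have hL₁ : ρ₁.reg rLen = σ.reg rLen := (a₁.reg _ (hpr _ (by simp))).trans hL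
    have hD₁ : ρ₁.arr aDig = ρ.arr aDig := a₁.arr _ (hpa _ (by simp))
    have hB₁ : ρ₁.arr aBase = σ.arr aBase := (a₁.arr _ (hpa _ (by simp))).trans hB
    obtain ⟨ρ₂, t₂, hr₂, ht₂, hle₂, hd₂, hv₂⟩ := ter_advance (G := G) hcρ₁ (b := b)
      (by rwa [hL₁, hB₁]) (by rwa [hL₁, hD₁])
    rw [hL₁] at ht₂ hd₂ hv₂
    rw [hD₁, hval h0] at hv₂
    have hI₂ := hI _ _ _ hr₂.agree hI₁
    have hrun : Runs G (p ;; advance) ρ ρ₂ (t₁ + t₂) := .seq hr₁ hr₂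
    have hag₂ : Agree (odometer p) σ ρ₂ :=
      hag.trans ⟨hrun.agree.reg, hrun.agree.arr, hrun.agree.out⟩
    obtain ⟨τ, u, hru, hu, hIτ⟩ := ih (N + 1) ρ₂ (by omega) hag₂ hle₂
      (fun h => by rw [h] at hv₂; omega)
      (fun h => by rw [h, one_mul] at hv₂; omega) hd₂ hI₂
    refine ⟨τ, t₁ + t₂ + u + 1, .loop_step ?_ hrun hru, ?_, hIτ⟩
    · rw [holds_eq, h0, hcρ.hZ]
    · rw [add_mul]
      omega

/-- Set all digits to `0`, and write down their bases. -/
def resetDigits : Prog :=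
  .const rCarry 0 ;; .const rJ 0 ;;
    .forLoop rJ rMB (.store aBase rJ rN ;; .store aDig rJ rZero) ;;
    .const rI 0 ;; .forLoop rI rM (.store aBase rJ rTwo ;; .store aDig rJ rZero ;; .inc rJ) ;;
    .copy rLen rJ

/-- `l` digits in base `n`, and binary digits. -/
def bases (n l : ℕ) (j : ℕ) : ℕ := if j < l then n else 2

theorem ter_resetDigits {σ : State} (hc : Ctx n s σ) :
    Ter G resetDigits σ fun τ t => t ≤ (σ.reg rMB + σ.reg rM) * 5 + 6 ∧ τ.reg rCarry = 0 ∧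
      τ.reg rLen = σ.reg rMB + σ.reg rM ∧
      ∀ j < σ.reg rMB + σ.reg rM, τ.arr aBase j = bases n (σ.reg rMB) j ∧ τ.arr aDig j = 0 := by
  unfold resetDigits
  rw [ter_seq, ter_const, ter_seq, ter_const]
  have hc' : Ctx n s ((σ.set rCarry 0).set rJ 0) := (hc.set _ (by decide)).set _ (by decide)
  refine (Ter.forLoop (c := 2) (fun k ρ => ∀ j < k, ρ.arr aBase j = n ∧ ρ.arr aDig j = 0)
    (by decide) (by decide) (by simp) ?_).bind ?_
  · rintro k ρ - hk hJ ha hI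
    have hc₁ := hc'.agree ha (by decide)
    simp [hJ, hc₁.hN, hc₁.hZ]
    exact fun j hj => ⟨fun h => (hI j (by omega)).1, fun h => (hI j (by omega)).2⟩
  rintro ρ t ⟨ht, hI, hJ⟩ ha
  have hc₁ := hc'.agree ha (by decide)
  have e1 := ha.reg rMB (by decide)
  have e2 := ha.reg rM (by decide)
  have e3 := ha.reg rCarry (by decide)
  simp at e1 e2 e3 hI hJ ht
  rw [ter_seq, ter_const]
  refine (Ter.forLoop (c := 3) (fun k ρ => ρ.reg rJ = σ.reg rMB + k ∧
    ∀ j < σ.reg rMB + k, ρ.arr aBase j = bases n (σ.reg rMB) j ∧ ρ.arr aDig j = 0)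
    (by decide) (by decide) ?_ ?_).bind ?_
  · simp [hJ]
    intro j hj
    rw [bases, if_pos hj]
    exact hI j hj
  · rintro k ρ' - hk hJ' ha' ⟨h1, h2⟩
    have hc₂ := (hc₁.set (x := rI) 0 (by decide)).agree ha' (by decide)
    simp [h1, hc₂.hZ, hc₂.hT]
    refine ⟨by ring, fun j hj => ?_⟩
    by_cases h : j = σ.reg rMB + k
    · simp [h, bases]
    · simpa [h] using h2 j (by omega)
  rintro ρ' t' ⟨ht', ⟨h1, h2⟩, -⟩ ha'
  have e4 := ha'.reg rCarry (by decide)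
  simp [e2, e3] at ht' h1 h2 e4
  simp [e4, h1]
  refine ⟨by omega, h2⟩

end Odometer

/-! ### The enumeration of all candidates -/

section Enumeration

variable {n s : ℕ} {G : SimpleGraph (Fin n)}

variable (G) in
/-- The program `emit` treats the current set: if `J P` describes the memory after treating the
sets in `P`, and the current set is `S`, then `J (insert S P)` describes the memory afterwards. -/
structure EmitSpec (s : ℕ) (J : Set (Finset (Fin n)) → State → Prop) (emit : Prog) (c : ℕ) :
    Prop where
  regs : ∀ x ∈ emit.regs, 30 ≤ x
  arrs : ∀ a ∈ emit.arrs, 10 ≤ a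
  stable : ∀ P σ τ, (∀ x, x ≤ 2 ∨ 40 ≤ x → τ.reg x = σ.reg x) →
    (∀ a, 10 ≤ a → τ.arr a = σ.arr a) → τ.out = σ.out → J P σ → J P τ
  run : ∀ P S σ, Ctx n s σ → Cur G S σ → IsDefectiveClique G s S → J P σ →
    Ter G emit σ fun τ t => t ≤ c * (n + 1) ^ 2 ∧ J (insert S P) τ

variable {J : Set (Finset (Fin n)) → State → Prop} {emit : Prog} {c : ℕ}

/-- The enumeration writes only to registers from 3 to 39 and to arrays below 10, while `J` is
insensitive to these; registers from 30 to 39 are scratch space shared with `emit`. -/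
theorem EmitSpec.agree (h : EmitSpec G s J emit c) {p : Prog} {σ τ : State} (ha : Agree p σ τ)
    (hr : ∀ x ∈ p.regs, 3 ≤ x ∧ x < 40) (hp : ∀ a ∈ p.arrs, a < 10) (ho : p.prints = false)
    {P : Set (Finset (Fin n))} (hJ : J P σ) : J P τ := by
  refine h.stable P σ τ (fun x hx => ha.reg x fun h' => ?_) (fun a hx => ha.arr a fun h' => ?_)
    (ha.out ho) hJ
  · have := hr x h'
    omega
  · have := hp a h'
    omega

theorem EmitSpec.notMem_regs (h : EmitSpec G s J emit c) {x : ℕ} (hx : x < 30) :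
    x ∉ emit.regs := fun h' => by
  have := h.regs x h'
  omega

theorem EmitSpec.notMem_arrs (h : EmitSpec G s J emit c) {a : ℕ} (ha : a < 10) :
    a ∉ emit.arrs := fun h' => by
  have := h.arrs a h'
  omega

/-- Treat the two sets that belong to the current digits. -/
def processBoth (emit : Prog) : Prog :=
  .copy rBud rS ;; .copy rUse rMB ;; process ;; emit ;;
    .const rBud 0 ;; .const rUse 0 ;; process ;; emit

variable (G) in
/-- `P` contains the sets that belong to the digits `d`. -/
def Covered (s l m : ℕ) (w : ℕ → Fin n) (R : List (Fin n)) (P : Set (Finset (Fin n)))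
    (d : ℕ → ℕ) : Prop :=
  (∀ B : List (Fin n), B.length = l → (∀ j (h : j < B.length), d j = B[j]) →
    (R.foldl (ins G s) ((((List.range m).filter fun j => d (l + j) = 1).map w).foldl (ins G s)
      (B.foldl (ins G s) ∅))) ∈ P) ∧
  (R.drop (d 0 - (n - R.length))).foldl (ins G s)
    ((R.take (d 0 - (n - R.length))).foldl (ins G 0)
      ((((List.range m).filter fun j => d (l + j) = 1).map w).foldl (ins G 0) ∅)) ∈ P

theorem Covered.mono {l m : ℕ} {w : ℕ → Fin n} {R : List (Fin n)} {P Q : Set (Finset (Fin n))}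
    {d : ℕ → ℕ} (h : Covered G s l m w R P d) (hPQ : P ⊆ Q) : Covered G s l m w R Q d :=
  ⟨fun B h1 h2 => hPQ (h.1 B h1 h2), hPQ h.2⟩

theorem Covered.congr {l m : ℕ} (hl : 0 < l) {w : ℕ → Fin n} {R : List (Fin n)}
    {P : Set (Finset (Fin n))} {d e : ℕ → ℕ} (h : Covered G s l m w R P d)
    (hde : ∀ j < l + m, d j = e j) : Covered G s l m w R P e := by
  have hf : (List.range m).filter (fun j => d (l + j) = 1) =
      (List.range m).filter (fun j => e (l + j) = 1) := by
    refine List.filter_congr fun j hj => ?_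
    rw [hde (l + j) (by simpa using hj)]
  unfold Covered at h ⊢
  rw [hf, hde 0 (by omega)] at h
  exact ⟨fun B h1 h2 => h.1 B h1 fun j hj => by rw [hde j (by omega), h2 j hj], h.2⟩

theorem isDefectiveClique_greedy {d : ℕ} (l l₁ l₂ l₃ : List (Fin n)) (hd : d ≤ s) :
    IsDefectiveClique G s (l₃.foldl (ins G s) (l₂.foldl (ins G d) (l₁.foldl (ins G d)
      (l.foldl (ins G d) ∅)))) :=
  isDefectiveClique_foldl l₃ ((isDefectiveClique_foldl l₂ (isDefectiveClique_foldl l₁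
    (isDefectiveClique_foldl l (isDefectiveClique_empty d)))).mono hd)

/-- One digit string serves two guesses. The first run reads the leading digits as the set B and has
budget s throughout. The second ignores B, starts with budget 0, and reads the first digit as the
switch position. -/
theorem ter_processBoth (he : EmitSpec G s J emit c) {σ : State} (hc : Ctx n s σ)
    {R : List (Fin n)} {w : ℕ → Fin n} (hl : 0 < σ.reg rMB) (hln : σ.reg rMB ≤ n)
    (hd : ∀ j < σ.reg rMB, σ.arr aDig j < n)
    (hw : ∀ j < σ.reg rM, σ.arr aCand j = w j) (hM : σ.reg rM ≤ n)
    (hR : Deleted R σ) {P : Set (Finset (Fin n))} (hP : ∀ S ∈ P, IsDefectiveClique G s S)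
    (hJ : J P σ) :
    Ter G (processBoth emit) σ fun τ t => t ≤ (2 * c + 124) * (n + 1) ^ 2 ∧
      ∃ Q, P ⊆ Q ∧ (∀ S ∈ Q, IsDefectiveClique G s S) ∧ J Q τ ∧
        Covered G s (σ.reg rMB) (σ.reg rM) w R Q (σ.arr aDig) := by
  classical
  obtain ⟨B, hB, hBd⟩ : ∃ B : List (Fin n), σ.reg rMB = B.length ∧
      ∀ j (h : j < B.length), σ.arr aDig j = B[j] :=
    ⟨List.ofFn fun j : Fin (σ.reg rMB) => ⟨σ.arr aDig j, hd j j.2⟩, by simp, by simp⟩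
  have hBu : ∀ B' : List (Fin n), B'.length = σ.reg rMB →
      (∀ j (h : j < B'.length), σ.arr aDig j = B'[j]) → B' = B := by
    intro B' h1 h2
    refine List.ext_getElem (by omega) fun j hj hj' => ?_
    rw [Fin.ext_iff, ← h2, ← hBd]
  have htop : σ.reg rTop = n - R.length := by
    have := hR.top
    omega
  have hd0 : σ.arr aDig 0 ≤ n := (hd 0 hl).le
  unfold processBoth
  rw [ter_seq, ter_copy, ter_seq, ter_copy]
  refine (ter_process (B := B) (R := R) (w := w) ((hc.set _ (by decide)).set _ (by decide))
    (by simpa using hB) (by omega) (by simpa using hBd) (by simpa using hw) (by simpa using hM)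
    ⟨by simpa using hR.top, by simpa using hR.ord⟩ (by simpa using hd0)).bind ?_
  rintro ρ₁ t₁ ⟨ht₁, h₁⟩ a₁
  have c₁ := ((hc.set _ (by decide)).set _ (by decide)).agree a₁ (by decide)
  have J₁ : J P ρ₁ := he.agree a₁ (by decide) (by decide) (by decide)
    (he.stable P σ _ (fun x hx => by
      simp
      split_ifs <;> first | rfl | omega) (fun _ _ => rfl) rfl hJ)
  simp [hc.hS, htop] at h₁
  -- With the same budget on both sides, the switch has no effect.
  rw [← List.foldl_append, List.take_append_drop] at h₁
  refine (he.run P _ ρ₁ c₁ h₁ (isDefectiveClique_greedy B _ [] R le_rfl) J₁).bind ?_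
  rintro ρ₂ t₂ ⟨ht₂, J₂⟩ a₂
  have c₂ := c₁.agree a₂ fun x hx => he.notMem_regs (by
    simp only [List.mem_cons, List.not_mem_nil, or_false] at hx
    omega)
  rw [ter_seq, ter_const, ter_seq, ter_const]
  have e : ∀ x ∈ [rMB, rM, rTop], ρ₂.reg x = σ.reg x := by
    intro x hx
    simp only [List.mem_cons, List.not_mem_nil, or_false] at hx
    rw [a₂.reg x (he.notMem_regs (by omega))]
    rcases hx with rfl | rfl | rfl
    · simp [a₁.reg rMB (by decide)]
    · simp [a₁.reg rM (by decide)]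
    · simp [a₁.reg rTop (by decide)]
  have e' : ∀ a ∈ [aDig, aCand, aOrd], ρ₂.arr a = σ.arr a := by
    intro a ha
    simp only [List.mem_cons, List.not_mem_nil, or_false] at ha
    rw [a₂.arr a (he.notMem_arrs (by omega))]
    rcases ha with rfl | rfl | rfl
    · simp [a₁.arr aDig (by decide)]
    · simp [a₁.arr aCand (by decide)]
    · simp [a₁.arr aOrd (by decide)]
  have eMB := e rMB (by simp)
  have eM := e rM (by simp)
  have eTop := e rTop (by simp)
  have eD := e' aDig (by simp)
  have eC := e' aCand (by simp)
  have eO := e' aOrd (by simp)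
  refine (ter_process (B := []) (R := R) (w := w) ((c₂.set _ (by decide)).set _ (by decide))
    (by simp) (by simp) (by simp) (by simpa [eM, eC] using hw) (by simpa [eM] using hM)
    ⟨by simpa [eTop] using hR.top, by simpa [eTop, eO] using hR.ord⟩
    (by simpa [eD] using hd0)).bind ?_
  rintro ρ₃ t₃ ⟨ht₃, h₃⟩ a₃
  have c₃ := ((c₂.set _ (by decide)).set _ (by decide)).agree a₃ (by decide)
  have J₃ := he.agree a₃ (by decide) (by decide) (by decide)
    (he.stable _ ρ₂ _ (fun x hx => by
      simp
      split_ifs <;> first | rfl | omega) (fun _ _ => rfl) rfl J₂)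
  simp only [State.set_reg, State.set_arr, Nat.reduceEqDiff, ↓reduceIte, eM, eMB, eTop, eD,
    htop] at h₃
  refine (he.run _ _ ρ₃ c₃ h₃ (isDefectiveClique_greedy [] _ _ _ (Nat.zero_le s)) J₃).mono ?_
  rintro τ t ⟨ht, hJ'⟩
  refine ⟨by nlinarith, _, ?_, ?_, hJ', fun B' h1 h2 => ?_, Set.mem_insert _ _⟩
  · exact (Set.subset_insert _ _).trans (Set.subset_insert _ _)
  · rintro S (rfl | rfl | hS)
    · exact isDefectiveClique_greedy [] _ _ _ (Nat.zero_le s)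
    · exact isDefectiveClique_greedy B _ [] R le_rfl
    · exact hP S hS
  · rw [hBu B' h1 h2]
    exact Set.mem_insert_of_mem _ (Set.mem_insert _ _)

end Enumeration

/-! ### All guesses for one list of candidates -/

section Visit

variable {n s : ℕ} {G : SimpleGraph (Fin n)} {J : Set (Finset (Fin n)) → State → Prop}
  {emit : Prog} {c : ℕ}

theorem toFinset_selected {l m : ℕ} {w : ℕ → Fin n} {C A : Finset (Fin n)}
    (hC : (Finset.range m).image w = C) (hA : A ⊆ C) {d : ℕ → ℕ}
    (hd : ∀ j < m, d (l + j) = if w j ∈ A then 1 else 0) :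
    (((List.range m).filter fun j => d (l + j) = 1).map w).toFinset = A := by
  ext x
  simp only [List.mem_toFinset, List.mem_map, List.mem_filter, List.mem_range, decide_eq_true_eq]
  constructor
  · rintro ⟨j, ⟨hj, h1⟩, rfl⟩
    by_contra h
    simp [hd j hj, h] at h1
  · intro hx
    obtain ⟨j, hj, rfl⟩ := Finset.mem_image.1 (hC.symm ▸ hA hx)
    have hj := Finset.mem_range.1 hj
    exact ⟨j, ⟨hj, by simp [hd j hj, hx]⟩, rfl⟩

theorem foldl_selected {l m : ℕ} {w : ℕ → Fin n} {C A S : Finset (Fin n)} {e : ℕ}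
    (hC : (Finset.range m).image w = C) (hA : A ⊆ C) {d : ℕ → ℕ}
    (hd : ∀ j < m, d (l + j) = if w j ∈ A then 1 else 0) (h : IsDefectiveClique G e (S ∪ A)) :
    (((List.range m).filter fun j => d (l + j) = 1).map w).foldl (ins G e) S = S ∪ A := by
  rw [foldl_ins_of_isDefectiveClique _ (by rwa [toFinset_selected hC hA hd]),
    toFinset_selected hC hA hd]

/-- Every guess is encoded by an admissible digit string, and a guessed set that is defective is
built exactly, so the treated sets include all extensions that the covering argument asks for. -/
theorem extends_of_covered {l m : ℕ} {w : ℕ → Fin n} {R : List (Fin n)} {C : Finset (Fin n)}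
    {P : Set (Finset (Fin n))} (hs : 0 < l) (hl : l = min (s - 1) n)
    (hC : (Finset.range m).image w = C) (hR : R ≠ []) (hRn : R.length ≤ n)
    (h : ∀ d, (∀ j < l + m, d j < bases n l j) → Covered G s l m w R P d) :
    Extends G s C R P := by
  have hn : 0 < n := by omega
  have hclique : ∀ A ⊆ C, IsDefectiveClique G 0 A → ∀ R₁ R₂, R₂ ≠ [] → R₁ ++ R₂ = R →
      R₂.foldl (ins G s) (R₁.foldl (ins G 0) A) ∈ P := by
    rintro A hA hA0 R₁ R₂ hR₂ rfl
    -- The position of the head of R₂ in `aOrd` is a legal digit because R₂ is nonempty; only digit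
    -- 0 matters here.
    let d : ℕ → ℕ := fun j => if j < l then n - R₂.length else if w (j - l) ∈ A then 1 else 0
    have hd : ∀ j < m, d (l + j) = if w j ∈ A then 1 else 0 := fun j _ => by simp [d]
    have hpos := List.length_pos_iff.2 hR₂
    have hcov := (h d fun j hj => by
      simp only [d, bases]
      split_ifs <;> omega).2
    rw [foldl_selected hC hA hd (by rwa [Finset.empty_union]), Finset.empty_union] at hcov
    have hlen : d 0 - (n - (R₁ ++ R₂).length) = R₁.length := by
      simp only [d, if_pos hs]
      simp only [List.length_append] at hRn ⊢
      omega
    rw [hlen] at hcov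
    simpa using hcov
  refine ⟨fun A hA B hB hAB => ?_, hclique⟩
  -- The l digits leave no room for a shorter list, so B is padded with an element of A ∪ B. If
  -- there is none, the clique ∅ with the switch at the very start gives the same extension.
  rcases (A ∪ B).eq_empty_or_nonempty with h0 | ⟨x, hx⟩
  · rw [h0]
    exact hclique ∅ (Finset.empty_subset C) (isDefectiveClique_empty 0) [] R hR rfl
  · have hBl : B.card ≤ l := by
      rw [hl]
      exact le_min hB (by simpa using Finset.card_le_univ B)
    let Bl : List (Fin n) := B.toList ++ List.replicate (l - B.card) x
    have hBlen : Bl.length = l := by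
      simp [Bl]
      omega
    have hunion : Bl.toFinset ∪ A = A ∪ B := by
      ext y
      simp only [Bl, List.toFinset_append, Finset.toList_toFinset, Finset.mem_union,
        List.mem_toFinset, List.mem_replicate]
      constructor
      · rintro ((h | ⟨-, rfl⟩) | h)
        · exact Or.inr h
        · exact Finset.mem_union.1 hx
        · exact Or.inl h
      · rintro (h | h)
        · exact Or.inr h
        · exact Or.inl (Or.inl h)
    let d : ℕ → ℕ := fun j => if hj : j < Bl.length then Bl[j] else if w (j - l) ∈ A then 1 else 0
    have hd : ∀ j < m, d (l + j) = if w j ∈ A then 1 else 0 := fun j _ => by simp [d, hBlen]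
    have hcov := (h d fun j hj => by
      simp only [d, bases, hBlen]
      split_ifs <;> simp).1 Bl hBlen fun j hj => by simp [d, hj]
    have hB' : Bl.foldl (ins G s) ∅ = Bl.toFinset := by
      rw [foldl_ins_of_isDefectiveClique _ (by
        rw [Finset.empty_union]
        exact hAB.subset (hunion ▸ Finset.subset_union_left)), Finset.empty_union]
    rw [hB', foldl_selected hC hA hd (by rwa [hunion]), hunion] at hcov
    exact hcov

/-- Treat all sets that belong to the current list of candidates. -/
def visit (emit : Prog) : Prog := resetDigits ;; odometer (processBoth emit)

/-- As `emit` is a variable, `decide` cannot compute the frame; it is applied with `.skip` in its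
place. The same device recurs for the larger programs. -/
theorem notMem_regs_processBoth {x : ℕ} (h : x ∉ emit.regs)
    (hx : x ∉ (processBoth .skip).regs) : x ∉ (processBoth emit).regs := by
  simp only [processBoth, Prog.regs, List.mem_append, not_or] at hx ⊢
  tauto

theorem notMem_arrs_processBoth {x : ℕ} (h : x ∉ emit.arrs)
    (hx : x ∉ (processBoth .skip).arrs) : x ∉ (processBoth emit).arrs := by
  simp only [processBoth, Prog.arrs, List.mem_append, not_or] at hx ⊢
  tauto

theorem notMem_regs_odometer {x : ℕ} (h : x ∉ emit.regs)
    (hx : x ∉ (odometer (processBoth .skip)).regs) : x ∉ (odometer (processBoth emit)).regs := by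
  simp only [odometer, Prog.regs, List.mem_append, not_or] at hx ⊢
  exact ⟨notMem_regs_processBoth h hx.1, hx.2⟩

theorem notMem_arrs_odometer {x : ℕ} (h : x ∉ emit.arrs)
    (hx : x ∉ (odometer (processBoth .skip)).arrs) : x ∉ (odometer (processBoth emit)).arrs := by
  simp only [odometer, Prog.arrs, List.mem_append, not_or] at hx ⊢
  exact ⟨notMem_arrs_processBoth h hx.1, hx.2⟩

theorem prod_bases (n l m : ℕ) :
    ∏ i ∈ Finset.range (l + m), bases n l i = n ^ l * 2 ^ m := by
  rw [Finset.prod_range_add, Finset.prod_congr (g := fun _ => n) rfl fun i hi => by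
    rw [bases, if_pos (Finset.mem_range.1 hi)]]
  simp [bases]

theorem ter_visit (he : EmitSpec G s J emit c) {σ : State} (hc : Ctx n s σ)
    {R : List (Fin n)} {C : Finset (Fin n)} (hl : 0 < σ.reg rMB)
    (hl' : σ.reg rMB = min (s - 1) n) (hC : Lists (σ.arr aCand) (σ.reg rM) C)
    (hR : Deleted R σ) (hR0 : R ≠ []) {P : Set (Finset (Fin n))}
    (hP : ∀ S ∈ P, IsDefectiveClique G s S) (hJ : J P σ) :
    Ter G (visit emit) σ fun τ t =>
      t ≤ n ^ (min (s - 1) n) * 2 ^ C.card * ((2 * c + 170) * (n + 1) ^ 2) ∧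
      ∃ Q, P ⊆ Q ∧ (∀ S ∈ Q, IsDefectiveClique G s S) ∧ J Q τ ∧ Extends G s C R Q := by
  obtain ⟨hm, w, hw, hwC⟩ := hC
  have hn : 0 < n := by omega
  have hCn : C.card ≤ n := by simpa using Finset.card_le_univ C
  unfold visit
  refine (ter_resetDigits hc).bind ?_
  rintro ρ₁ t₁ ⟨ht₁, hcarry, hlen, hdig⟩ a₁
  have c₁ := hc.agree a₁ (by decide)
  have J₁ := he.agree a₁ (by decide) (by decide) (by decide) hJ
  have mb₁ := a₁.reg rMB (by decide)
  have m₁ := a₁.reg rM (by decide)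
  have top₁ := a₁.reg rTop (by decide)
  have cand₁ := a₁.arr aCand (by decide)
  have ord₁ := a₁.arr aOrd (by decide)
  -- Invariant: the strings of value below N have been covered by the growing family Q of defective
  -- cliques.
  refine (ter_odometer (G := G) (p := processBoth emit) (b := bases n (σ.reg rMB))
    (c := (2 * c + 124) * (n + 1) ^ 2) c₁
    (fun N ρ => ∃ Q, P ⊆ Q ∧ (∀ S ∈ Q, IsDefectiveClique G s S) ∧ J Q ρ ∧
      ∀ d, (∀ j < σ.reg rMB + σ.reg rM, d j < bases n (σ.reg rMB) j) →
        mixedVal (bases n (σ.reg rMB)) d (σ.reg rMB + σ.reg rM) < N →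
          Covered G s (σ.reg rMB) (σ.reg rM) w R Q d)
    ?_ ?_ (fun j hj => (hdig j (by omega)).1) ?_ (fun j hj => (hdig j (by omega)).2) hcarry
    ⟨P, subset_rfl, hP, J₁, fun d _ h => absurd h (by omega)⟩ ?_ ?_).mono ?_
  · intro x hx
    refine notMem_regs_processBoth (he.notMem_regs ?_) ?_
    · simp only [List.mem_cons, List.not_mem_nil, or_false] at hx
      omega
    · revert x
      decide
  · intro x hx
    refine notMem_arrs_processBoth (he.notMem_arrs ?_) ?_
    · simp only [List.mem_cons, List.not_mem_nil, or_false] at hx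
      omega
    · revert x
      decide
  · intro j _
    unfold bases
    split_ifs <;> omega
  · rintro N ρ τ ha ⟨Q, h1, h2, h3, h4⟩
    exact ⟨Q, h1, h2, he.agree ha (by decide) (by decide) (by decide) h3, h4⟩
  · rintro N ρ ha hdρ hN ⟨Q, h1, h2, h3, h4⟩
    have hreg : ∀ x, x < 30 → x ∉ (odometer (processBoth .skip)).regs → ρ.reg x = ρ₁.reg x :=
      fun x hx hx' => ha.reg x (notMem_regs_odometer (he.notMem_regs hx) hx')
    have harr : ∀ x, x < 10 → x ∉ (odometer (processBoth .skip)).arrs → ρ.arr x = ρ₁.arr x :=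
      fun x hx hx' => ha.arr x (notMem_arrs_odometer (he.notMem_arrs hx) hx')
    have cρ : Ctx n s ρ := c₁.agree ha fun x hx => notMem_regs_odometer (he.notMem_regs (by
      simp only [List.mem_cons, List.not_mem_nil, or_false] at hx
      omega)) (by
        revert x
        decide)
    have mbρ := (hreg rMB (by decide) (by decide)).trans mb₁
    have mρ := (hreg rM (by decide) (by decide)).trans m₁
    have topρ := (hreg rTop (by decide) (by decide)).trans top₁
    have candρ := (harr aCand (by decide) (by decide)).trans cand₁
    have ordρ := (harr aOrd (by decide) (by decide)).trans ord₁
    rw [hlen] at hdρ hN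
    refine (ter_processBoth he cρ (R := R) (w := w) (by omega) (by omega) ?_
      (by rwa [mρ, candρ]) (by omega) ⟨by rw [topρ]; exact hR.top, by
        rw [topρ, ordρ]; exact hR.ord⟩ h2 h3).mono ?_
    · intro j hj
      have := hdρ j (by omega)
      rwa [bases, if_pos (by omega)] at this
    · rintro τ t ⟨ht, Q', g1, g2, g3, g4⟩
      rw [mbρ, mρ] at g4
      refine ⟨ht, Q', h1.trans g1, g2, g3, fun d hd hdN => ?_⟩
      rcases Nat.lt_succ_iff_lt_or_eq.1 hdN with h | h
      · exact (h4 d hd h).mono g1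
      · exact g4.congr hl (eq_of_mixedVal_eq hdρ hd (hN.trans h.symm))
  · rintro τ t ⟨ht, Q, h1, h2, h3, h4⟩
    rw [hlen] at ht h4
    refine ⟨?_, Q, h1, h2, h3, extends_of_covered hl hl' hwC hR0 (by have := hR.top; omega)
      fun d hd => h4 d hd (mixedVal_lt hd)⟩
    rw [prod_bases] at ht
    rw [← hl', ← hm]
    have hD : 1 ≤ n ^ σ.reg rMB * 2 ^ σ.reg rM := Nat.one_le_iff_ne_zero.2 (by positivity)
    generalize n ^ σ.reg rMB * 2 ^ σ.reg rM = D at ht hD ⊢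
    have hsum : σ.reg rMB + σ.reg rM ≤ 2 * n := by omega
    have h5 : (2 * c + 124) * (n + 1) ^ 2 + (σ.reg rMB + σ.reg rM) * 10 + 4 ≤
        (2 * c + 148) * (n + 1) ^ 2 := by nlinarith
    have h6 : (σ.reg rMB + σ.reg rM) * 5 + 7 ≤ 22 * (n + 1) ^ 2 := by nlinarith
    have h7 := Nat.mul_le_mul_left D h5
    have h8 := Nat.mul_le_mul hD h6
    calc t₁ + t ≤ D * ((2 * c + 148) * (n + 1) ^ 2) + D * (22 * (n + 1) ^ 2) := by omega
      _ = _ := by ring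

end Visit

/-! ### Stages of the deletion process and the total running time -/

section Core

variable {n s : ℕ} {G : SimpleGraph (Fin n)} {J : Set (Finset (Fin n)) → State → Prop}
  {emit : Prog} {c : ℕ}

theorem Extends.mono {V : Type*} [DecidableEq V] {G : SimpleGraph V} {X : Finset V} {R : List V}
    {P Q : Set (Finset V)} (h : Extends G s X R P) (hPQ : P ⊆ Q) : Extends G s X R Q :=
  ⟨fun A hA B hB hAB => hPQ (h.defective A hA B hB hAB),
    fun A hA h0 R₁ R₂ h1 h2 => hPQ (h.clique A hA h0 R₁ R₂ h1 h2)⟩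

/-- Treat all candidates for the vertex `rV`. -/
def visitAll (emit : Prog) : Prog := .forLoop rU rN (buildCand ;; visit emit)

theorem notMem_regs_visitAll {x : ℕ} (h : x ∉ emit.regs)
    (hx : x ∉ (visitAll .skip).regs) : x ∉ (visitAll emit).regs := by
  simp only [visitAll, Prog.forLoop, visit, Prog.regs, List.mem_append, not_or] at hx ⊢
  exact ⟨⟨hx.1.1, hx.1.2.1, notMem_regs_odometer h hx.1.2.2⟩, hx.2⟩

theorem notMem_arrs_visitAll {x : ℕ} (h : x ∉ emit.arrs)
    (hx : x ∉ (visitAll .skip).arrs) : x ∉ (visitAll emit).arrs := by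
  simp only [visitAll, Prog.forLoop, visit, Prog.arrs, List.mem_append, not_or] at hx ⊢
  exact ⟨⟨hx.1.1, hx.1.2.1, notMem_arrs_odometer h hx.1.2.2⟩, hx.2⟩

theorem notMem_regs_visit {x : ℕ} (h : x ∉ emit.regs)
    (hx : x ∉ (buildCand ;; visit .skip).regs) : x ∉ (buildCand ;; visit emit).regs := by
  simp only [visit, Prog.regs, List.mem_append, not_or] at hx ⊢
  exact ⟨hx.1, hx.2.1, notMem_regs_odometer h hx.2.2⟩

variable [DecidableRel G.Adj]

theorem ter_visitAll (he : EmitSpec G s J emit c) {σ : State} (hc : Ctx n s σ) {X : Finset (Fin n)}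
    {R : List (Fin n)} {v : Fin n} {g : ℕ} (hX : IsChar (σ.arr aAlive) X) (hv : σ.reg rV = v)
    (hg : Bounds G X v g) (hs : 2 ≤ s) (hl : σ.reg rMB = min (s - 1) n)
    (hR : Deleted R σ) (hR0 : R ≠ []) {P : Set (Finset (Fin n))}
    (hP : ∀ S ∈ P, IsDefectiveClique G s S) (hJ : J P σ) (hU : σ.reg rU = 0) :
    Ter G (visitAll emit) σ fun τ t =>
      t ≤ n * (n ^ (min (s - 1) n) * 2 ^ g * ((2 * c + 170) * (n + 1) ^ 2) + 10 * n + 12) + 1 ∧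
      ∃ Q, P ⊆ Q ∧ (∀ S ∈ Q, IsDefectiveClique G s S) ∧ J Q τ ∧
        ∀ u, Extends G s (cand G X v u) R Q := by
  have hn : 0 < n := by
    have h1 := v.2
    omega
  refine (Ter.forLoop
    (c := n ^ (min (s - 1) n) * 2 ^ g * ((2 * c + 170) * (n + 1) ^ 2) + 10 * n + 10)
    (fun k ρ => ∃ Q, P ⊆ Q ∧ (∀ S ∈ Q, IsDefectiveClique G s S) ∧ J Q ρ ∧
      ∀ u : Fin n, (u : ℕ) < k → Extends G s (cand G X v u) R Q)
    (notMem_regs_visit (he.notMem_regs (by decide)) (by decide)) ?_ ?_ ?_).mono ?_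
  · rw [List.mem_cons, not_or]
    exact ⟨by decide, notMem_regs_visit (he.notMem_regs (by decide)) (by decide)⟩
  · exact ⟨P, subset_rfl, hP, hJ, fun u hu => by omega⟩
  · rintro k ρ - hk hUk ha ⟨Q, h1, h2, h3, h4⟩
    rw [hc.hN] at hk
    lift k to Fin n using hk
    have hreg : ∀ x, x < 30 → x ∉ (visitAll .skip).regs → ρ.reg x = σ.reg x :=
      fun x hx hx' => ha.reg x (notMem_regs_visitAll (he.notMem_regs hx) hx')
    have harr : ∀ x, x < 10 → x ∉ (visitAll .skip).arrs → ρ.arr x = σ.arr x :=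
      fun x hx hx' => ha.arr x (notMem_arrs_visitAll (he.notMem_arrs hx) hx')
    have cρ : Ctx n s ρ := hc.agree ha fun x hx => notMem_regs_visitAll (he.notMem_regs (by
      simp only [List.mem_cons, List.not_mem_nil, or_false] at hx
      omega)) (by
        revert x
        decide)
    refine (ter_buildCand cρ (X := X) (v := v) (u := k)
      (by rwa [harr aAlive (by decide) (by decide)])
      (by rwa [hreg rV (by decide) (by decide)]) hUk).bind ?_
    rintro ρ₁ t₁ ⟨ht₁, hC⟩ a₁
    have c₁ := cρ.agree a₁ (by decide)
    have mb₁ := (a₁.reg rMB (by decide)).trans (hreg rMB (by decide) (by decide))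
    have top₁ := (a₁.reg rTop (by decide)).trans (hreg rTop (by decide) (by decide))
    have ord₁ := (a₁.arr aOrd (by decide)).trans (harr aOrd (by decide) (by decide))
    refine (ter_visit he c₁ (R := R) (by omega) (by omega) hC
      ⟨by rw [top₁]; exact hR.top, by rw [top₁, ord₁]; exact hR.ord⟩ hR0 h2
      (he.agree a₁ (by decide) (by decide) (by decide) h3)).mono ?_
    rintro τ t ⟨ht, Q', g1, g2, g3, g4⟩
    refine ⟨?_, Q', h1.trans g1, g2, ?_, fun u hu => ?_⟩
    · have : n ^ (min (s - 1) n) * 2 ^ (cand G X v k).card * ((2 * c + 170) * (n + 1) ^ 2) ≤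
          n ^ (min (s - 1) n) * 2 ^ g * ((2 * c + 170) * (n + 1) ^ 2) := by
        have h5 := hg k
        gcongr
        norm_num
      omega
    · exact he.stable _ τ _ (fun x hx => by
        rw [State.set_reg, if_neg (by omega)]) (fun _ _ => rfl) rfl g3
    · rcases Nat.lt_succ_iff_lt_or_eq.1 hu with h | h
      · exact (h4 u h).mono g1
      · rwa [Fin.ext h]
  · rintro τ t ⟨ht, ⟨Q, h1, h2, h3, h4⟩, -⟩
    rw [hU, hc.hN] at ht h4
    refine ⟨?_, Q, h1, h2, h3, fun u => h4 u (by simp)⟩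
    simp only [add_assoc, Nat.reduceAdd, Nat.sub_zero] at ht ⊢
    exact ht

/-- Delete the next vertex. -/
def stage (emit : Prog) : Prog :=
  pick ;; .dec rTop ;; .store aOrd rTop rV ;; .const rU 0 ;; visitAll emit ;;
    .store aAlive rV rZero

theorem notMem_regs_stage {x : ℕ} (h : x ∉ emit.regs)
    (hx : x ∉ (stage .skip).regs) : x ∉ (stage emit).regs := by
  simp only [stage, Prog.regs, List.mem_append, not_or] at hx ⊢
  exact ⟨hx.1, hx.2.1, hx.2.2.1, hx.2.2.2.1, notMem_regs_visitAll h hx.2.2.2.2.1, hx.2.2.2.2.2⟩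

variable (G) in
/-- The state after the vertices in `R` have been deleted. -/
structure StageInv (s : ℕ) (J : Set (Finset (Fin n)) → State → Prop) (R : List (Fin n))
    (P : Set (Finset (Fin n))) (σ : State) : Prop where
  nodup : R.Nodup
  deleted : Deleted R σ
  alive : IsChar (σ.arr aAlive) R.toFinsetᶜ
  defective : ∀ S ∈ P, IsDefectiveClique G s S
  treated : J P σ
  extends' : ∀ L v R', L ++ v :: R' = R → ∀ u, Extends G s (cand G R'.toFinsetᶜ v u) (v :: R') P

/-- The vertex enters `aOrd` before the visits, because the extensions must offer it again, but
leaves `aAlive` only afterwards, because the candidates are taken in the set that still contains it.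
-/
theorem ter_stage (he : EmitSpec G s J emit c) {γ : ℕ} (hG : IsWeaklyClosed G γ) {σ : State}
    (hc : Ctx n s σ) (hs : 2 ≤ s) (hl : σ.reg rMB = min (s - 1) n) {R : List (Fin n)}
    {P : Set (Finset (Fin n))} (h : StageInv G s J R P σ) (hR : R.length < n) :
    Ter G (stage emit) σ fun τ t =>
      t ≤ n * (n ^ (min (s - 1) n) * 2 ^ (γ + 1) * ((2 * c + 170) * (n + 1) ^ 2)) +
        50 * (n + 1) ^ 3 ∧ τ.reg rMB = min (s - 1) n ∧
      ∃ v Q, StageInv G s J (v :: R) Q τ := by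
  have hne : R.toFinsetᶜ.Nonempty := by
    rw [← Finset.card_pos, Finset.card_compl, List.toFinset_card_of_nodup h.nodup,
      Fintype.card_fin]
    omega
  refine (ter_pick hc h.alive (g := γ + 1) (hG.exists_card_cand_le hne)).bind ?_
  rintro ρ₁ t₁ ⟨ht₁, v, hvX, hv, hb⟩ a₁
  have c₁ := hc.agree a₁ (by decide)
  have mb₁ := a₁.reg rMB (by decide)
  have top₁ := a₁.reg rTop (by decide)
  have ord₁ := a₁.arr aOrd (by decide)
  have alive₁ := a₁.arr aAlive (by decide)
  have J₁ := he.agree a₁ (by decide) (by decide) (by decide) h.treated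
  have htop := h.deleted.top
  rw [ter_seq, ter_dec, ter_seq, ter_store, ter_seq, ter_const]
  refine (ter_visitAll he (X := R.toFinsetᶜ) (R := v :: R) (v := v) (g := γ + 1)
    (((c₁.set _ (by decide)).setArr _ _ _).set _ (by decide)) ?_ (by simpa using hv) hb hs
    (by simpa [mb₁] using hl) ?_ (by simp) h.defective ?_ (by simp)).bind ?_
  · intro i
    simpa [alive₁] using h.alive i
  · refine ⟨?_, ?_⟩
    · simp [top₁]
      omega
    · intro j hj
      cases j with
      | zero => simp [hv]
      | succ j =>
        have := h.deleted.ord j (by simpa using hj)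
        rw [show σ.reg rTop + j = σ.reg rTop - 1 + (j + 1) by omega] at this
        simp [top₁, ord₁, this]
  · refine he.stable _ ρ₁ _ (fun x hx => ?_) (fun a ha => ?_) rfl J₁
    · simp
      split_ifs <;> first | rfl | omega
    · funext j
      simp
      omega
  rintro ρ₂ t₂ ⟨ht₂, Q, h1, h2, h3, h4⟩ a₂
  have hreg : ∀ x, x < 30 → x ∉ (visitAll .skip).regs → _ :=
    fun x hx hx' => a₂.reg x (notMem_regs_visitAll (he.notMem_regs hx) hx')
  have harr : ∀ x, x < 10 → x ∉ (visitAll .skip).arrs → _ :=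
    fun x hx hx' => a₂.arr x (notMem_arrs_visitAll (he.notMem_arrs hx) hx')
  have e1 := hreg rMB (by decide) (by decide)
  have e2 := hreg rV (by decide) (by decide)
  have e3 := hreg rZero (by decide) (by decide)
  have e4 := hreg rTop (by decide) (by decide)
  have e5 := harr aAlive (by decide) (by decide)
  have e6 := harr aOrd (by decide) (by decide)
  simp [mb₁, hl, hv, c₁.hZ, top₁] at e1 e2 e3 e4
  rw [ter_store]
  refine ⟨?_, by simpa using e1, v, Q, ?_, ⟨?_, ?_⟩, ?_, h2, ?_, ?_⟩
  · generalize n ^ (min (s - 1) n) * 2 ^ (γ + 1) * ((2 * c + 170) * (n + 1) ^ 2) = D at ht₂ ⊢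
    nlinarith
  · exact List.nodup_cons.2 ⟨by simpa using hvX, h.nodup⟩
  · simp [e4]
    omega
  · intro j hj
    cases j with
    | zero => simp [e4, e6, top₁, hv]
    | succ j =>
      have := h.deleted.ord j (by simpa using hj)
      rw [show σ.reg rTop + j = σ.reg rTop - 1 + (j + 1) by omega] at this
      simp [e4, e6, top₁, ord₁, this]
  · intro i
    have := h.alive i
    rw [compl_cons]
    by_cases hiv : i = v
    · simp [e2, e3, hiv]
    · have hiv' : (i : ℕ) ≠ v := fun h' => hiv (Fin.ext h')
      simpa [e2, e3, e5, hiv, hiv', alive₁] using this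
  · refine he.stable _ ρ₂ _ (fun x hx => rfl) (fun a ha => ?_) rfl h3
    funext j
    simp
    omega
  · intro L w R' hL u
    cases L with
    | nil =>
      obtain ⟨rfl, rfl⟩ := List.cons_eq_cons.1 hL
      exact h4 u
    | cons x L => exact (h.extends' L w R' (List.cons_eq_cons.1 hL).2 u).mono h1

/-- Set up the constants, and make all vertices alive. -/
def setup : Prog :=
  .const rZero 0 ;; .const rOne 1 ;; .const rTwo 2 ;; .copy rMB rN ;; .copy rT rS ;; .dec rT ;;
    .ite (.lt rT rMB) (.copy rMB rT) .skip ;; .copy rTop rN ;; .const rStage 0 ;; .const rJ 0 ;;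
    .forLoop rJ rN (.store aAlive rJ rOne)

-- Capping the number of vertex digits at n loses nothing, since B has at most n elements, and keeps
-- the odometer of length at most 2n even if s is huge.
omit [DecidableRel G.Adj] in
theorem ter_setup {σ : State} (hN : σ.reg rN = n) (hS : σ.reg rS = s) :
    Ter G setup σ fun τ t => t ≤ 3 * n + 12 ∧ Ctx n s τ ∧
      τ.reg rMB = min (s - 1) n ∧ τ.reg rTop = n ∧ τ.reg rStage = 0 ∧
      IsChar (τ.arr aAlive) (Finset.univ : Finset (Fin n)) := by
  have hloop : ∀ ρ : State, Ctx n s ρ → ρ.reg rMB = min (s - 1) n → ρ.reg rTop = n →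
      ρ.reg rStage = 0 → ρ.reg rJ = 0 →
      Ter G (.forLoop rJ rN (.store aAlive rJ rOne)) ρ fun τ t => t ≤ n * 3 + 1 ∧ Ctx n s τ ∧
        τ.reg rMB = min (s - 1) n ∧ τ.reg rTop = n ∧ τ.reg rStage = 0 ∧
        IsChar (τ.arr aAlive) (Finset.univ : Finset (Fin n)) := by
    intro ρ hc h1 h2 h3 h4
    refine (Ter.forLoop (c := 1) (fun k τ => ∀ j < k, τ.arr aAlive j = 1) (by decide) (by decide)
      (by simp [h4]) ?_).agree.mono ?_
    · intro k τ _ _ hk ha hI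
      simp [hk, (hc.agree ha (by decide)).hO]
      exact fun j hj hjk => hI j (by omega)
    · rintro τ t ⟨⟨ht, hI, -⟩, ha⟩
      rw [h4, hc.hN] at ht hI
      exact ⟨ht, hc.agree ha (by decide), (ha.reg _ (by decide)).trans h1,
        (ha.reg _ (by decide)).trans h2, (ha.reg _ (by decide)).trans h3,
        fun i => by simpa using hI i (by simp)⟩
  unfold setup
  simp [hN, hS]
  constructor
  all_goals
    intro h
    refine (hloop _ ⟨by simp [hN], by simp [hS], by simp, by simp, by simp⟩ ?_ (by simp)
      (by simp) (by simp)).mono fun τ t ht => ⟨by omega, ht.2⟩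
    simp
    omega

/-- Treat a family of `s`-defective cliques that contains all maximal ones. -/
def enumeration (emit : Prog) : Prog := setup ;; .forLoop rStage rN (stage emit)

/-- There are n stages with n visits of cost D each, and D is of order 2^γ · n^(s+1). Choosing the
vertices costs O(n⁴) in total, which is within the bound. -/
theorem stages_bound {γ D : ℕ} (hn : 1 ≤ n) (hs : 2 ≤ s)
    (hD : D = n ^ (min (s - 1) n) * 2 ^ (γ + 1) * ((2 * c + 170) * (n + 1) ^ 2)) :
    n * (n * D + 50 * (n + 1) ^ 3 + 2) + 3 * n + 13 ≤
      (16 * c + 2640) * (2 ^ γ * n ^ (s + 3)) := by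
  have h1 : n ^ (min (s - 1) n) ≤ n ^ (s - 1) := Nat.pow_le_pow_right hn (min_le_left _ _)
  have h2 : (n + 1) ^ 2 ≤ 4 * n ^ 2 := by nlinarith
  have h3 : n * n * D ≤ (16 * c + 1360) * (2 ^ γ * n ^ (s + 3)) := by
    have h5 := Nat.mul_le_mul_left (n * n) (Nat.mul_le_mul (Nat.mul_le_mul_right (2 ^ (γ + 1)) h1)
      (Nat.mul_le_mul_left (2 * c + 170) h2))
    rw [← hD] at h5
    refine h5.trans (le_of_eq ?_)
    rw [show s + 3 = (s - 1) + 4 by omega, pow_add n (s - 1) 4]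
    ring
  have h4 : n ^ 4 ≤ 2 ^ γ * n ^ (s + 3) := by
    calc n ^ 4 ≤ n ^ (s + 3) := Nat.pow_le_pow_right hn (by omega)
      _ ≤ _ := Nat.le_mul_of_pos_left _ (by positivity)
  have h5 : n * (50 * (n + 1) ^ 3 + 2) + 3 * n + 13 ≤ 1280 * n ^ 4 := by
    obtain ⟨m, rfl⟩ := Nat.exists_eq_add_of_le hn
    ring_nf
    nlinarith [sq_nonneg m, Nat.zero_le (m ^ 3), Nat.zero_le (m ^ 4)]
  calc n * (n * D + 50 * (n + 1) ^ 3 + 2) + 3 * n + 13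
      = n * n * D + (n * (50 * (n + 1) ^ 3 + 2) + 3 * n + 13) := by ring
    _ ≤ (16 * c + 1360) * (2 ^ γ * n ^ (s + 3)) + 1280 * (2 ^ γ * n ^ (s + 3)) :=
        Nat.add_le_add h3 (h5.trans (Nat.mul_le_mul_left _ h4))
    _ = _ := by ring

theorem ter_enumeration (he : EmitSpec G s J emit c) {γ : ℕ} (hG : IsWeaklyClosed G γ)
    (hn : 1 ≤ n) (hs : 2 ≤ s) {σ : State} (hσn : σ.reg rN = n) (hσs : σ.reg rS = s)
    (hJ : J ∅ σ) :
    Ter G (enumeration emit) σ fun τ t => t ≤ (16 * c + 2640) * (2 ^ γ * n ^ (s + 3)) ∧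
      ∃ Q, (∀ S ∈ Q, IsDefectiveClique G s S) ∧ (∀ S, IsMaximalDefectiveClique G s S → S ∈ Q) ∧
        J Q τ := by
  have : Nonempty (Fin n) := ⟨⟨0, hn⟩⟩
  refine (ter_setup hσn hσs).bind ?_
  rintro ρ₁ t₁ ⟨ht₁, c₁, mb₁, top₁, stage₁, alive₁⟩ a₁
  have J₁ := he.agree a₁ (by decide) (by decide) (by decide) hJ
  refine (Ter.forLoop
    (c := n * (n ^ (min (s - 1) n) * 2 ^ (γ + 1) * ((2 * c + 170) * (n + 1) ^ 2)) +
        50 * (n + 1) ^ 3)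
    (fun k ρ => ρ.reg rMB = min (s - 1) n ∧ ∃ R Q, R.length = k ∧ StageInv G s J R Q ρ)
    (notMem_regs_stage (he.notMem_regs (by decide)) (by decide)) ?_ ?_ ?_).mono ?_
  · rw [List.mem_cons, not_or]
    exact ⟨by decide, notMem_regs_stage (he.notMem_regs (by decide)) (by decide)⟩
  · refine ⟨mb₁, [], ∅, stage₁.symm, List.nodup_nil, ⟨by simpa using top₁, by simp⟩,
      by simpa using alive₁, by simp, J₁, fun L v R' h => by simp at h⟩
  · rintro k ρ - hk hkρ ha ⟨h1, R, Q, h2, h3⟩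
    rw [c₁.hN] at hk
    have cρ : Ctx n s ρ := c₁.agree ha fun x hx => by
      have hx1 : x ∉ (stage emit).regs := notMem_regs_stage (he.notMem_regs (by
        simp only [List.mem_cons, List.not_mem_nil, or_false] at hx
        omega)) (by
          revert x
          decide)
      simp only [Prog.forLoop, Prog.regs, List.mem_append, not_or]
      refine ⟨hx1, ?_⟩
      clear hx1
      revert x
      decide
    refine (ter_stage he hG cρ hs h1 h3 (by omega)).mono ?_
    rintro τ t ⟨ht, g1, v, Q', g2⟩
    refine ⟨ht, by simpa using g1, v :: R, Q', by simp [h2], g2.nodup,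
      ⟨by simpa using g2.deleted.top, by simpa using g2.deleted.ord⟩,
      by simpa using g2.alive, g2.defective, ?_, g2.extends'⟩
    exact he.stable _ τ _ (fun x hx => by
      rw [State.set_reg, if_neg (by omega)]) (fun _ _ => rfl) rfl g2.treated
  · rintro τ t ⟨ht, ⟨-, R, Q, h1, h2⟩, -⟩
    rw [stage₁, c₁.hN] at ht h1
    simp only [Nat.sub_zero, Nat.zero_le, max_eq_right] at ht h1
    have hR : ∀ v, v ∈ R := fun v => by
      have : R.toFinset = Finset.univ := by
        rw [← Finset.card_eq_iff_eq_univ, List.toFinset_card_of_nodup h2.nodup, h1,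
          Fintype.card_fin]
      rw [← List.mem_toFinset, this]
      exact Finset.mem_univ v
    refine ⟨?_, Q, h2.defective, fun S hS =>
      mem_of_isMaximalDefectiveClique (by omega) hR h2.nodup h2.extends' hS, h2.treated⟩
    have := stages_bound (c := c) (γ := γ) hn hs rfl
    omega

end Core

/-! ### The decision problem -/

notation "rFound" => 40

section Decide

variable {n s : ℕ} {G : SimpleGraph (Fin n)}

/-- Note whether the current set has at least `rK` elements. -/
def testSize : Prog :=
  .const rC 0 ;; .const rW 0 ;;
    .forLoop rW rN (.load rT aSet rW ;; .ite (.eq rT rOne) (.inc rC) .skip) ;;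
    .ite (.lt rC rK) .skip (.const rFound 1)

/-- `rFound` lies outside the registers of the enumeration and is only ever raised, so it records
whether any treated set was large enough. -/
theorem emitSpec_testSize (k : ℕ) :
    EmitSpec G s (fun P σ => σ.reg rK = k ∧ σ.out = [] ∧
      σ.reg rFound ≤ 1 ∧ (σ.reg rFound = 1 ↔ ∃ S ∈ P, k ≤ S.card)) testSize 5 where
  regs := by decide
  arrs := by decide
  stable := by
    rintro P σ τ hr - ho ⟨h1, h2, h3⟩
    refine ⟨(hr _ (by decide)).trans h1, ho.trans h2, ?_⟩
    rwa [hr _ (by decide)]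
  run := by
    rintro P S σ hc hS - ⟨h1, h2, h3⟩
    have hrun : Ter G testSize σ fun τ t => t ≤ 5 * (n + 1) ^ 2 ∧
        τ.reg rFound = if k ≤ S.card then 1 else σ.reg rFound := by
      unfold testSize
      rw [ter_seq, ter_const, ter_seq, ter_const]
      have hc' := (hc.set (x := rC) 0 (by decide)).set (x := rW) 0 (by decide)
      refine (Ter.forLoop (c := 3) (fun j ρ => ρ.reg rC = (below (· ∈ S) j).card)
        (by decide) (by decide) (by simp [below_zero]) ?_).bind ?_
      · rintro j ρ - hj hW ha hI
        have hc₁ := hc'.agree ha (by decide)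
        have e := ha.arr aSet (by decide)
        simp [hc.hN] at hj e
        lift j to Fin n using hj
        have hSj := hS.1 j
        by_cases h : j ∈ S
        · rw [below_succ_pos h, Finset.card_insert_of_notMem (notMem_below _ j)]
          simp [hW, e, hSj, h, hc₁.hO, hI]
        · rw [below_succ_neg h]
          simp [hW, e, hSj, h, hc₁.hO, hI]
      · rintro ρ t ⟨ht, hI, -⟩ ha
        have e1 := ha.reg rK (by decide)
        have e2 := ha.reg rFound (by decide)
        simp [hc.hN, below_self, h1] at ht hI e1 e2
        simp [hI, e1, e2]
        exact ⟨fun h => ⟨by nlinarith, fun h' => by omega⟩,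
          fun h => ⟨by nlinarith, fun h' => by omega⟩⟩
    refine hrun.agree.mono ?_
    rintro τ t ⟨⟨ht, hf⟩, ha⟩
    refine ⟨ht, (ha.reg _ (by decide)).trans h1, (ha.out (by decide)).trans h2, ?_⟩
    rw [hf]
    split_ifs with h
    · exact ⟨le_rfl, fun _ => ⟨S, Set.mem_insert S P, h⟩, fun _ => rfl⟩
    · refine ⟨h3.1, h3.2.trans ⟨fun ⟨T, hT, hk⟩ => ⟨T, Set.mem_insert_of_mem S hT, hk⟩, ?_⟩⟩
      rintro ⟨T, rfl | hT, hk⟩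
      · exact absurd hk h
      · exact ⟨T, hT, hk⟩

theorem IsDefectiveClique.exists_maximal {S : Finset (Fin n)} (hS : IsDefectiveClique G s S) :
    ∃ T, S ⊆ T ∧ IsMaximalDefectiveClique G s T :=
  Finite.exists_le_maximal hS

/-- The program for the decision problem. -/
def decideProg : Prog := enumeration testSize ;; .print rFound

theorem decidesWithin {γ : ℕ} (hG : IsWeaklyClosed G γ) (hn : 1 ≤ n) (hs : 2 ≤ s) (k : ℕ) :
    DecidesWithin G s k decideProg (2721 * (2 ^ γ * n ^ (s + 3))) := by
  classical
  have h : Ter G decideProg (init [n, s, k]) fun τ t =>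
      τ.out = [if ∃ S : Finset (Fin n), k ≤ S.card ∧ IsDefectiveClique G s S then 1 else 0] ∧
        t ≤ 2721 * (2 ^ γ * n ^ (s + 3)) := by
    refine (ter_enumeration (emitSpec_testSize k) hG hn hs (by simp [init]) (by simp [init])
      (by simp [init])).bind ?_
    rintro ρ t ⟨ht, Q, hQ, hmax, -, hout, hle, hf⟩ -
    rw [ter_print, State.write_out, hout]
    -- The final print step is absorbed by raising 16 · 5 + 2640 to 2721.
    have hpos : 1 ≤ 2 ^ γ * n ^ (s + 3) := Nat.one_le_iff_ne_zero.2 (by positivity)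
    refine ⟨?_, by omega⟩
    rw [List.nil_append]
    congr 1
    split_ifs with h
    · obtain ⟨S, hk, hS⟩ := h
      obtain ⟨T, hST, hT⟩ := hS.exists_maximal
      exact hf.2 ⟨T, hmax T hT, hk.trans (Finset.card_le_card hST)⟩
    · have : ρ.reg rFound ≠ 1 := fun h' => by
        obtain ⟨S, hS, hk⟩ := hf.1 h'
        exact h ⟨S, hk, hQ S hS⟩
      omega
  obtain ⟨τ, t, hr, ho, ht⟩ := h
  unfold DecidesWithin PrintsWithin
  refine ⟨τ, t, hr, ?_, ht⟩
  rw [ho]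

end Decide

/-! ### Printing all maximal defective cliques once -/

notation "rCount" => 40
notation "rOk" => 41
notation "rPos" => 42
notation "rCur" => 43
notation "rNext" => 44
notation "rNew" => 45
/-- the children of the nodes of the trie of printed strings are in the arrays `10` and `11` -/
notation "aChild" => 10

/-- `f b a` is the child of the node `a` in direction `b` (`0` if there is none) in a trie with
the nodes `0, …, m`; `lab a` is the string that leads to `a`. -/
structure Trie (f : ℕ → ℕ → ℕ) (m : ℕ) (lab : ℕ → List ℕ) : Prop where
  root : lab 0 = []
  inj : ∀ a ≤ m, ∀ a' ≤ m, lab a = lab a' → a = a'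
  child : ∀ a ≤ m, ∀ b < 2, f b a ≠ 0 → f b a ≤ m ∧ lab (f b a) = lab a ++ [b]
  parent : ∀ a ≤ m, a ≠ 0 → ∃ a' ≤ m, ∃ b < 2, f b a' = a
  fresh : ∀ a, m < a → ∀ b < 2, f b a = 0

/-- The strings in a trie. -/
def strings (m : ℕ) (lab : ℕ → List ℕ) : Set (List ℕ) := {l | ∃ a ≤ m, lab a = l}

/-- The strings of a trie are closed under prefixes, and the node of a prefix has the expected
child. -/
theorem Trie.exists_parent {f : ℕ → ℕ → ℕ} {m : ℕ} {lab : ℕ → List ℕ} (h : Trie f m lab)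
    {a b : ℕ} {l : List ℕ} (ha : a ≤ m) (hl : lab a = l ++ [b]) :
    ∃ a' ≤ m, lab a' = l ∧ f b a' = a ∧ a ≠ 0 := by
  have ha0 : a ≠ 0 := by
    rintro rfl
    rw [h.root] at hl
    simp at hl
  obtain ⟨a', ha', b', hb', hf⟩ := h.parent a ha ha0
  have h1 := (h.child a' ha' b' hb' (by rwa [hf])).2
  rw [hf, hl] at h1
  obtain ⟨h2, h3⟩ := List.append_inj' h1 rfl
  simp only [List.cons.injEq, and_true] at h3
  exact ⟨a', ha', h2.symm, h3 ▸ hf, ha0⟩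

theorem Trie.notMem_strings {f : ℕ → ℕ → ℕ} {m : ℕ} {lab : ℕ → List ℕ} (h : Trie f m lab)
    {a b : ℕ} (ha : a ≤ m) (hf : f b a = 0) : lab a ++ [b] ∉ strings m lab := by
  rintro ⟨c, hc, hl⟩
  obtain ⟨a', ha', h1, h2, h3⟩ := h.exists_parent hc hl
  rw [h.inj a' ha' a ha h1, hf] at h2
  exact h3 h2.symm

/-- The new node m + 1 has no children by `fresh`, so its cells need no initialisation, and labels
stay distinct because the new label was not in the trie. -/
theorem Trie.add {f f' : ℕ → ℕ → ℕ} {m : ℕ} {lab : ℕ → List ℕ} (h : Trie f m lab)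
    {a b : ℕ} (ha : a ≤ m) (hb : b < 2) (hf : f b a = 0)
    (hf' : ∀ b' < 2, ∀ a', f' b' a' = if b' = b ∧ a' = a then m + 1 else f b' a') :
    Trie f' (m + 1) (Function.update lab (m + 1) (lab a ++ [b])) := by
  have hlab : ∀ c ≤ m, Function.update lab (m + 1) (lab a ++ [b]) c = lab c := fun c hc =>
    Function.update_of_ne (by omega) _ _
  have hnew : ∀ c ≤ m, lab c ≠ lab a ++ [b] := fun c hc hl =>
    h.notMem_strings ha hf ⟨c, hc, hl⟩
  constructor
  · rw [hlab 0 (by omega), h.root]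
  · intro c hc c' hc' heq
    rcases Nat.le_succ_iff.1 hc with h1 | rfl <;> rcases Nat.le_succ_iff.1 hc' with h2 | rfl
    · rw [hlab c h1, hlab c' h2] at heq
      exact h.inj c h1 c' h2 heq
    · rw [hlab c h1, Function.update_self] at heq
      exact absurd heq (hnew c h1)
    · rw [hlab c' h2, Function.update_self] at heq
      exact absurd heq.symm (hnew c' h2)
    · rfl
  · intro c hc b' hb' hne
    rw [hf' b' hb'] at hne ⊢
    split_ifs at hne ⊢ with hcond
    · obtain ⟨rfl, rfl⟩ := hcond
      rw [Function.update_self, hlab c ha]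
      exact ⟨le_rfl, rfl⟩
    · have hc' : c ≤ m := by
        by_contra hcm
        exact hne (h.fresh c (by omega) b' hb')
      obtain ⟨h1, h2⟩ := h.child c hc' b' hb' hne
      rw [hlab _ h1, hlab c hc', h2]
      exact ⟨by omega, rfl⟩
  · intro c hc hc0
    rcases Nat.le_succ_iff.1 hc with h1 | rfl
    · obtain ⟨a', ha', b', hb', hfc⟩ := h.parent c h1 hc0
      refine ⟨a', by omega, b', hb', ?_⟩
      rw [hf' b' hb', if_neg, hfc]
      rintro ⟨rfl, rfl⟩
      omega
    · exact ⟨a, by omega, b, hb, by rw [hf' b hb, if_pos ⟨rfl, rfl⟩]⟩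
  · intro c hc b' hb'
    rw [hf' b' hb', if_neg (by omega)]
    exact h.fresh c (by omega) b' hb'

theorem strings_update (m : ℕ) (lab : ℕ → List ℕ) (l : List ℕ) :
    strings (m + 1) (Function.update lab (m + 1) l) = insert l (strings m lab) := by
  ext x
  constructor
  · rintro ⟨a, ha, rfl⟩
    rcases Nat.le_succ_iff.1 ha with h | rfl
    · rw [Function.update_of_ne (by omega)]
      exact Or.inr ⟨a, h, rfl⟩
    · rw [Function.update_self]
      exact Or.inl rfl
  · rintro (rfl | ⟨a, ha, rfl⟩)
    · exact ⟨m + 1, le_rfl, Function.update_self _ _ _⟩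
    · exact ⟨a, by omega, Function.update_of_ne (by omega) _ _⟩

/-! ### Inserting characteristic vectors into the trie -/

section Emit

variable {n s : ℕ} {G : SimpleGraph (Fin n)}

/-- The state of the trie. -/
def HasTrie (lab : ℕ → List ℕ) (σ : State) : Prop :=
  Trie (fun b => σ.arr (aChild + b)) (σ.reg rCount) lab

/-- Go to the child of the current node in direction `b`, which is created if necessary. -/
def descend (b : ℕ) : Prog :=
  .load rNext (aChild + b) rCur ;; .ite (.eq rNext rZero)
    (.inc rCount ;; .copy rNext rCount ;; .store (aChild + b) rCur rNext ;; .const rNew 1) .skip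

theorem ter_descend {σ : State} (hc : Ctx n s σ) {lab : ℕ → List ℕ} (hT : HasTrie lab σ)
    (hcur : σ.reg rCur ≤ σ.reg rCount) {b : ℕ} (hb : b < 2) :
    Ter G (descend b) σ fun τ t => t ≤ 6 ∧ ∃ lab', HasTrie lab' τ ∧
      τ.reg rNext ≤ τ.reg rCount ∧ lab' (τ.reg rNext) = lab (σ.reg rCur) ++ [b] ∧
      (τ.reg rNew = σ.reg rNew ∧
          strings (τ.reg rCount) lab' = strings (σ.reg rCount) lab ∨
        τ.reg rNew = 1 ∧ lab (σ.reg rCur) ++ [b] ∉ strings (σ.reg rCount) lab ∧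
          strings (τ.reg rCount) lab' =
            insert (lab (σ.reg rCur) ++ [b]) (strings (σ.reg rCount) lab)) := by
  unfold descend
  by_cases h : σ.arr (aChild + b) (σ.reg rCur) = 0
  · simp [h, hc.hZ]
    refine ⟨Function.update lab (σ.reg rCount + 1) (lab (σ.reg rCur) ++ [b]), ?_, ?_, ?_⟩
    · unfold HasTrie
      simp only [State.set_reg, State.setArr_reg, Nat.reduceEqDiff, ↓reduceIte]
      exact hT.add hcur hb h fun b' _ a' => by
        by_cases h1 : b' = b <;> by_cases h2 : a' = σ.reg rCur <;> simp [h1, h2]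
    · simp
    · exact Or.inr ⟨hT.notMem_strings hcur h, strings_update _ _ _⟩
  · simp [h, hc.hZ]
    obtain ⟨h1, h2⟩ := hT.child _ hcur b hb h
    exact ⟨lab, hT, h1, h2, Or.inl rfl⟩

/-- Insert the characteristic vector of the current set into the trie; `rNew` tells whether it
is new. -/
def insertTrie : Prog :=
  .const rCur 0 ;; .const rNew 0 ;; .const rPos 0 ;; .forLoop rPos rN
    (.load rT aSet rPos ;; .ite (.eq rT rOne) (descend 1) (descend 0) ;; .copy rCur rNext)

theorem length_charVec (S : Finset (Fin n)) : (charVec S).length = n := by simp [charVec]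

theorem take_charVec_succ (S : Finset (Fin n)) (k : Fin n) :
    (charVec S).take (k + 1) = (charVec S).take k ++ [if k ∈ S then 1 else 0] := by
  have h : (k : ℕ) < (charVec S).length := by simp [charVec]
  rw [← List.take_concat_get' _ _ h]
  simp [charVec]

theorem charVec_injective : Function.Injective (charVec (n := n)) := by
  intro S T h
  have h' := List.ofFn_injective h
  ext i
  have := congrFun h' i
  by_cases h1 : i ∈ S <;> by_cases h2 : i ∈ T <;> simp [h1, h2] at this ⊢

theorem ter_insertTrie {σ : State} (hc : Ctx n s σ) {S : Finset (Fin n)}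
    (hS : IsChar (σ.arr aSet) S) {lab : ℕ → List ℕ} (hT : HasTrie lab σ) :
    Ter G insertTrie σ fun τ t => t ≤ 12 * n + 4 ∧ ∃ lab', HasTrie lab' τ ∧
      (τ.reg rNew = 0 ∧ charVec S ∈ strings (σ.reg rCount) lab ∧
          strings (τ.reg rCount) lab' = strings (σ.reg rCount) lab ∨
        τ.reg rNew = 1 ∧ charVec S ∉ strings (σ.reg rCount) lab ∧
          ∀ l, l.length = n → (l ∈ strings (τ.reg rCount) lab' ↔
            l = charVec S ∨ l ∈ strings (σ.reg rCount) lab)) := by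
  unfold insertTrie
  rw [ter_seq, ter_const, ter_seq, ter_const, ter_seq, ter_const]
  have hc' : Ctx n s (((σ.set rCur 0).set rNew 0).set rPos 0) :=
    ((hc.set _ (by decide)).set _ (by decide)).set _ (by decide)
  -- Either every prefix so far was already present and the trie is unchanged, or the current prefix
  -- is new and only prefixes of the vector have been added.
  refine (Ter.forLoop (c := 9) (fun k ρ => ∃ lab', HasTrie lab' ρ ∧
    ρ.reg rCur ≤ ρ.reg rCount ∧ lab' (ρ.reg rCur) = (charVec S).take k ∧
    (ρ.reg rNew = 0 ∧ strings (ρ.reg rCount) lab' = strings (σ.reg rCount) lab ∧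
        (∀ j ≤ k, (charVec S).take j ∈ strings (σ.reg rCount) lab) ∨
      ρ.reg rNew = 1 ∧ (charVec S).take k ∉ strings (σ.reg rCount) lab ∧
        ∀ l, (l ∈ strings (ρ.reg rCount) lab' ↔
          (∃ j ≤ k, l = (charVec S).take j) ∨ l ∈ strings (σ.reg rCount) lab)))
    (by decide) (by decide) ?_ ?_).mono ?_
  · refine ⟨lab, by simpa [HasTrie] using hT, by simp, by simpa using hT.root,
      Or.inl ⟨by simp, by simp, fun j hj => ⟨0, by simp, ?_⟩⟩⟩
    have : j = 0 := by simpa using hj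
    rw [this, hT.root, List.take_zero]
  · rintro k ρ - hk hPos ha ⟨lab', h1, h2, h3, h4⟩
    have hcρ := hc'.agree ha (by decide)
    rw [hc'.hN] at hk
    lift k to Fin n using hk
    have e := ha.arr aSet (by decide)
    have hSk : ρ.arr aSet k = if k ∈ S then 1 else 0 := by
      rw [e]
      exact hS k
    rw [ter_seq, ter_load, hPos, hSk]
    have hb : (if k ∈ S then 1 else 0) < 2 := by split_ifs <;> omega
    have key := ter_descend (G := G) (σ := ρ.set rT (if k ∈ S then 1 else 0))
      (hcρ.set _ (by decide)) (lab := lab') (by simpa [HasTrie] using h1) (by simpa using h2) hb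
    have hd : Ter G (.ite (.eq rT rOne) (descend 1) (descend 0))
        (ρ.set rT (if k ∈ S then 1 else 0)) fun τ t => t ≤ 7 ∧ ∃ lab₂, HasTrie lab₂ τ ∧
        τ.reg rNext ≤ τ.reg rCount ∧ lab₂ (τ.reg rNext) = (charVec S).take (k + 1) ∧
        (τ.reg rNew = ρ.reg rNew ∧
            strings (τ.reg rCount) lab₂ = strings (ρ.reg rCount) lab' ∨
          τ.reg rNew = 1 ∧ (charVec S).take (k + 1) ∉ strings (ρ.reg rCount) lab' ∧
            strings (τ.reg rCount) lab₂ =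
              insert ((charVec S).take (k + 1)) (strings (ρ.reg rCount) lab')) := by
      rw [take_charVec_succ, ← h3]
      rw [ter_ite]
      simp only [State.set_reg, Nat.reduceEqDiff, ↓reduceIte] at key
      by_cases hkS : k ∈ S
      · simp only [hkS, ↓reduceIte] at key ⊢
        refine ⟨fun _ => key.mono fun τ t h => ⟨by omega, h.2⟩, fun h => absurd ?_ h⟩
        simp [hcρ.hO]
      · simp only [hkS, ↓reduceIte] at key ⊢
        refine ⟨fun h => absurd h ?_, fun _ => key.mono fun τ t h => ⟨by omega, h.2⟩⟩
        simp [hcρ.hO]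
    refine hd.bind ?_
    rintro τ t ⟨ht, lab₂, g1, g2, g3, g4⟩ -
    rw [ter_copy]
    refine ⟨by omega, lab₂, by simpa [HasTrie] using g1, by simpa using g2, by simpa using g3, ?_⟩
    simp only [State.set_reg, Nat.reduceEqDiff, ↓reduceIte]
    have hlt : ∀ j ≤ (k : ℕ), (charVec S).take (k + 1) ≠ (charVec S).take j := by
      intro j hj heq
      have := congrArg List.length heq
      rw [List.length_take, List.length_take, length_charVec] at this
      have := k.2
      omega
    rcases g4 with ⟨g4, g5⟩ | ⟨g4, g5, g6⟩
    · rcases h4 with ⟨h4, h5, h6⟩ | ⟨h4, h5, h6⟩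
      · refine Or.inl ⟨g4.trans h4, g5.trans h5, fun j hj => ?_⟩
        rcases Nat.le_succ_iff.1 hj with h | rfl
        · exact h6 j h
        · rw [← h5, ← g5]
          exact ⟨_, g2, g3⟩
      -- Below a new prefix no child can exist: the longer string would be an added prefix of
      -- smaller length, or an old string, whose parent would make the shorter prefix old.
      · have hmem : (charVec S).take (k + 1) ∈ strings (ρ.reg rCount) lab' :=
          g5 ▸ ⟨_, g2, g3⟩
        rcases (h6 _).1 hmem with ⟨j, hj, heq⟩ | ⟨a, ha1, ha2⟩
        · exact absurd heq (hlt j hj)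
        · rw [take_charVec_succ] at ha2
          obtain ⟨a', ha', hl', -⟩ := hT.exists_parent ha1 ha2
          exact absurd ⟨a', ha', hl'⟩ h5
    · refine Or.inr ⟨g4, ?_, fun l => ?_⟩
      · intro hmem
        rcases h4 with ⟨h4, h5, h6⟩ | ⟨h4, h5, h6⟩
        · exact g5 (h5 ▸ hmem)
        · exact g5 ((h6 _).2 (Or.inr hmem))
      · rw [g6, Set.mem_insert_iff]
        have hle : (∃ j ≤ (k : ℕ) + 1, l = (charVec S).take j) ↔
            l = (charVec S).take (k + 1) ∨ ∃ j ≤ (k : ℕ), l = (charVec S).take j := by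
          constructor
          · rintro ⟨j, hj, rfl⟩
            rcases Nat.le_succ_iff.1 hj with h | rfl
            · exact Or.inr ⟨j, h, rfl⟩
            · exact Or.inl rfl
          · rintro (h | ⟨j, hj, h⟩)
            · exact ⟨_, le_rfl, h⟩
            · exact ⟨j, by omega, h⟩
        rw [hle, or_assoc]
        refine or_congr Iff.rfl ?_
        rcases h4 with ⟨h4, h5, h6⟩ | ⟨h4, h5, h6⟩
        · rw [h5]
          refine ⟨Or.inr, ?_⟩
          rintro (⟨j, hj, rfl⟩ | h)
          · exact h6 j hj
          · exact h
        · exact h6 l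
  · rintro τ t ⟨ht, ⟨lab', h1, h2, h3, h4⟩, -⟩
    have hn : max (((σ.set rCur 0).set rNew 0).set rPos 0 |>.reg rPos)
        (((σ.set rCur 0).set rNew 0).set rPos 0 |>.reg rN) = n := by simp [hc.hN]
    rw [hn] at h3 h4
    rw [List.take_of_length_le (length_charVec S).le] at h4
    simp [hc.hN] at ht
    refine ⟨by omega, lab', h1, ?_⟩
    rcases h4 with ⟨h4, h5, h6⟩ | ⟨h4, h5, h6⟩
    · have := h6 n le_rfl
      rw [List.take_of_length_le (length_charVec S).le] at this
      exact Or.inl ⟨h4, this, h5⟩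
    -- Proper prefixes were added as well; restricting to length n leaves only the vector itself.
    · refine Or.inr ⟨h4, h5, fun l hl => (h6 l).trans (or_congr ⟨?_, fun h => ?_⟩ Iff.rfl)⟩
      · rintro ⟨j, hj, rfl⟩
        rw [List.length_take, length_charVec] at hl
        rw [List.take_of_length_le (by rw [length_charVec]; omega)]
      · exact ⟨n, le_rfl, by rw [h, List.take_of_length_le (length_charVec S).le]⟩

end Emit

/-! ### Printing each maximal set once -/

section Enumerate

variable {n s : ℕ} {G : SimpleGraph (Fin n)}

/-- Test whether the current set is maximal. -/
def testMaximal : Prog :=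
  .const rOk 1 ;; .const rPos 0 ;; .forLoop rPos rN
    (.load rT aSet rPos ;; .ite (.eq rT rZero)
      (.copy rX rPos ;; countMiss ;; .ite (.lt rS rC) .skip (.const rOk 0)) .skip)

open Classical in
theorem ter_testMaximal {σ : State} (hc : Ctx n s σ) {S : Finset (Fin n)} (hS : Cur G S σ)
    (hd : IsDefectiveClique G s S) :
    Ter G testMaximal σ fun τ t => t ≤ n * (7 * n + 11) + 3 ∧
      (τ.reg rOk = 1 ↔ IsMaximalDefectiveClique G s S) := by
  unfold testMaximal
  rw [ter_seq, ter_const, ter_seq, ter_const]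
  have hc' := (hc.set (x := rOk) 1 (by decide)).set (x := rPos) 0 (by decide)
  refine (Ter.forLoop (c := 7 * n + 9) (fun k ρ => ρ.reg rOk = 1 ↔
    ∀ x : Fin n, (x : ℕ) < k → x ∉ S → ¬ IsDefectiveClique G s (insert x S))
    (by decide) (by decide) (by simp) ?_).mono ?_
  · rintro k ρ - hk hPos ha hI
    have c₁ := hc'.agree ha (by decide)
    rw [hc'.hN] at hk
    lift k to Fin n using hk
    have e1 := ha.arr aSet (by decide)
    have e2 := ha.reg rMiss (by decide)
    simp at e1 e2
    have hSk := hS.1 k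
    have hsucc : (∀ x : Fin n, (x : ℕ) < k + 1 → x ∉ S → ¬ IsDefectiveClique G s (insert x S)) ↔
        (∀ x : Fin n, (x : ℕ) < k → x ∉ S → ¬ IsDefectiveClique G s (insert x S)) ∧
          (k ∉ S → ¬ IsDefectiveClique G s (insert k S)) := by
      constructor
      · exact fun h => ⟨fun x hx => h x (by omega), h k (by omega)⟩
      · rintro ⟨h1, h2⟩ x hx
        rcases Nat.lt_succ_iff_lt_or_eq.1 hx with h | h
        · exact h1 x h
        · rwa [Fin.ext h]
    rw [hsucc, ← hI]
    by_cases h : k ∈ S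
    · simp [hPos, e1, hSk, h, c₁.hZ]
    · simp only [ter_seq, ter_load, ter_ite, hPos, e1, hSk, h, ↓reduceIte, ter_copy]
      refine ⟨fun _ => ?_, fun h => absurd ?_ h⟩
      · refine (ter_countMiss (S := S) (x := k) ((c₁.set _ (by decide)).set _ (by decide))
          (by simpa [e1] using hS.1) (by simp [hPos])).agree.mono ?_
        rintro τ t ⟨⟨ht, hC⟩, ha'⟩
        have c₂ := ((c₁.set _ (by decide)).set _ (by decide)).agree ha' (by decide)
        have e3 := ha'.reg rOk (by decide)
        simp [e2, hS.2] at hC e3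
        rw [← miss_insert h] at hC
        rw [isDefectiveClique_iff, ← hC]
        simp [c₂.hS, e3]
        omega
      · simp [c₁.hZ]
  · rintro τ t ⟨ht, hI, -⟩
    simp [hc.hN] at ht hI
    simp only [add_assoc, Nat.reduceAdd] at ht
    refine ⟨by omega, ?_⟩
    rw [hI, isMaximalDefectiveClique_iff]
    exact ⟨fun h => ⟨hd, h⟩, fun h => h.2⟩

/-- Print the characteristic vector of the current set. -/
def printSet : Prog := .const rPos 0 ;; .forLoop rPos rN (.load rT aSet rPos ;; .print rT)

theorem ter_printSet {σ : State} (hc : Ctx n s σ) {S : Finset (Fin n)}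
    (hS : IsChar (σ.arr aSet) S) :
    Ter G printSet σ fun τ t => t ≤ 4 * n + 2 ∧ τ.out = σ.out ++ charVec S := by
  unfold printSet
  rw [ter_seq, ter_const]
  refine (Ter.forLoop (c := 2) (fun k ρ => ρ.out = σ.out ++ (charVec S).take k)
    (by decide) (by decide) (by simp) ?_).mono ?_
  · rintro k ρ - hk hPos ha hI
    simp [hc.hN] at hk
    lift k to Fin n using hk
    have e1 := ha.arr aSet (by decide)
    simp at e1
    simp [hPos, e1, hS k, hI, take_charVec_succ]
  · rintro τ t ⟨ht, hI, -⟩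
    simp [hc.hN] at ht hI
    rw [List.take_of_length_le (length_charVec S).le] at hI
    exact ⟨by omega, hI⟩

/-- Print the current set if it is maximal and has not been printed before. -/
def printNew : Prog :=
  testMaximal ;; .ite (.eq rOk rOne)
    (insertTrie ;; .ite (.eq rNew rOne) printSet .skip) .skip

variable (G) in
/-- The maximal sets in `P` have been printed. -/
def Printed (s : ℕ) (P : Set (Finset (Fin n))) (σ : State) : Prop :=
  ∃ (L : List (Finset (Fin n))) (lab : ℕ → List ℕ), L.Nodup ∧
    (∀ S, S ∈ L ↔ S ∈ P ∧ IsMaximalDefectiveClique G s S) ∧ σ.out = L.flatMap charVec ∧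
    HasTrie lab σ ∧ ∀ S, S ∈ L ↔ charVec S ∈ strings (σ.reg rCount) lab

theorem hasTrie_congr {lab : ℕ → List ℕ} {σ τ : State} (h : HasTrie lab σ)
    (ha : ∀ b < 2, τ.arr (aChild + b) = σ.arr (aChild + b))
    (hr : τ.reg rCount = σ.reg rCount) : HasTrie lab τ := by
  unfold HasTrie at h ⊢
  rw [hr]
  refine ⟨h.root, h.inj, fun a h1 b hb => ?_, fun a h1 h2 => ?_, fun a h1 b hb => ?_⟩
  · simpa only [ha b hb] using h.child a h1 b hb
  · obtain ⟨a', h3, b, hb, h4⟩ := h.parent a h1 h2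
    exact ⟨a', h3, b, hb, by rw [ha b hb, h4]⟩
  · simpa only [ha b hb] using h.fresh a h1 b hb

/-- The maximality test is quadratic, and inserting into the trie and printing are linear; so
removing duplicates does not affect the order of the running time. -/
theorem emitSpec_printNew : EmitSpec G s (Printed G s) printNew 30 where
  regs := by decide
  arrs := by decide
  stable := by
    rintro P σ τ hr ha ho ⟨L, lab, h1, h2, h3, h4, h5⟩
    have hcount := hr rCount (by decide)
    refine ⟨L, lab, h1, h2, ho.trans h3, hasTrie_congr h4 (fun b _ => ha _ (by omega)) hcount, ?_⟩
    rwa [hcount]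
  run := by
    rintro P S σ hc hS hd ⟨L, lab, h1, h2, h3, h4, h5⟩
    unfold printNew
    refine (ter_testMaximal hc hS hd).bind ?_
    rintro ρ₁ t₁ ⟨ht₁, hok⟩ a₁
    have c₁ := hc.agree a₁ (by decide)
    have out₁ := a₁.out (by decide)
    have count₁ := a₁.reg rCount (by decide)
    have trie₁ := hasTrie_congr h4 (τ := ρ₁) (fun b hb => by
      interval_cases b <;> exact a₁.arr _ (by decide)) count₁
    have set₁ := a₁.arr aSet (by decide)
    rw [ter_ite, holds_eq, c₁.hO, hok]
    have hmem : ∀ T, T ∈ insert S P ∧ IsMaximalDefectiveClique G s T ↔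
        (T = S ∧ IsMaximalDefectiveClique G s S) ∨ T ∈ L := by
      intro T
      rw [h2, Set.mem_insert_iff]
      constructor
      · rintro ⟨rfl | h, h'⟩
        · exact Or.inl ⟨rfl, h'⟩
        · exact Or.inr ⟨h, h'⟩
      · rintro (⟨rfl, h⟩ | ⟨h, h'⟩)
        · exact ⟨Or.inl rfl, h⟩
        · exact ⟨Or.inr h, h'⟩
    constructor
    · intro hmax
      refine (ter_insertTrie c₁ (S := S) (by rw [set₁]; exact hS.1) trie₁).bind ?_
      rintro ρ₂ t₂ ⟨ht₂, lab₂, trie₂, hnew⟩ a₂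
      have c₂ := c₁.agree a₂ (by decide)
      have out₂ := (a₂.out (by decide)).trans out₁
      have set₂ := (a₂.arr aSet (by decide)).trans set₁
      rw [count₁] at hnew
      rw [ter_ite, holds_eq, c₂.hO]
      rcases hnew with ⟨hnew, hin, hstr⟩ | ⟨hnew, hin, hstr⟩
      · rw [hnew]
        refine ⟨fun h => absurd h (by decide), fun _ => ter_skip.2 ⟨by nlinarith, ?_⟩⟩
        have hSL : S ∈ L := (h5 S).2 hin
        refine ⟨L, lab₂, h1, fun T => ?_, out₂.trans h3, trie₂, fun T => ?_⟩
        · rw [hmem]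
          exact ⟨Or.inr, fun h => h.elim (fun h => h.1 ▸ hSL) id⟩
        · rw [hstr]
          exact h5 T
      · rw [hnew]
        refine ⟨fun _ => ?_, fun h => absurd rfl h⟩
        have hSL : S ∉ L := fun h => hin ((h5 S).1 h)
        refine (ter_printSet c₂ (S := S) (by rw [set₂]; exact hS.1)).agree.mono ?_
        rintro τ t ⟨⟨ht, hout⟩, a₃⟩
        have count₃ := a₃.reg rCount (by decide)
        refine ⟨by nlinarith, L ++ [S], lab₂, ?_, fun T => ?_, ?_, ?_, fun T => ?_⟩
        · rw [List.nodup_append]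
          refine ⟨h1, List.nodup_singleton S, fun a ha b hb h => hSL ?_⟩
          rw [← List.mem_singleton.1 hb, ← h]
          exact ha
        · rw [hmem, List.mem_append, List.mem_singleton, or_comm]
          simp [hmax]
        · rw [hout, out₂, h3]
          simp
        · exact hasTrie_congr trie₂ (fun b hb => by
            interval_cases b <;> exact a₃.arr _ (by decide)) count₃
        · rw [count₃, hstr _ (length_charVec T), List.mem_append, List.mem_singleton, h5 T,
            charVec_injective.eq_iff, or_comm]
    · intro hmax
      refine ter_skip.2 ⟨by nlinarith, L, lab, h1, fun T => ?_, out₁.trans h3, trie₁, ?_⟩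
      · rw [hmem]
        simp [hmax]
      · rwa [count₁]

/-- The initial trie contains the empty string, which for n = 0 would already be a characteristic
vector. -/
theorem printed_init (hn : 1 ≤ n) : Printed G s ∅ (init [n, s]) := by
  refine ⟨[], fun _ => [], List.nodup_nil, by simp, by simp [init], ?_, fun S => ?_⟩
  · constructor <;> simp [init]
  · simp only [List.not_mem_nil, false_iff]
    rintro ⟨a, -, h⟩
    have := congrArg List.length h
    rw [length_charVec] at this
    simp at this
    omega

theorem enumeratesWithin {γ : ℕ} (hG : IsWeaklyClosed G γ) (hn : 1 ≤ n) (hs : 2 ≤ s) :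
    EnumeratesWithin G s (enumeration printNew) (3120 * (2 ^ γ * n ^ (s + 3))) := by
  classical
  obtain ⟨τ, t, hr, ht, Q, -, hmax, L, lab, h1, h2, h3, -, -⟩ :=
    ter_enumeration emitSpec_printNew hG hn hs (by simp [init]) (by simp [init]) (printed_init hn)
  exact ⟨L, h1, fun S => (h2 S).trans ⟨fun h => h.2, fun h => ⟨hmax S h, h⟩⟩, τ, t, hr, h3, ht⟩

end Enumerate

end DefClique

theorem mainTheorem4 :
    (∃ C : ℕ, ∀ (V : Type*) [Fintype V] [Nonempty V] (G : SimpleGraph V) (γ s : ℕ),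
      2 ≤ s → DefClique.IsWeaklyClosed G γ →
        {S : Finset V | DefClique.IsMaximalDefectiveClique G s S}.ncard
          ≤ C * (2 ^ γ * Fintype.card V ^ (s + 1))) ∧
    (∃ (p : DefClique.Prog) (C : ℕ), ∀ (n : ℕ) (G : SimpleGraph (Fin n)) (γ s : ℕ),
      1 ≤ n → 2 ≤ s → DefClique.IsWeaklyClosed G γ →
        DefClique.EnumeratesWithin G s p (C * (2 ^ γ * n ^ (s + 3)))) ∧
    (∃ (p : DefClique.Prog) (C : ℕ), ∀ (n : ℕ) (G : SimpleGraph (Fin n)) (γ s k : ℕ),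
      1 ≤ n → 2 ≤ s → DefClique.IsWeaklyClosed G γ →
        DefClique.DecidesWithin G s k p (C * (2 ^ γ * n ^ (s + 3)))) :=
  ⟨⟨12, fun _ _ _ _ _ _ hs hG => DefClique.ncard_isMaximalDefectiveClique_le hs hG⟩,
    ⟨DefClique.enumeration DefClique.printNew, 3120,
      fun _ _ _ _ hn hs hG => DefClique.enumeratesWithin hG hn hs⟩,
    ⟨DefClique.decideProg, 2721,
      fun _ _ _ _ k hn hs hG => DefClique.decidesWithin hG hn hs k⟩⟩
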